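/- Let $d\ge 1$ and $s\ge 0$. For a multi-index $\alpha\in\mathbf N^d$ let $h_\alpha(x)=\pi^{-d/4}(-1)^{|\alpha|}(2^{|\alpha|}\alpha!)^{-1/2}e^{|x|^2/2}\,\partial^\alpha e^{-|x|^2}$ be the Hermite function on $\mathbf R^d$, and for $\alpha=(\alpha_1,\alpha_2)\in\mathbf N^d\times\mathbf N^d\simeq \mathbf N^{2d}$ let $$\varrho_{\alpha}(x,\xi)=(2\pi)^{-d/2}\int_{\mathbf R^d}h_{\alpha_1}\big(\tfrac y2-x\big)\,h_{\alpha_2}\big(\tfrac y2+x\big)\,e^{i\langle y,\xi\rangle}\,dy,\qquad (x,\xi)\in\mathbf R^{2d},$$ be the Hermite–Wong functions, which belong to the Schwartz space $\mathscr S(\mathbf R^{2d})$. On $\mathscr S(\mathbf R^{2d})$, with $X=(x,\xi)$ and $D=-i\partial$, let $$H_\sigma=|X|^2-\tfrac14\Delta_X+\langle\xi,D_x\rangle-\langle x,D_\xi\rangle,\qquad \bar H_\sigma=|X|^2-\tfrac14\Delta_X-\langle\xi,D_x\rangle+\langle x,D_\xi\rangle,\qquad T_\sigma=H_\sigma\circ\bar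 H_\sigma .$$ A formal expansion $\sum_{\alpha\in\mathbf N^{2d}}c_\alpha\varrho_\alpha$ is identified with its coefficient family $(c_\alpha)$ in $\mathbf C$; a function $a\in\mathscr S(\mathbf R^{2d})$ is identified with an expansion if the series converges to $a$ (unconditionally) in $\mathscr S(\mathbf R^{2d})$. For $s>0$ let - $\boldsymbol{\mathcal S}_{\sigma,s}$ ($\boldsymbol\Sigma_{\sigma,s}$) be the set of expansions with $|c_\alpha|\lesssim e^{-r|\alpha|^{1/(2s)}}$ for some $r>0$ (for every $r>0$); - $\boldsymbol{\mathcal S}'_{\sigma,s}$ ($\boldsymbol\Sigma'_{\sigma,s}$) be the set of expansions with $|c_\alpha|\lesssim e^{r|\alpha|^{1/(2s)}}$ for every $r>0$ (for some $r>0$). Further, $\boldsymbol{\mathcal S}_{\sigma,0}$ is the set of finite expansions, $\boldsymbol{\mathcal S}'_{\sigma,0}$ the set of all formal expansions, and $\boldsymbol\Sigma_{\sigma,0}=\{0\}$. For $s>0$ the spaces defined by "for some $r>0$" ("for every $r>0$") carry the locally convex inductive limit topology (the projective limit topology) of the corresponding Banach spaces of coefficient families with weighted supremum norms; $\boldsymbol{\mathcal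 S}_{\sigma,0}$ carries the locally convex inductive limit topology of the finite-dimensional spaces of expansions supported in $\{|\alpha|\le N\}$, and $\boldsymbol{\mathcal S}'_{\sigma,0}$ the topology of coefficientwise convergence. $\mathscr S'(\mathbf R^{2d})$ carries the weak-$*$ topology. Then the following is true. 1. Every $\varrho_{\alpha_1,\alpha_2}$ is non-zero, and $$H_\sigma\varrho_{\alpha_1,\alpha_2}=(2|\alpha_1|+d)\varrho_{\alpha_1,\alpha_2},\qquad \bar H_\sigma\varrho_{\alpha_1,\alpha_2}=(2|\alpha_2|+d)\varrho_{\alpha_1,\alpha_2},$$ $$T_\sigma\varrho_{\alpha_1,\alpha_2}=(2|\alpha_1|+d)(2|\alpha_2|+d)\varrho_{\alpha_1,\alpha_2}.$$ 2. Every expansion in $\boldsymbol{\mathcal S}_{\sigma,s}$ and in $\boldsymbol\Sigma_{\sigma,s}$ converges in $\mathscr S(\mathbf R^{2d})$, and $H_\sigma$ and $\bar H_\sigma$ restrict to linear homeomorphisms on $\boldsymbol{\mathcal S}_{\sigma,s}$ and on $\boldsymbol\Sigma_{\sigma,s}$. 3. Every $a\in\mathscr S(\mathbf R^{2d})$ has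 an expansion in $\boldsymbol{\mathcal S}'_{\sigma,s}$ and, if $s>0$, in $\boldsymbol\Sigma'_{\sigma,s}$; and each of $H_\sigma$ and $\bar H_\sigma$, defined on $\mathscr S(\mathbf R^{2d})$, extends to a linear homeomorphism on each of $\mathscr S'(\mathbf R^{2d})$, $\boldsymbol{\mathcal S}'_{\sigma,s}$ and, if $s>0$, $\boldsymbol\Sigma'_{\sigma,s}$. In each case this extension is the only continuous map of the space into itself that extends the operator. -/

import Mathlib

open MeasureTheory SchwartzMap
open scoped Real ENNReal Nat LineDeriv

noncomputable section

namespace TwistedPilipovic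

/-- The configuration space `ℝ^d`. -/
abbrev V (d : ℕ) : Type := EuclideanSpace ℝ (Fin d)

/-- The phase space `ℝ^{2d} ≃ ℝ^d × ℝ^d`, with points `X = (x, ξ) = (X.1, X.2)`. -/
abbrev Phase (d : ℕ) : Type := V d × V d

/-- The set `ℕ^{2d} ≃ ℕ^d × ℕ^d` of indices `α = (α₁, α₂)`. -/
abbrev Idx (d : ℕ) : Type := (Fin d → ℕ) × (Fin d → ℕ)

/-- The length `|α|` of a multi-index. -/
def len {d : ℕ} (α : Fin d → ℕ) : ℕ := ∑ j, α j

/-! ### Hermite functions and Hermite–Wong functions -/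

/-- The Hermite function of order `n` on `ℝ`:
`h_n(t) = π^{-1/4} (-1)^n (2^n n!)^{-1/2} e^{t²/2} (d/dt)^n e^{-t²}`. -/
def hermite₁ (n : ℕ) (t : ℝ) : ℝ :=
  π ^ (-(1 / 4) : ℝ) * (-1) ^ n * ((2 : ℝ) ^ n * (n ! : ℝ)) ^ (-(1 / 2) : ℝ) *
    Real.exp (t ^ 2 / 2) * iteratedDeriv n (fun u : ℝ => Real.exp (-u ^ 2)) t

/-- The Hermite function of order `α` on `ℝ^d`,
`h_α(x) = π^{-d/4} (-1)^{|α|} (2^{|α|} α!)^{-1/2} e^{|x|²/2} ∂^α e^{-|x|²}`; since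
`∂^α e^{-|x|²} = ∏_j (d/dx_j)^{α_j} e^{-x_j²}`, it is the product of the `h_{α_j}(x_j)`. -/
def hermiteFun {d : ℕ} (α : Fin d → ℕ) (x : V d) : ℝ := ∏ j, hermite₁ (α j) (x j)

/-- The Hermite–Wong function
`ϱ_α(x, ξ) = (2π)^{-d/2} ∫ h_{α₁}(y/2 - x) h_{α₂}(y/2 + x) e^{i⟨y,ξ⟩} dy`
(the Hermite functions are real valued, so there is no conjugation). -/
def hermiteWongFun {d : ℕ} (α : Idx d) (X : Phase d) : ℂ :=
  (((2 * π) ^ (-(d : ℝ) / 2) : ℝ) : ℂ) *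
    ∫ y : V d, ((hermiteFun α.1 ((1 / 2 : ℝ) • y - X.1) : ℝ) : ℂ) *
      ((hermiteFun α.2 ((1 / 2 : ℝ) • y + X.1) : ℝ) : ℂ) *
      Complex.exp (Complex.I * ((inner ℝ y X.2 : ℝ) : ℂ))

section HermiteWongSchwartz

theorem gaussian_pow_bound {b : ℝ} (hb : 0 < b) (N : ℕ) :
    ∃ C : ℝ, ∀ t : ℝ, 0 ≤ t → (1 + t) ^ N * Real.exp (-(b * t ^ 2)) ≤ C := by
  refine ⟨(N ! : ℝ) * Real.exp (1 + 1 / (4 * b)), fun t ht => ?_⟩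
  have h1 : (1 + t) ^ N ≤ (N ! : ℝ) * Real.exp (1 + t) := by
    have := Real.pow_div_factorial_le_exp (1 + t) (by linarith) N
    rw [div_le_iff₀ (by positivity)] at this
    linarith
  calc (1 + t) ^ N * Real.exp (-(b * t ^ 2))
      ≤ (N ! : ℝ) * Real.exp (1 + t) * Real.exp (-(b * t ^ 2)) := by gcongr
    _ = (N ! : ℝ) * Real.exp (1 + t - b * t ^ 2) := by
        rw [mul_assoc, ← Real.exp_add]; ring_nf
    _ ≤ _ := by
        gcongr
        have : t - b * t ^ 2 = 1 / (4 * b) - b * (t - 1 / (2 * b)) ^ 2 := by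
          field_simp; ring
        have h2 : 0 ≤ b * (t - 1 / (2 * b)) ^ 2 := by positivity
        linarith

/-- Gaussians are Schwartz functions. -/
theorem exists_gaussian {d : ℕ} {b : ℝ} (hb : 0 < b) :
    ∃ g : 𝓢(V d, ℝ), ∀ x, g x = Real.exp (-(b * ‖x‖ ^ 2)) := by
  have htg : (fun x : V d => -(b * ‖x‖ ^ 2)).HasTemperateGrowth :=
    ((Function.HasTemperateGrowth.const b).mul
      (Function.hasTemperateGrowth_norm_sq (V d))).neg
  refine ⟨⟨fun x => Real.exp (-(b * ‖x‖ ^ 2)), Real.contDiff_exp.comp htg.1, ?_⟩, fun x => rfl⟩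
  intro k n
  obtain ⟨m, C, hC, hbd⟩ := htg.norm_iteratedFDeriv_le_uniform n
  obtain ⟨M, hM⟩ := gaussian_pow_bound hb (k + m * n)
  refine ⟨(n ! : ℝ) * (C + 1) ^ n * M, fun x => ?_⟩
  have hx : (1 : ℝ) ≤ 1 + ‖x‖ := by linarith [norm_nonneg x]
  have hD1 : 1 ≤ (C + 1) * (1 + ‖x‖) ^ m :=
    one_le_mul_of_one_le_of_one_le (by linarith) (one_le_pow₀ hx)
  have key := norm_iteratedFDeriv_comp_le (𝕜 := ℝ) (g := Real.exp)
    (f := fun x : V d => -(b * ‖x‖ ^ 2)) (n := n) (N := n) Real.contDiff_exp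
    (htg.1.of_le (by exact_mod_cast le_top)) le_rfl x
    (C := Real.exp (-(b * ‖x‖ ^ 2))) (D := (C + 1) * (1 + ‖x‖) ^ m)
    (fun i _ => by
      rw [norm_iteratedFDeriv_eq_norm_iteratedDeriv, iteratedDeriv_eq_iterate,
        Real.iter_deriv_exp, Real.norm_eq_abs, abs_of_pos (Real.exp_pos _)])
    (fun i hi hin => by
      calc _ ≤ C * (1 + ‖x‖) ^ m := hbd i hin x
        _ ≤ (C + 1) * (1 + ‖x‖) ^ m := by gcongr; linarith
        _ ≤ _ := le_self_pow₀ hD1 (by omega))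
  calc ‖x‖ ^ k * _
      ≤ (1 + ‖x‖) ^ k *
        ((n ! : ℝ) * Real.exp (-(b * ‖x‖ ^ 2)) * ((C + 1) * (1 + ‖x‖) ^ m) ^ n) := by
        refine mul_le_mul (by gcongr; linarith) key (norm_nonneg _) (by positivity)
    _ = (n ! : ℝ) * (C + 1) ^ n *
        ((1 + ‖x‖) ^ (k + m * n) * Real.exp (-(b * ‖x‖ ^ 2))) := by
        rw [mul_pow, pow_add, pow_mul]; ring
    _ ≤ _ := by gcongr; exact hM _ (norm_nonneg _)

/-- Tensor products of Schwartz functions are Schwartz functions. -/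
theorem exists_tensor {E F : Type*} [NormedAddCommGroup E] [NormedSpace ℝ E]
    [NormedAddCommGroup F] [NormedSpace ℝ F] (f : 𝓢(E, ℂ)) (g : 𝓢(F, ℂ)) :
    ∃ h : 𝓢(E × F, ℂ), ∀ X, h X = f X.1 * g X.2 := by
  have hf : ContDiff ℝ (⊤ : ℕ∞) (fun X : E × F => f X.1) := (f.smooth _).comp contDiff_fst
  have hg : ContDiff ℝ (⊤ : ℕ∞) (fun X : E × F => g X.2) := (g.smooth _).comp contDiff_snd
  have bf : ∀ (X : E × F) (i : ℕ), ‖iteratedFDeriv ℝ i (fun X : E × F => f X.1) X‖ ≤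
      ‖iteratedFDeriv ℝ i f X.1‖ := by
    intro X i
    have := (ContinuousLinearMap.fst ℝ E F).iteratedFDeriv_comp_right (f := f)
      (f.smooth ⊤) X (i := i) (by exact_mod_cast le_top)
    change ‖iteratedFDeriv ℝ i (f ∘ (ContinuousLinearMap.fst ℝ E F)) X‖ ≤ _
    rw [this]
    refine (ContinuousMultilinearMap.norm_compContinuousLinearMap_le _ _).trans ?_
    refine mul_le_of_le_one_right (norm_nonneg _) ?_
    exact Finset.prod_le_one (fun _ _ => norm_nonneg _)
      fun _ _ => ContinuousLinearMap.norm_fst_le ℝ E F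
  have bg : ∀ (X : E × F) (i : ℕ), ‖iteratedFDeriv ℝ i (fun X : E × F => g X.2) X‖ ≤
      ‖iteratedFDeriv ℝ i g X.2‖ := by
    intro X i
    have := (ContinuousLinearMap.snd ℝ E F).iteratedFDeriv_comp_right (f := g)
      (g.smooth ⊤) X (i := i) (by exact_mod_cast le_top)
    change ‖iteratedFDeriv ℝ i (g ∘ (ContinuousLinearMap.snd ℝ E F)) X‖ ≤ _
    rw [this]
    refine (ContinuousMultilinearMap.norm_compContinuousLinearMap_le _ _).trans ?_
    refine mul_le_of_le_one_right (norm_nonneg _) ?_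
    exact Finset.prod_le_one (fun _ _ => norm_nonneg _)
      fun _ _ => ContinuousLinearMap.norm_snd_le ℝ E F
  refine ⟨⟨fun X => f X.1 * g X.2, hf.mul hg, ?_⟩, fun X => rfl⟩
  intro k n
  choose Cf hCf using f.decay
  choose Cg hCg using g.decay
  refine ⟨∑ i ∈ Finset.range (n + 1), (n.choose i : ℝ) *
    (Cf k i * Cg 0 (n - i) + Cf 0 i * Cg k (n - i)), fun X => ?_⟩
  have h1 := norm_iteratedFDeriv_mul_le (𝕜 := ℝ) hf hg X (n := n) (by exact_mod_cast le_top)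
  refine (mul_le_mul_of_nonneg_left h1 (by positivity)).trans ?_
  rw [Finset.mul_sum]
  refine Finset.sum_le_sum fun i _ => ?_
  have hk : ‖X‖ ^ k ≤ ‖X.1‖ ^ k + ‖X.2‖ ^ k := by
    rw [Prod.norm_def]
    rcases max_choice ‖X.1‖ ‖X.2‖ with h | h <;> rw [h]
    · linarith [pow_nonneg (norm_nonneg X.2) k]
    · linarith [pow_nonneg (norm_nonneg X.1) k]
  have hCf := fun k n => (hCf k n).2
  have hCg := fun k n => (hCg k n).2
  have e1 : ‖X.1‖ ^ k * ‖iteratedFDeriv ℝ i f X.1‖ ≤ Cf k i := hCf k i X.1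
  have e2 : ‖iteratedFDeriv ℝ i f X.1‖ ≤ Cf 0 i :=
    (one_mul _).symm.trans_le (by simpa only [pow_zero] using hCf 0 i X.1)
  have e3 : ‖X.2‖ ^ k * ‖iteratedFDeriv ℝ (n - i) g X.2‖ ≤ Cg k (n - i) := hCg k _ X.2
  have e4 : ‖iteratedFDeriv ℝ (n - i) g X.2‖ ≤ Cg 0 (n - i) :=
    (one_mul _).symm.trans_le (by simpa only [pow_zero] using hCg 0 (n - i) X.2)
  have p1 := norm_nonneg (iteratedFDeriv ℝ i f X.1)
  have p2 := norm_nonneg (iteratedFDeriv ℝ (n - i) g X.2)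
  calc ‖X‖ ^ k * ((n.choose i : ℝ) * ‖iteratedFDeriv ℝ i (fun X : E × F => f X.1) X‖ *
        ‖iteratedFDeriv ℝ (n - i) (fun X : E × F => g X.2) X‖)
      ≤ (‖X.1‖ ^ k + ‖X.2‖ ^ k) * ((n.choose i : ℝ) * ‖iteratedFDeriv ℝ i f X.1‖ *
        ‖iteratedFDeriv ℝ (n - i) g X.2‖) := by
        gcongr
        · exact bf X i
        · exact bg X _
    _ = (n.choose i : ℝ) *
        ((‖X.1‖ ^ k * ‖iteratedFDeriv ℝ i f X.1‖) * ‖iteratedFDeriv ℝ (n - i) g X.2‖ +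
        ‖iteratedFDeriv ℝ i f X.1‖ * (‖X.2‖ ^ k * ‖iteratedFDeriv ℝ (n - i) g X.2‖)) := by
        ring
    _ ≤ _ := by
        gcongr
        · exact (by positivity : (0 : ℝ) ≤ _).trans e1
        · exact p1.trans e2

/-- The functions `(x, y) ↦ p(x) q(y)` with `p`, `q` of temperate growth. -/
def tensorMonoid (d : ℕ) : Submonoid (Phase d → ℂ) where
  carrier := {G | ∃ p q : V d → ℂ, p.HasTemperateGrowth ∧ q.HasTemperateGrowth ∧
    ∀ X, G X = p X.1 * q X.2}
  one_mem' := ⟨fun _ => 1, fun _ => 1, .const 1, .const 1, fun X => by simp⟩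
  mul_mem' := by
    rintro G G' ⟨p, q, hp, hq, h⟩ ⟨p', q', hp', hq', h'⟩
    refine ⟨p * p', q * q', hp.mul hp', hq.mul hq', fun X => ?_⟩
    simp only [Pi.mul_apply, h, h']
    ring

theorem exists_partialFourier {d : ℕ} (G : Phase d → ℂ)
    (hG : G ∈ Algebra.adjoin ℂ (tensorMonoid d : Set (Phase d → ℂ))) :
    (∃ S : 𝓢(Phase d, ℂ), ∀ X, S X = ∫ y : V d, G (X.1, y) *
      ((Real.exp (-(1 * ‖X.1‖ ^ 2)) * Real.exp (-(1 / 4 * ‖y‖ ^ 2)) : ℝ) : ℂ) *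
      Complex.exp (Complex.I * ((inner ℝ y X.2 : ℝ) : ℂ))) ∧
    ∀ X : Phase d, Integrable fun y : V d => G (X.1, y) *
      ((Real.exp (-(1 * ‖X.1‖ ^ 2)) * Real.exp (-(1 / 4 * ‖y‖ ^ 2)) : ℝ) : ℂ) *
      Complex.exp (Complex.I * ((inner ℝ y X.2 : ℝ) : ℂ)) := by
  have hG' : G ∈ Submodule.span ℂ (tensorMonoid d : Set (Phase d → ℂ)) := by
    have : G ∈ Subalgebra.toSubmodule (Algebra.adjoin ℂ (tensorMonoid d : Set (Phase d → ℂ))) := hG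
    rwa [Algebra.adjoin_eq_span, Submonoid.closure_eq] at this
  clear hG
  induction hG' using Submodule.span_induction with
  | mem G h =>
    obtain ⟨p, q, hp, hq, h⟩ := h
    obtain ⟨g₁, hg₁⟩ := exists_gaussian (d := d) (b := 1) one_pos
    obtain ⟨g₂, hg₂⟩ := exists_gaussian (d := d) (b := 1 / 4) (by norm_num)
    let f₁ : 𝓢(V d, ℂ) := smulLeftCLM ℂ p (postcompCLM (𝕜 := ℝ) Complex.ofRealCLM g₁)
    let f₂ : 𝓢(V d, ℂ) := smulLeftCLM ℂ q (postcompCLM (𝕜 := ℝ) Complex.ofRealCLM g₂)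
    have hf₁ : ∀ x, f₁ x = p x * (Real.exp (-(1 * ‖x‖ ^ 2)) : ℝ) := fun x => by
      simp only [f₁, smulLeftCLM_apply_apply hp, postcompCLM_apply, hg₁, smul_eq_mul,
        Complex.ofRealCLM_apply]
    have hf₂ : ∀ x, f₂ x = q x * (Real.exp (-(1 / 4 * ‖x‖ ^ 2)) : ℝ) := fun x => by
      simp only [f₂, smulLeftCLM_apply_apply hq, postcompCLM_apply, hg₂, smul_eq_mul,
        Complex.ofRealCLM_apply]
    let L : V d ≃L[ℝ] V d := ContinuousLinearEquiv.smulLeft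
      (Units.mk0 (-(2 * π)⁻¹ : ℝ) (by simp [Real.pi_ne_zero]))
    obtain ⟨S, hS⟩ := exists_tensor f₁ (compCLMOfContinuousLinearEquiv ℂ L
      (FourierTransform.fourier f₂))
    have hform : ∀ (X : Phase d) (y : V d), G (X.1, y) *
        ((Real.exp (-(1 * ‖X.1‖ ^ 2)) * Real.exp (-(1 / 4 * ‖y‖ ^ 2)) : ℝ) : ℂ) *
        Complex.exp (Complex.I * ((inner ℝ y X.2 : ℝ) : ℂ)) =
        f₁ X.1 * (Complex.exp (Complex.I * ((inner ℝ y X.2 : ℝ) : ℂ)) * f₂ y) := by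
      intro X y
      rw [hf₁, hf₂, h, Complex.ofReal_mul]
      ring
    refine ⟨⟨S, fun X => ?_⟩, fun X => ?_⟩
    · simp_rw [hform X]
      rw [integral_const_mul, hS]
      congr 1
      rw [compCLMOfContinuousLinearEquiv_apply, Function.comp_apply, fourier_coe,
        Real.fourier_eq']
      refine integral_congr_ae (.of_forall fun y => ?_)
      simp only [smul_eq_mul]
      congr 2
      have : L X.2 = (-(2 * π)⁻¹ : ℝ) • X.2 := rfl
      rw [this, inner_smul_right, mul_comm Complex.I]
      congr 2
      field_simp
    · simp_rw [hform X]
      refine Integrable.const_mul ?_ _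
      refine f₂.integrable.bdd_mul (c := 1) (by fun_prop) (.of_forall fun y => ?_)
      rw [mul_comm, Complex.norm_exp_ofReal_mul_I]
  | zero => exact ⟨⟨0, fun X => by simp⟩, fun X => by simp⟩
  | add G G' _ _ ih ih' =>
    obtain ⟨⟨S, hS⟩, hi⟩ := ih
    obtain ⟨⟨S', hS'⟩, hi'⟩ := ih'
    refine ⟨⟨S + S', fun X => ?_⟩, fun X => ?_⟩
    · simp only [Pi.add_apply, add_mul]
      rw [integral_add (hi X) (hi' X), ← hS, ← hS']
      rfl
    · simp only [Pi.add_apply, add_mul]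
      exact (hi X).add (hi' X)
  | smul c G _ ih =>
    obtain ⟨⟨S, hS⟩, hi⟩ := ih
    refine ⟨⟨c • S, fun X => ?_⟩, fun X => ?_⟩
    · simp only [Pi.smul_apply, smul_eq_mul, mul_assoc]
      rw [integral_const_mul]
      simp only [← mul_assoc]
      rw [← hS]
      rfl
    · simp only [Pi.smul_apply, smul_eq_mul, mul_assoc]
      refine Integrable.const_mul ?_ _
      simpa only [mul_assoc] using hi X

theorem exists_hermite₁_poly (n : ℕ) :
    ∃ p : Polynomial ℝ, ∀ t, hermite₁ n t = p.eval t * Real.exp (-(t ^ 2 / 2)) := by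
  have h : ∃ p : Polynomial ℝ, ∀ t, iteratedDeriv n (fun u : ℝ => Real.exp (-u ^ 2)) t =
      p.eval t * Real.exp (-t ^ 2) := by
    induction n with
    | zero => exact ⟨1, fun t => by simp⟩
    | succ n ih =>
      obtain ⟨p, hp⟩ := ih
      refine ⟨Polynomial.derivative p - 2 * Polynomial.X * p, fun t => ?_⟩
      rw [iteratedDeriv_succ, funext hp]
      have h1 : HasDerivAt (fun u : ℝ => Real.exp (-u ^ 2))
          (Real.exp (-t ^ 2) * (-(2 * t))) t := by
        simpa using ((hasDerivAt_pow 2 t).neg).exp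
      have h2 := ((p.hasDerivAt t).mul h1).deriv
      change deriv (fun x => Polynomial.eval x p * Real.exp (-x ^ 2)) t = _ at h2
      rw [h2]
      simp
      ring
  obtain ⟨p, hp⟩ := h
  refine ⟨Polynomial.C (π ^ (-(1 / 4) : ℝ) * (-1) ^ n *
    ((2 : ℝ) ^ n * (n ! : ℝ)) ^ (-(1 / 2) : ℝ)) * p, fun t => ?_⟩
  rw [hermite₁, hp, Polynomial.eval_mul, Polynomial.eval_C]
  have : Real.exp (-(t ^ 2 / 2)) = Real.exp (t ^ 2 / 2) * Real.exp (-t ^ 2) := by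
    rw [← Real.exp_add]; ring_nf
  rw [this]
  ring

theorem coord_mem {d : ℕ} (j : Fin d) (ε : ℝ) :
    (fun X : Phase d => (((1 / 2 : ℝ) * X.2 j + ε * X.1 j : ℝ) : ℂ)) ∈
      Algebra.adjoin ℂ (tensorMonoid d : Set (Phase d → ℂ)) := by
  have hc : (fun x : V d => ((x j : ℝ) : ℂ)).HasTemperateGrowth :=
    (Complex.ofRealCLM.comp (EuclideanSpace.proj (𝕜 := ℝ) j)).hasTemperateGrowth
  have h1 : (fun X : Phase d => ((X.1 j : ℝ) : ℂ)) ∈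
      Algebra.adjoin ℂ (tensorMonoid d : Set (Phase d → ℂ)) :=
    Algebra.subset_adjoin ⟨fun x => ((x j : ℝ) : ℂ), fun _ => 1, hc, .const 1, fun X => by simp⟩
  have h2 : (fun X : Phase d => ((X.2 j : ℝ) : ℂ)) ∈
      Algebra.adjoin ℂ (tensorMonoid d : Set (Phase d → ℂ)) :=
    Algebra.subset_adjoin ⟨fun _ => 1, fun x => ((x j : ℝ) : ℂ), .const 1, hc, fun X => by simp⟩
  have := Subalgebra.add_mem _ (Subalgebra.smul_mem _ h2 (1 / 2 : ℂ))
    (Subalgebra.smul_mem _ h1 (ε : ℂ))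
  convert this using 1
  ext X
  simp

theorem poly_mem {d : ℕ} (p : Polynomial ℝ) (j : Fin d) (ε : ℝ) :
    (fun X : Phase d => ((p.eval ((1 / 2 : ℝ) * X.2 j + ε * X.1 j) : ℝ) : ℂ)) ∈
      Algebra.adjoin ℂ (tensorMonoid d : Set (Phase d → ℂ)) := by
  induction p using Polynomial.induction_on' with
  | add p q hp hq =>
    convert Subalgebra.add_mem _ hp hq using 1
    ext X
    simp
  | monomial n a =>
    convert Subalgebra.smul_mem _ (Subalgebra.pow_mem _ (coord_mem j ε) n) (a : ℂ) using 1
    ext X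
    simp

theorem exists_hermiteWong {d : ℕ} (α : Idx d) :
    ∃ S : 𝓢(Phase d, ℂ), ∀ X, S X = hermiteWongFun α X := by
  choose p hp using exists_hermite₁_poly
  let G : Phase d → ℂ :=
    (∏ j, fun X : Phase d => (((p (α.1 j)).eval ((1 / 2 : ℝ) * X.2 j + (-1) * X.1 j) : ℝ) : ℂ)) *
    ∏ j, fun X : Phase d => (((p (α.2 j)).eval ((1 / 2 : ℝ) * X.2 j + 1 * X.1 j) : ℝ) : ℂ)
  have hG : G ∈ Algebra.adjoin ℂ (tensorMonoid d : Set (Phase d → ℂ)) :=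
    Subalgebra.mul_mem _ (Subalgebra.prod_mem _ fun j _ => poly_mem _ j _)
      (Subalgebra.prod_mem _ fun j _ => poly_mem _ j _)
  obtain ⟨⟨S, hS⟩, -⟩ := exists_partialFourier G hG
  refine ⟨((((2 * π) ^ (-(d : ℝ) / 2) : ℝ) : ℂ)) • S, fun X => ?_⟩
  rw [IsSMulApply.smul_apply, hS, hermiteWongFun, smul_eq_mul]
  congr 1
  refine integral_congr_ae (.of_forall fun y => ?_)
  have e : Real.exp (-(1 * ‖X.1‖ ^ 2)) * Real.exp (-(1 / 4 * ‖y‖ ^ 2)) =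
      (∏ j, Real.exp (-(((1 / 2 : ℝ) * y j + (-1) * X.1 j) ^ 2 / 2))) *
      ∏ j, Real.exp (-(((1 / 2 : ℝ) * y j + 1 * X.1 j) ^ 2 / 2)) := by
    rw [← Real.exp_sum, ← Real.exp_sum, ← Real.exp_add, ← Real.exp_add,
      EuclideanSpace.norm_sq_eq, EuclideanSpace.norm_sq_eq, ← Finset.sum_add_distrib]
    simp only [Real.norm_eq_abs, sq_abs, Finset.mul_sum, ← Finset.sum_neg_distrib]
    rw [← Finset.sum_add_distrib]
    congr 1
    refine Finset.sum_congr rfl fun j _ => ?_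
    ring
  simp only [e]
  simp only [G, Pi.mul_apply, Finset.prod_apply, hermiteFun, hp, PiLp.sub_apply,
    PiLp.add_apply, PiLp.smul_apply, smul_eq_mul, Finset.prod_mul_distrib, one_mul, neg_one_mul,
    ← sub_eq_add_neg, Complex.ofReal_mul, Complex.ofReal_prod]
  ring

end HermiteWongSchwartz

/-- The Hermite–Wong function `ϱ_α` as an element of the Schwartz space `𝓢(ℝ^{2d})`. -/
def hermiteWong {d : ℕ} (α : Idx d) : 𝓢(Phase d, ℂ) where
  toFun := hermiteWongFun α
  smooth' := by
    obtain ⟨S, hS⟩ := exists_hermiteWong α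
    rw [← funext hS]
    exact S.smooth'
  decay' := by
    obtain ⟨S, hS⟩ := exists_hermiteWong α
    rw [← funext hS]
    exact S.decay'

/-! ### The operators `H_σ`, `H̄_σ` and `T_σ` on the Schwartz space -/

/-- The partial derivative `∂_{x_j}`. -/
def dx {d : ℕ} (j : Fin d) : 𝓢(Phase d, ℂ) →L[ℂ] 𝓢(Phase d, ℂ) :=
  LineDeriv.lineDerivOpCLM ℂ 𝓢(Phase d, ℂ) ((EuclideanSpace.single j (1 : ℝ), 0) : Phase d)

/-- The partial derivative `∂_{ξ_j}`. -/
def dξ {d : ℕ} (j : Fin d) : 𝓢(Phase d, ℂ) →L[ℂ] 𝓢(Phase d, ℂ) :=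
  LineDeriv.lineDerivOpCLM ℂ 𝓢(Phase d, ℂ) ((0, EuclideanSpace.single j (1 : ℝ)) : Phase d)

/-- Multiplication by `x_j`. -/
def mulx {d : ℕ} (j : Fin d) : 𝓢(Phase d, ℂ) →L[ℂ] 𝓢(Phase d, ℂ) :=
  smulLeftCLM ℂ fun X : Phase d => ((X.1 j : ℝ) : ℂ)

/-- Multiplication by `ξ_j`. -/
def mulξ {d : ℕ} (j : Fin d) : 𝓢(Phase d, ℂ) →L[ℂ] 𝓢(Phase d, ℂ) :=
  smulLeftCLM ℂ fun X : Phase d => ((X.2 j : ℝ) : ℂ)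

/-- The operator `|X|² - ¼ Δ_X`. -/
def oscillator (d : ℕ) : 𝓢(Phase d, ℂ) →L[ℂ] 𝓢(Phase d, ℂ) :=
  ∑ j : Fin d, (mulx j ∘L mulx j + mulξ j ∘L mulξ j) -
    (1 / 4 : ℂ) • ∑ j : Fin d, (dx j ∘L dx j + dξ j ∘L dξ j)

/-- The operator `⟨ξ, D_x⟩ - ⟨x, D_ξ⟩`, where `D = -i∂`. -/
def rotation (d : ℕ) : 𝓢(Phase d, ℂ) →L[ℂ] 𝓢(Phase d, ℂ) :=
  ∑ j : Fin d, mulξ j ∘L (-Complex.I • dx j) - ∑ j : Fin d, mulx j ∘L (-Complex.I • dξ j)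

/-- `H_σ = |X|² - ¼ Δ_X + ⟨ξ, D_x⟩ - ⟨x, D_ξ⟩`. -/
def Hσ (d : ℕ) : 𝓢(Phase d, ℂ) →L[ℂ] 𝓢(Phase d, ℂ) := oscillator d + rotation d

/-- `H̄_σ = |X|² - ¼ Δ_X - ⟨ξ, D_x⟩ + ⟨x, D_ξ⟩`. -/
def Hσbar (d : ℕ) : 𝓢(Phase d, ℂ) →L[ℂ] 𝓢(Phase d, ℂ) := oscillator d - rotation d

/-- `T_σ = H_σ ∘ H̄_σ`. -/
def Tσ (d : ℕ) : 𝓢(Phase d, ℂ) →L[ℂ] 𝓢(Phase d, ℂ) := Hσ d ∘L Hσbar d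

theorem dx_apply {d : ℕ} (j : Fin d) (f : 𝓢(Phase d, ℂ)) (X : Phase d) :
    dx j f X = lineDeriv ℝ f X (EuclideanSpace.single j 1, 0) := SchwartzMap.lineDerivOp_apply ..

theorem dξ_apply {d : ℕ} (j : Fin d) (f : 𝓢(Phase d, ℂ)) (X : Phase d) :
    dξ j f X = lineDeriv ℝ f X (0, EuclideanSpace.single j 1) := SchwartzMap.lineDerivOp_apply ..

theorem mulx_apply {d : ℕ} (j : Fin d) (f : 𝓢(Phase d, ℂ)) (X : Phase d) :
    mulx j f X = (X.1 j : ℂ) * f X :=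
  smulLeftCLM_apply_apply (Complex.ofRealCLM.comp ((EuclideanSpace.proj (𝕜 := ℝ) j).comp
    (ContinuousLinearMap.fst ℝ (V d) (V d)))).hasTemperateGrowth f X

theorem mulξ_apply {d : ℕ} (j : Fin d) (f : 𝓢(Phase d, ℂ)) (X : Phase d) :
    mulξ j f X = (X.2 j : ℂ) * f X :=
  smulLeftCLM_apply_apply (Complex.ofRealCLM.comp ((EuclideanSpace.proj (𝕜 := ℝ) j).comp
    (ContinuousLinearMap.snd ℝ (V d) (V d)))).hasTemperateGrowth f X

/-! ### Formal Hermite–Wong expansions -/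

/-- A formal expansion `∑_α c_α ϱ_α` is given by its family of coefficients `c`. It *is an
expansion of* the Schwartz function `a` if the series converges to `a` in `𝓢(ℝ^{2d})`. -/
def IsExpansion {d : ℕ} (c : Idx d → ℂ) (a : 𝓢(Phase d, ℂ)) : Prop :=
  HasSum (fun α => c α • hermiteWong α) a

/-- The weight `e^{-r |α|^{1/(2s)}}` when `s > 0`. For `s = 0` it is the indicator function of
`{α : |α| + 1 ≤ 1 / r}`, so that a family bounded by a multiple of the weight for some `r > 0` is
the same as a family of finite support. -/
def weight {d : ℕ} (s r : ℝ) (α : Idx d) : ℝ :=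
  if s = 0 then (if r * ((len α.1 + len α.2 : ℕ) + 1 : ℝ) ≤ 1 then 1 else 0)
  else Real.exp (-(r * ((len α.1 + len α.2 : ℕ) : ℝ) ^ (1 / (2 * s))))

theorem weight_nonneg {d : ℕ} (s r : ℝ) (α : Idx d) : 0 ≤ weight s r α := by
  unfold weight
  split_ifs <;> positivity

theorem weight_anti {d : ℕ} (s : ℝ) {r r' : ℝ} (h : r ≤ r') (α : Idx d) :
    weight s r' α ≤ weight s r α := by
  unfold weight
  split_ifs with h0 h1 h2 h2
  · exact le_rfl
  · exact absurd (le_trans (by gcongr) h1) h2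
  · exact zero_le_one
  · exact le_rfl
  · gcongr

/-- The Banach space of bounded families indexed by `ℕ^{2d}`, with the supremum norm. -/
abbrev Bdd (d : ℕ) : Type := lp (fun _ : Idx d => ℂ) ∞

theorem norm_apply_le {d : ℕ} (b : Bdd d) (α : Idx d) : ‖b α‖ ≤ ‖b‖ :=
  lp.norm_apply_le_norm ENNReal.top_ne_zero b α

/-- A family of complex numbers with the bound `C`, as an element of `ℓ^∞`. -/
def toBdd {d : ℕ} (f : Idx d → ℂ) (h : ∃ C : ℝ, ∀ α, ‖f α‖ ≤ C) : Bdd d :=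
  ⟨f, memℓp_infty (by
    obtain ⟨C, hC⟩ := h
    exact ⟨C, by rintro _ ⟨α, rfl⟩; exact hC α⟩)⟩

/-- The inductive limit topology, in the category of locally convex spaces, given by the maps
`T i : F → E`: the finest locally convex vector space topology making all of them continuous. -/
@[reducible] def lcInductive {ι F E : Type*} [TopologicalSpace F] [AddCommGroup E] [Module ℂ E]
    (T : ι → F → E) : TopologicalSpace E :=
  sInf {t | (∀ i, @Continuous F E _ t (T i)) ∧ @IsTopologicalAddGroup E t _ ∧
    @ContinuousSMul ℂ E _ _ t ∧ @LocallyConvexSpace ℝ E _ _ _ _ t}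

/-- The projective limit topology given by the maps `T i : E → F`: the coarsest topology making
all of them continuous. -/
@[reducible] def projective {ι F E : Type*} [TopologicalSpace F] (T : ι → E → F) : TopologicalSpace E :=
  ⨅ i, TopologicalSpace.induced (T i) inferInstance

/-! #### The space `𝓢_{σ,s}` (Roumieu type, boldface calligraphic S) -/

def roumieuSubmodule (d : ℕ) (s : ℝ) : Submodule ℂ (Idx d → ℂ) where
  carrier := {c | ∃ r > 0, ∃ C : ℝ, ∀ α, ‖c α‖ ≤ C * weight s r α}
  zero_mem' := ⟨1, one_pos, 0, fun α => by simp⟩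
  add_mem' := by
    rintro c c' ⟨r, hr, C, hC⟩ ⟨r', hr', C', hC'⟩
    refine ⟨min r r', lt_min hr hr', |C| + |C'|, fun α => ?_⟩
    have h1 : ‖c α‖ ≤ |C| * weight s (min r r') α :=
      (hC α).trans (mul_le_mul (le_abs_self C) (weight_anti s (min_le_left _ _) α)
        (weight_nonneg ..) (abs_nonneg C))
    have h2 : ‖c' α‖ ≤ |C'| * weight s (min r r') α :=
      (hC' α).trans (mul_le_mul (le_abs_self C') (weight_anti s (min_le_right _ _) α)
        (weight_nonneg ..) (abs_nonneg C'))
    rw [add_mul]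
    exact (norm_add_le _ _).trans (add_le_add h1 h2)
  smul_mem' := by
    rintro z c ⟨r, hr, C, hC⟩
    refine ⟨r, hr, ‖z‖ * C, fun α => ?_⟩
    rw [Pi.smul_apply, norm_smul, mul_assoc]
    exact mul_le_mul_of_nonneg_left (hC α) (norm_nonneg z)

/-- The twisted Pilipović space `𝓢_{σ,s}(ℝ^{2d})` of Roumieu type and order `s ≥ 0`: all expansions
with `|c_α| ≲ e^{-r|α|^{1/(2s)}}` for some `r > 0` (all finite expansions if `s = 0`). -/
def Roumieu (d : ℕ) (s : ℝ) : Type := roumieuSubmodule d s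

namespace Roumieu
variable {d : ℕ} {s : ℝ}
instance : AddCommGroup (Roumieu d s) := inferInstanceAs (AddCommGroup (roumieuSubmodule d s))
instance : Module ℂ (Roumieu d s) := inferInstanceAs (Module ℂ (roumieuSubmodule d s))

/-- The coefficients of an expansion. -/
def coeff : Roumieu d s →ₗ[ℂ] (Idx d → ℂ) := (roumieuSubmodule d s).subtype

/-- The inclusion of the Banach space of all `c` with `sup_α |c_α| / weight s r α < ∞`, parametrized
by `ℓ^∞`. -/
def step (r : Set.Ioi (0 : ℝ)) (b : Bdd d) : Roumieu d s :=
  ⟨fun α => (weight s r α : ℂ) * b α, r, r.2, ‖b‖, fun α => by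
    rw [norm_mul, Complex.norm_real, Real.norm_of_nonneg (weight_nonneg ..), mul_comm]
    exact mul_le_mul_of_nonneg_right (norm_apply_le b α) (weight_nonneg ..)⟩

instance : TopologicalSpace (Roumieu d s) := lcInductive step
end Roumieu

/-! #### The space `Σ_{σ,s}` (Beurling type, boldface Sigma) -/

def beurlingSubmodule (d : ℕ) (s : ℝ) : Submodule ℂ (Idx d → ℂ) where
  carrier := {c | ∀ r > 0, ∃ C : ℝ, ∀ α, ‖c α‖ ≤ C * weight s r α}
  zero_mem' := fun r _ => ⟨0, fun α => by simp⟩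
  add_mem' := by
    intro c c' h h' r hr
    obtain ⟨C, hC⟩ := h r hr
    obtain ⟨C', hC'⟩ := h' r hr
    refine ⟨C + C', fun α => ?_⟩
    rw [add_mul]
    exact (norm_add_le _ _).trans (add_le_add (hC α) (hC' α))
  smul_mem' := by
    intro z c h r hr
    obtain ⟨C, hC⟩ := h r hr
    refine ⟨‖z‖ * C, fun α => ?_⟩
    rw [Pi.smul_apply, norm_smul, mul_assoc]
    exact mul_le_mul_of_nonneg_left (hC α) (norm_nonneg z)

/-- The twisted Pilipović space `Σ_{σ,s}(ℝ^{2d})` of Beurling type and order `s`: all expansions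
with `|c_α| ≲ e^{-r|α|^{1/(2s)}}` for every `r > 0` (only the zero expansion if `s = 0`). -/
def Beurling (d : ℕ) (s : ℝ) : Type := beurlingSubmodule d s

namespace Beurling
variable {d : ℕ} {s : ℝ}
instance : AddCommGroup (Beurling d s) := inferInstanceAs (AddCommGroup (beurlingSubmodule d s))
instance : Module ℂ (Beurling d s) := inferInstanceAs (Module ℂ (beurlingSubmodule d s))

/-- The coefficients of an expansion. -/
def coeff : Beurling d s →ₗ[ℂ] (Idx d → ℂ) := (beurlingSubmodule d s).subtype

/-- The map `c ↦ (c_α / weight s r α)_α` into `ℓ^∞`. -/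
def scaled (r : Set.Ioi (0 : ℝ)) (c : Beurling d s) : Bdd d :=
  toBdd (fun α => coeff c α / (weight s r α : ℂ)) (by
    obtain ⟨C, hC⟩ := c.2 r r.2
    refine ⟨|C|, fun α => ?_⟩
    rw [norm_div, Complex.norm_real, Real.norm_of_nonneg (weight_nonneg ..)]
    refine div_le_of_le_mul₀ (weight_nonneg ..) (abs_nonneg C) ((hC α).trans ?_)
    exact mul_le_mul_of_nonneg_right (le_abs_self C) (weight_nonneg ..))

instance : TopologicalSpace (Beurling d s) := projective scaled
end Beurling

/-! #### The distribution space `𝓢'_{σ,s}` -/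

def roumieuDualSubmodule (d : ℕ) (s : ℝ) : Submodule ℂ (Idx d → ℂ) where
  carrier := {c | ∀ r > 0, ∃ C : ℝ, ∀ α, ‖c α‖ * weight s r α ≤ C}
  zero_mem' := fun r _ => ⟨0, fun α => by simp⟩
  add_mem' := by
    intro c c' h h' r hr
    obtain ⟨C, hC⟩ := h r hr
    obtain ⟨C', hC'⟩ := h' r hr
    refine ⟨C + C', fun α => ?_⟩
    refine (mul_le_mul_of_nonneg_right (norm_add_le _ _) (weight_nonneg ..)).trans ?_
    rw [add_mul]
    exact add_le_add (hC α) (hC' α)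
  smul_mem' := by
    intro z c h r hr
    obtain ⟨C, hC⟩ := h r hr
    refine ⟨‖z‖ * C, fun α => ?_⟩
    rw [Pi.smul_apply, norm_smul, mul_assoc]
    exact mul_le_mul_of_nonneg_left (hC α) (norm_nonneg z)

/-- The distribution space `𝓢'_{σ,s}(ℝ^{2d})`, `s ≥ 0`: all formal expansions with
`|c_α| ≲ e^{r|α|^{1/(2s)}}` for every `r > 0` (all formal expansions if `s = 0`). -/
def RoumieuDual (d : ℕ) (s : ℝ) : Type := roumieuDualSubmodule d s

namespace RoumieuDual
variable {d : ℕ} {s : ℝ}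
instance : AddCommGroup (RoumieuDual d s) :=
  inferInstanceAs (AddCommGroup (roumieuDualSubmodule d s))
instance : Module ℂ (RoumieuDual d s) := inferInstanceAs (Module ℂ (roumieuDualSubmodule d s))

/-- The coefficients of an expansion. -/
def coeff : RoumieuDual d s →ₗ[ℂ] (Idx d → ℂ) := (roumieuDualSubmodule d s).subtype

/-- The map `c ↦ (c_α weight s r α)_α` into `ℓ^∞`. -/
def scaled (r : Set.Ioi (0 : ℝ)) (c : RoumieuDual d s) : Bdd d :=
  toBdd (fun α => coeff c α * (weight s r α : ℂ)) (by
    obtain ⟨C, hC⟩ := c.2 r r.2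
    refine ⟨C, fun α => ?_⟩
    rw [norm_mul, Complex.norm_real, Real.norm_of_nonneg (weight_nonneg ..)]
    exact hC α)

instance : TopologicalSpace (RoumieuDual d s) := projective scaled
end RoumieuDual

/-! #### The distribution space `Σ'_{σ,s}` -/

def beurlingDualSubmodule (d : ℕ) (s : ℝ) : Submodule ℂ (Idx d → ℂ) where
  carrier := {c | ∃ r > 0, ∃ C : ℝ, ∀ α, ‖c α‖ * weight s r α ≤ C}
  zero_mem' := ⟨1, one_pos, 0, fun α => by simp⟩
  add_mem' := by
    rintro c c' ⟨r, hr, C, hC⟩ ⟨r', hr', C', hC'⟩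
    refine ⟨max r r', lt_max_of_lt_left hr, C + C', fun α => ?_⟩
    have h1 : ‖c α‖ * weight s (max r r') α ≤ C := le_trans
      (mul_le_mul_of_nonneg_left (weight_anti s (le_max_left _ _) α) (norm_nonneg _)) (hC α)
    have h2 : ‖c' α‖ * weight s (max r r') α ≤ C' := le_trans
      (mul_le_mul_of_nonneg_left (weight_anti s (le_max_right _ _) α) (norm_nonneg _)) (hC' α)
    refine (mul_le_mul_of_nonneg_right (norm_add_le _ _) (weight_nonneg ..)).trans ?_
    rw [add_mul]
    exact add_le_add h1 h2
  smul_mem' := by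
    rintro z c ⟨r, hr, C, hC⟩
    refine ⟨r, hr, ‖z‖ * C, fun α => ?_⟩
    rw [Pi.smul_apply, norm_smul, mul_assoc]
    exact mul_le_mul_of_nonneg_left (hC α) (norm_nonneg z)

/-- The distribution space `Σ'_{σ,s}(ℝ^{2d})`, `s > 0`: all formal expansions with
`|c_α| ≲ e^{r|α|^{1/(2s)}}` for some `r > 0`. (Only `s > 0` is meaningful here.) -/
def BeurlingDual (d : ℕ) (s : ℝ) : Type := beurlingDualSubmodule d s

namespace BeurlingDual
variable {d : ℕ} {s : ℝ}
instance : AddCommGroup (BeurlingDual d s) :=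
  inferInstanceAs (AddCommGroup (beurlingDualSubmodule d s))
instance : Module ℂ (BeurlingDual d s) := inferInstanceAs (Module ℂ (beurlingDualSubmodule d s))

/-- The coefficients of an expansion. -/
def coeff : BeurlingDual d s →ₗ[ℂ] (Idx d → ℂ) := (beurlingDualSubmodule d s).subtype

/-- The inclusion of the Banach space of all `c` with `sup_α |c_α| weight s r α < ∞`, parametrized
by `ℓ^∞`. -/
def step (r : Set.Ioi (0 : ℝ)) (b : Bdd d) : BeurlingDual d s :=
  ⟨fun α => b α / (weight s r α : ℂ), r, r.2, ‖b‖, fun α => by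
    rw [norm_div, Complex.norm_real, Real.norm_of_nonneg (weight_nonneg ..)]
    rcases (weight_nonneg s r α).eq_or_lt with h | h
    · rw [← h]; simp
    · rw [div_mul_cancel₀ _ h.ne']; exact norm_apply_le b α⟩

instance : TopologicalSpace (BeurlingDual d s) := lcInductive step
end BeurlingDual

/-! ### Restrictions and extensions -/

instance instHasTemperateGrowth (d : ℕ) : (volume : Measure (Phase d)).HasTemperateGrowth := by
  have : (volume : Measure (Phase d)).IsAddHaarMeasure :=
    inferInstanceAs (((volume : Measure (V d)).prod (volume : Measure (V d))).IsAddHaarMeasure)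
  infer_instance

/-- The operator `T` on `𝓢(ℝ^{2d})` restricts to a homeomorphism on the space `E` of expansions
(whose coefficients are given by `coeff`): there is a linear homeomorphism `Φ` of `E` such that every
element `∑ c_α ϱ_α` of `E` converges in `𝓢(ℝ^{2d})`, to `a` say, and `Φ c` is the expansion
of `T a`. -/
def RestrictsToHomeo {d : ℕ} (T : 𝓢(Phase d, ℂ) →L[ℂ] 𝓢(Phase d, ℂ)) {E : Type}
    [AddCommGroup E] [Module ℂ E] [TopologicalSpace E] (coeff : E →ₗ[ℂ] (Idx d → ℂ)) : Prop :=
  ∃ Φ : E ≃L[ℂ] E, ∀ c : E, ∃ a : 𝓢(Phase d, ℂ),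
    IsExpansion (coeff c) a ∧ IsExpansion (coeff (Φ c)) (T a)

/-- The map `Ψ` on the space `E` of formal expansions extends the operator `T` on `𝓢(ℝ^{2d})`. -/
def Extends {d : ℕ} (T : 𝓢(Phase d, ℂ) →L[ℂ] 𝓢(Phase d, ℂ)) {E : Type}
    [AddCommGroup E] [Module ℂ E] (coeff : E →ₗ[ℂ] (Idx d → ℂ)) (Ψ : E → E) : Prop :=
  ∀ (c : E) (a : 𝓢(Phase d, ℂ)), IsExpansion (coeff c) a → IsExpansion (coeff (Ψ c)) (T a)

/-- The operator `T` on `𝓢(ℝ^{2d})` extends uniquely to a homeomorphism on the space `E` of formal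
expansions: every element of `𝓢(ℝ^{2d})` has an expansion in `E`, and there is a linear
homeomorphism of `E` which extends `T` and which is the only continuous map on `E` extending `T`. -/
def ExtendsUniquely {d : ℕ} (T : 𝓢(Phase d, ℂ) →L[ℂ] 𝓢(Phase d, ℂ)) {E : Type}
    [AddCommGroup E] [Module ℂ E] [TopologicalSpace E] (coeff : E →ₗ[ℂ] (Idx d → ℂ)) : Prop :=
  (∀ a : 𝓢(Phase d, ℂ), ∃ c : E, IsExpansion (coeff c) a) ∧
  ∃ Φ : E ≃L[ℂ] E, Extends T coeff Φ ∧
    ∀ Ψ : E → E, Continuous Ψ → Extends T coeff Ψ → Ψ = Φ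

/-- The operator `T` on `𝓢(ℝ^{2d})` extends uniquely to a homeomorphism on `𝓢'(ℝ^{2d})`: there is a
linear homeomorphism of `𝓢'(ℝ^{2d})` which extends `T` and which is the only continuous map on
`𝓢'(ℝ^{2d})` extending `T`. -/
def ExtendsUniquelyTempered {d : ℕ} (T : 𝓢(Phase d, ℂ) →L[ℂ] 𝓢(Phase d, ℂ)) : Prop :=
  ∃ Φ : 𝓢'(Phase d, ℂ) ≃L[ℂ] 𝓢'(Phase d, ℂ),
    (∀ a : 𝓢(Phase d, ℂ), Φ (toTemperedDistributionCLM (Phase d) ℂ volume a) =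
      toTemperedDistributionCLM (Phase d) ℂ volume (T a)) ∧
    ∀ Ψ : 𝓢'(Phase d, ℂ) → 𝓢'(Phase d, ℂ), Continuous Ψ →
      (∀ a : 𝓢(Phase d, ℂ), Ψ (toTemperedDistributionCLM (Phase d) ℂ volume a) =
        toTemperedDistributionCLM (Phase d) ℂ volume (T a)) → Ψ = Φ

end TwistedPilipovic

end

noncomputable section

namespace TwistedPilipovic

/-! ### One-dimensional Hermite functions -/

/-! The transform `wigner` sends (f, g) to ∫ f(y/2 - x) g(y/2 + x) e^{i⟨y,ξ⟩} dy. Under it,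
multiplication by x_j, by ξ_j, and the derivatives in these variables become combinations of
coordinate multiplications and derivatives acting on f or on g. Suitable combinations act as
creation or annihilation operators on one argument only, so ϱ_α satisfies independent ladder
relations in its two indices. Since H_σ is the sum over j of `raiseFst j ∘ lowerFst j + 1`, and H̄_σ
is the analogous sum for the second index, the eigenvalue relations follow.

The mapping properties come from identifying 𝓢(ℝ^{2d}) with the rapidly decreasing coefficient
families. Transposition for the bilinear pairing ∫ f g exchanges the two sets of ladder operators up
to sign. Hence H_σ and H̄_σ are transposes of each other, and ϱ_{α₁,α₂} is biorthogonal to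
ϱ_{α₂,α₁}; the constant is reduced to the Gaussian ϱ_0, which also shows ϱ_α ≠ 0. The remaining
ingredients are: (i) all Schwartz seminorms of ϱ_α grow at most polynomially in α
(`polyGrowth_seminorm`), by a uniform sup bound and the ladder relations; (ii) the coefficients of a
Schwartz function decrease rapidly (`exists_seminorm_hwCoeff_le`), because the eigenvalues of T_σ
dominate 1 + |α|; (iii) the ϱ_α are complete (`eq_zero_of_pair_hermiteWong`), because their span
contains the powers of every linear form times a Gaussian.

In terms of coefficients, H_σ and H̄_σ multiply by numbers 2ν + d, which are at least 1 and grow at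
most linearly. A linear factor is absorbed by changing r in the weight, so multiplication and its
inverse are continuous on each space of expansions. Uniqueness of the extensions follows from
density of finite expansions and continuity of the coefficient functionals. On 𝓢' the extension is
precomposition with the transpose, and uniqueness follows from density of 𝓢. -/

theorem iteratedDeriv_gaussian_hasDerivAt (n : ℕ) (t : ℝ) :
    HasDerivAt (iteratedDeriv n fun u : ℝ => Real.exp (-u ^ 2))
      (iteratedDeriv (n + 1) (fun u : ℝ => Real.exp (-u ^ 2)) t) t := by
  rw [iteratedDeriv_succ]
  refine DifferentiableAt.hasDerivAt ?_
  have h : ContDiff ℝ ((n + 1 : ℕ) : WithTop ℕ∞) fun u : ℝ => Real.exp (-u ^ 2) := by fun_prop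
  exact (h.differentiable_iteratedDeriv n (by exact_mod_cast n.lt_succ_self)) t

theorem iteratedDeriv_gaussian_one (t : ℝ) :
    iteratedDeriv 1 (fun u : ℝ => Real.exp (-u ^ 2)) t = -2 * t * Real.exp (-t ^ 2) := by
  have h : HasDerivAt (fun u : ℝ => Real.exp (-u ^ 2)) (Real.exp (-t ^ 2) * (-(2 * t))) t := by
    simpa using ((hasDerivAt_pow 2 t).neg).exp
  rw [iteratedDeriv_one, h.deriv]
  ring

/-- The Gaussian solves u' = -2tu, and this is the equation differentiated n + 1 times. Each
induction step differentiates the previous identity and compares derivatives. -/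
theorem iteratedDeriv_gaussian_rec (n : ℕ) (t : ℝ) :
    iteratedDeriv (n + 2) (fun u : ℝ => Real.exp (-u ^ 2)) t =
      -2 * t * iteratedDeriv (n + 1) (fun u : ℝ => Real.exp (-u ^ 2)) t -
        2 * (n + 1) * iteratedDeriv n (fun u : ℝ => Real.exp (-u ^ 2)) t := by
  induction n generalizing t with
  | zero =>
    have h1 : iteratedDeriv 1 (fun u : ℝ => Real.exp (-u ^ 2)) =
        fun t => -2 * t * Real.exp (-t ^ 2) := funext iteratedDeriv_gaussian_one
    have h2 := iteratedDeriv_gaussian_hasDerivAt 0 t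
    have h3 := iteratedDeriv_gaussian_hasDerivAt 1 t
    rw [iteratedDeriv_zero] at h2
    have h4 := ((hasDerivAt_id t).const_mul (-2)).mul h2
    rw [h1] at h3
    have h5 := h3.unique h4
    simp only [id, zero_add, Nat.reduceAdd, mul_one] at h5 ⊢
    rw [h5, iteratedDeriv_zero]
    push_cast
    ring
  | succ n ih =>
    have h3 := iteratedDeriv_gaussian_hasDerivAt (n + 2) t
    rw [funext ih] at h3
    have h4 := (((hasDerivAt_id t).const_mul (-2)).mul
      (iteratedDeriv_gaussian_hasDerivAt (n + 1) t)).sub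
      ((iteratedDeriv_gaussian_hasDerivAt n t).const_mul (2 * ((n : ℝ) + 1)))
    have h5 := h3.unique h4
    simp only [id, mul_one] at h5
    rw [show n + 1 + 2 = n + 2 + 1 from rfl, h5]
    push_cast
    ring

theorem hermite_coeff_succ (n : ℕ) :
    √(2 * n + 2) * ((2 : ℝ) ^ (n + 1) * ((n + 1)! : ℝ)) ^ (-(1 / 2) : ℝ) =
      ((2 : ℝ) ^ n * (n ! : ℝ)) ^ (-(1 / 2) : ℝ) := by
  have h : (2 : ℝ) ^ (n + 1) * ((n + 1)! : ℝ) = (2 * n + 2) * ((2 : ℝ) ^ n * (n ! : ℝ)) := by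
    rw [Nat.factorial_succ]
    push_cast
    ring
  have hp : (0 : ℝ) < 2 * n + 2 := by positivity
  rw [h, Real.mul_rpow hp.le (by positivity), ← mul_assoc, Real.sqrt_eq_rpow,
    ← Real.rpow_add hp]
  norm_num

/-- The normalizing constants of orders n and n + 1 differ by the factor -√(2n+2). Writing both
orders with the constant of order n keeps quotients out of the ladder relations. -/
theorem sqrt_mul_hermite₁_succ (n : ℕ) (t : ℝ) :
    √(2 * n + 2) * hermite₁ (n + 1) t =
      -(π ^ (-(1 / 4) : ℝ) * (-1) ^ n * ((2 : ℝ) ^ n * (n ! : ℝ)) ^ (-(1 / 2) : ℝ) *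
        Real.exp (t ^ 2 / 2) *
        iteratedDeriv (n + 1) (fun u : ℝ => Real.exp (-u ^ 2)) t) := by
  rw [hermite₁, ← hermite_coeff_succ n]
  ring

theorem hasDerivAt_hermite₁ (n : ℕ) (t : ℝ) :
    HasDerivAt (hermite₁ n) (t * hermite₁ n t - √(2 * n + 2) * hermite₁ (n + 1) t) t := by
  have h1 : HasDerivAt (fun t : ℝ => Real.exp (t ^ 2 / 2)) (Real.exp (t ^ 2 / 2) * t) t := by
    have := ((hasDerivAt_pow 2 t).div_const 2).exp
    convert this using 1
    simp
  have h2 := (h1.const_mul (π ^ (-(1 / 4) : ℝ) * (-1) ^ n *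
    ((2 : ℝ) ^ n * (n ! : ℝ)) ^ (-(1 / 2) : ℝ))).mul (iteratedDeriv_gaussian_hasDerivAt n t)
  rw [sqrt_mul_hermite₁_succ]
  refine h2.congr_deriv ?_
  rw [hermite₁]
  ring

/-- The three-term recursion of the Hermite functions. -/
theorem hermite₁_rec (n : ℕ) (t : ℝ) :
    √(2 * n + 2) * hermite₁ (n + 1) t + √(2 * n) * hermite₁ (n - 1) t = 2 * t * hermite₁ n t := by
  rw [sqrt_mul_hermite₁_succ]
  -- For order 0 the index `n - 1` is truncated, but its coefficient √0 vanishes.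
  cases n with
  | zero =>
    rw [zero_add, iteratedDeriv_gaussian_one, hermite₁, iteratedDeriv_zero]
    simp
    ring
  | succ n =>
    rw [iteratedDeriv_gaussian_rec, Nat.add_sub_cancel, hermite₁, hermite₁,
      ← hermite_coeff_succ n]
    push_cast
    have h : √(2 * ((n : ℝ) + 1)) * √(2 * n + 2) = 2 * n + 2 := by
      rw [mul_add, mul_one]
      exact Real.mul_self_sqrt (by positivity)
    linear_combination (π ^ (-(1 / 4) : ℝ) * (-1) ^ n *
      ((2 : ℝ) ^ (n + 1) * ((n + 1)! : ℝ)) ^ (-(1 / 2) : ℝ) *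
      Real.exp (t ^ 2 / 2) * iteratedDeriv n (fun u : ℝ => Real.exp (-u ^ 2)) t) * h

/-! ### Multi-indices -/

/-- The multi-index `α + e_j`. -/
def up {d : ℕ} (j : Fin d) (α : Fin d → ℕ) : Fin d → ℕ := Function.update α j (α j + 1)

/-- The multi-index `α - e_j` (with truncated subtraction). -/
def dn {d : ℕ} (j : Fin d) (α : Fin d → ℕ) : Fin d → ℕ := Function.update α j (α j - 1)

section MultiIndex
variable {d : ℕ} (j : Fin d) (α : Fin d → ℕ)

@[simp] theorem up_self : up j α j = α j + 1 := by simp [up]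
@[simp] theorem dn_self : dn j α j = α j - 1 := by simp [dn]
@[simp] theorem dn_up : dn j (up j α) = α := by simp [dn, up]
theorem up_dn (h : α j ≠ 0) : up j (dn j α) = α := by
  have : α j - 1 + 1 = α j := by omega
  simp [dn, up, this]

@[simp] theorem len_up : len (up j α) = len α + 1 := by
  unfold len up
  rw [Finset.sum_update_of_mem (Finset.mem_univ j), ← Finset.add_sum_erase _ α (Finset.mem_univ j),
    Finset.sdiff_singleton_eq_erase]
  omega

theorem len_dn_add_one (h : α j ≠ 0) : len (dn j α) + 1 = len α := by
  rw [← len_up j, up_dn j α h]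

theorem len_dn_le : len (dn j α) ≤ len α := by
  by_cases h : α j = 0
  · have : dn j α = α := by rw [dn, show α j - 1 = α j by omega, Function.update_eq_self]
    rw [this]
  · exact (Nat.le_succ _).trans (len_dn_add_one j α h).le

theorem le_len : α j ≤ len α := Finset.single_le_sum (fun _ _ => Nat.zero_le _) (Finset.mem_univ j)

/-- A multi-index of positive length has a nonzero entry, hence equals `up j` of a shorter one;
induct on the length. -/
theorem up_induction {P : (Fin d → ℕ) → Prop} (h0 : P 0) (h1 : ∀ j α, P α → P (up j α)) : P α := by
  induction hn : len α generalizing α with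
  | zero =>
    have : α = 0 := funext fun i => by
      have := le_len i α
      simp only [Pi.zero_apply]
      omega
    rwa [this]
  | succ n ih =>
    obtain ⟨i, hi⟩ : ∃ i, α i ≠ 0 := by
      by_contra! h
      have : len α = 0 := Finset.sum_eq_zero fun i _ => h i
      omega
    rw [← up_dn i α hi]
    refine h1 i _ (ih _ ?_)
    have := len_dn_add_one i α hi
    omega

end MultiIndex

/-! ### Hermite functions as Schwartz functions -/

/-- Multiplication by `x_j` on `𝓢(ℝ^d)`. -/
def coordMul {d : ℕ} (j : Fin d) : 𝓢(V d, ℂ) →L[ℂ] 𝓢(V d, ℂ) :=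
  smulLeftCLM ℂ fun x : V d => ((x j : ℝ) : ℂ)

/-- The partial derivative `∂_j` on `𝓢(ℝ^d)`. -/
def coordDeriv {d : ℕ} (j : Fin d) : 𝓢(V d, ℂ) →L[ℂ] 𝓢(V d, ℂ) :=
  LineDeriv.lineDerivOpCLM ℂ 𝓢(V d, ℂ) (EuclideanSpace.single j (1 : ℝ))

theorem coordMul_apply {d : ℕ} (j : Fin d) (f : 𝓢(V d, ℂ)) (x : V d) :
    coordMul j f x = (x j : ℂ) * f x :=
  smulLeftCLM_apply_apply
    (Complex.ofRealCLM.comp (EuclideanSpace.proj (𝕜 := ℝ) j)).hasTemperateGrowth f x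

/-- A Hermite function is a polynomial, which has temperate growth, times the Gaussian e^{-|x|²/2}.
-/
theorem exists_hermiteSchwartz {d : ℕ} (α : Fin d → ℕ) :
    ∃ f : 𝓢(V d, ℂ), ∀ x, f x = (hermiteFun α x : ℂ) := by
  choose p hp using exists_hermite₁_poly
  obtain ⟨g, hg⟩ := exists_gaussian (d := d) (b := 1 / 2) (by norm_num)
  have hcoord : ∀ j : Fin d, (fun x : V d => ((x j : ℝ) : ℂ)).HasTemperateGrowth := fun j =>
    (Complex.ofRealCLM.comp (EuclideanSpace.proj (𝕜 := ℝ) j)).hasTemperateGrowth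
  have hpoly : ∀ (q : Polynomial ℝ) (j : Fin d),
      (fun x : V d => ((q.eval (x j) : ℝ) : ℂ)).HasTemperateGrowth := by
    intro q j
    induction q using Polynomial.induction_on' with
    | add q r hq hr =>
      simp only [Polynomial.eval_add, Complex.ofReal_add]
      exact hq.add hr
    | monomial n a =>
      simp only [Polynomial.eval_monomial, Complex.ofReal_mul, Complex.ofReal_pow]
      exact (Function.HasTemperateGrowth.const (a : ℂ)).mul ((hcoord j).pow n)
  have hprod : ∀ s : Finset (Fin d),
      (fun x : V d => ∏ j ∈ s, (((p (α j)).eval (x j) : ℝ) : ℂ)).HasTemperateGrowth := by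
    intro s
    induction s using Finset.cons_induction with
    | empty => simp [Function.HasTemperateGrowth.const]
    | cons j s hj ih =>
      simp only [Finset.prod_cons]
      exact (hpoly (p (α j)) j).mul ih
  refine ⟨smulLeftCLM ℂ (fun x : V d => ∏ j, (((p (α j)).eval (x j) : ℝ) : ℂ))
    (postcompCLM (𝕜 := ℝ) Complex.ofRealCLM g), fun x => ?_⟩
  rw [smulLeftCLM_apply_apply (hprod _), postcompCLM_apply, hg, hermiteFun]
  simp only [hp, Complex.ofRealCLM_apply, smul_eq_mul, Finset.prod_mul_distrib,
    Complex.ofReal_mul, Complex.ofReal_prod]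
  congr 1
  rw [← Complex.ofReal_prod, ← Real.exp_sum, EuclideanSpace.norm_sq_eq, Finset.mul_sum,
    Finset.sum_neg_distrib]
  simp [div_eq_inv_mul]

/-- The Hermite function `h_α` as an element of `𝓢(ℝ^d)`. -/
def hermiteSchwartz {d : ℕ} (α : Fin d → ℕ) : 𝓢(V d, ℂ) := (exists_hermiteSchwartz α).choose

theorem hermiteSchwartz_apply {d : ℕ} (α : Fin d → ℕ) (x : V d) :
    hermiteSchwartz α x = (hermiteFun α x : ℂ) := (exists_hermiteSchwartz α).choose_spec x

/-! ### Creation and annihilation relations on ℝ^d, and the L² norm of the Hermite functions -/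

section Ladder
variable {d : ℕ} (j : Fin d) (α : Fin d → ℕ)

theorem hermiteFun_update (k : ℕ) (x : V d) :
    hermiteFun (Function.update α j k) x =
      hermite₁ k (x j) * ∏ i ∈ Finset.univ.erase j, hermite₁ (α i) (x i) := by
  rw [hermiteFun, ← Finset.mul_prod_erase _ _ (Finset.mem_univ j), Function.update_self]
  congr 1
  refine Finset.prod_congr rfl fun i hi => ?_
  rw [Function.update_of_ne (Finset.ne_of_mem_erase hi)]

theorem hermiteFun_eq_mul (x : V d) :
    hermiteFun α x = hermite₁ (α j) (x j) * ∏ i ∈ Finset.univ.erase j, hermite₁ (α i) (x i) :=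
  (Finset.mul_prod_erase _ _ (Finset.mem_univ j)).symm

theorem coordDeriv_hermiteSchwartz_apply (x : V d) :
    coordDeriv j (hermiteSchwartz α) x =
      ((x j * hermiteFun α x - √(2 * α j + 2) * hermiteFun (up j α) x : ℝ) : ℂ) := by
  refine (SchwartzMap.lineDerivOp_apply ..).trans ?_
  rw [lineDeriv]
  refine HasDerivAt.deriv ?_
  simp only [hermiteSchwartz_apply]
  refine HasDerivAt.ofReal_comp ?_
  have hx : ∀ t : ℝ, hermiteFun α (x + t • EuclideanSpace.single j 1) =
      hermite₁ (α j) (x j + t) * ∏ i ∈ Finset.univ.erase j, hermite₁ (α i) (x i) := by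
    intro t
    rw [hermiteFun_eq_mul j]
    congr 1
    · simp
    · refine Finset.prod_congr rfl fun i hi => ?_
      simp [Finset.ne_of_mem_erase hi]
  rw [funext hx, up, hermiteFun_update, hermiteFun_eq_mul j α]
  have h := hasDerivAt_hermite₁ (α j) (x j + 0)
  have h2 := (h.comp_const_add (x j) 0).mul_const
    (∏ i ∈ Finset.univ.erase j, hermite₁ (α i) (x i))
  refine h2.congr_deriv ?_
  rw [add_zero]
  ring

theorem hermiteFun_rec (x : V d) :
    √(2 * α j + 2) * hermiteFun (up j α) x + √(2 * α j) * hermiteFun (dn j α) x =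
      2 * (x j * hermiteFun α x) := by
  rw [up, dn, hermiteFun_update, hermiteFun_update, hermiteFun_eq_mul j α]
  linear_combination (∏ i ∈ Finset.univ.erase j, hermite₁ (α i) (x i)) * hermite₁_rec (α j) (x j)

theorem hermiteSchwartz_raise :
    coordMul j (hermiteSchwartz α) - coordDeriv j (hermiteSchwartz α) =
      (√(2 * α j + 2) : ℂ) • hermiteSchwartz (up j α) := by
  ext x
  rw [sub_apply, smul_apply, coordMul_apply,
    coordDeriv_hermiteSchwartz_apply, hermiteSchwartz_apply, hermiteSchwartz_apply]
  push_cast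
  rw [smul_eq_mul]
  ring

/-- The derivative formula contains the raised function; the three-term recursion trades it for the
lowered one. -/
theorem hermiteSchwartz_lower :
    coordMul j (hermiteSchwartz α) + coordDeriv j (hermiteSchwartz α) =
      (√(2 * α j) : ℂ) • hermiteSchwartz (dn j α) := by
  ext x
  rw [add_apply, smul_apply, coordMul_apply,
    coordDeriv_hermiteSchwartz_apply, hermiteSchwartz_apply, hermiteSchwartz_apply]
  have h : ((√(2 * α j + 2) * hermiteFun (up j α) x + √(2 * α j) * hermiteFun (dn j α) x : ℝ) : ℂ) =
    ((2 * (x j * hermiteFun α x) : ℝ) : ℂ) := by rw [hermiteFun_rec]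
  push_cast at h ⊢
  rw [smul_eq_mul]
  linear_combination -h

theorem integral_mul_coordDeriv (f g : 𝓢(V d, ℂ)) :
    ∫ x, f x * coordDeriv j g x = -∫ x, coordDeriv j f x * g x :=
  SchwartzMap.integral_mul_lineDerivOp_right_eq_neg_left f g _

theorem integrable_mul_schwartz {E : Type*} [NormedAddCommGroup E] [NormedSpace ℝ E]
    [MeasurableSpace E] [BorelSpace E] [SecondCountableTopology E] {μ : Measure E}
    [μ.HasTemperateGrowth] (f g : 𝓢(E, ℂ)) : Integrable (fun x => f x * g x) μ :=
  (pairing (ContinuousLinearMap.mul ℂ ℂ) f g).integrable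

/-- By integration by parts x_j + ∂_j is the transpose of x_j - ∂_j, and both carry the factor
√(2α_j+2) between α and α + e_j. So the integral does not change along the ladder; its value is
never needed. -/
theorem integral_hermiteSchwartz_sq :
    ∫ x, hermiteSchwartz α x * hermiteSchwartz α x =
      ∫ x, hermiteSchwartz (0 : Fin d → ℕ) x * hermiteSchwartz (0 : Fin d → ℕ) x := by
  induction α using up_induction with
  | h0 => rfl
  | h1 j α ih =>
    rw [← ih]
    set f := hermiteSchwartz α
    set g := hermiteSchwartz (up j α)
    set c : ℂ := (√(2 * α j + 2) : ℂ)
    have hc : c ≠ 0 := by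
      have : (0 : ℝ) < √(2 * α j + 2) := by positivity
      simpa [c] using Complex.ofReal_ne_zero.2 this.ne'
    have h1 : ∀ x, c * g x = coordMul j f x - coordDeriv j f x := fun x => by
      rw [← sub_apply, hermiteSchwartz_raise, smul_apply, smul_eq_mul]
    have h2 : ∀ x, c * f x = coordMul j g x + coordDeriv j g x := fun x => by
      have := hermiteSchwartz_lower j (up j α)
      rw [dn_up, up_self] at this
      rw [← add_apply, this, smul_apply, smul_eq_mul]
      push_cast
      simp only [c, mul_add, mul_one, f]
    have e1 : c * ∫ x, g x * g x = ∫ x, (g x * coordMul j f x - g x * coordDeriv j f x) := by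
      rw [← integral_const_mul]
      congr 1 with x
      rw [mul_left_comm, h1, mul_sub]
    have e2 : c * ∫ x, f x * f x = ∫ x, (coordMul j g x * f x + coordDeriv j g x * f x) := by
      rw [← integral_const_mul]
      congr 1 with x
      rw [← mul_assoc, h2, add_mul]
    rw [integral_sub (integrable_mul_schwartz _ _) (integrable_mul_schwartz _ _),
      integral_mul_coordDeriv, sub_neg_eq_add] at e1
    rw [integral_add (integrable_mul_schwartz _ _) (integrable_mul_schwartz _ _)] at e2
    refine mul_left_cancel₀ hc (e1.trans (Eq.trans ?_ e2.symm))
    congr 2 with x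
    rw [coordMul_apply, coordMul_apply]
    ring

end Ladder

/-! ### The cross-Wigner type transform -/

section Wigner
variable {d : ℕ}

/-- The integrand of the transform `wigner`. -/
def wignerInt (f g : V d → ℂ) (X : Phase d) (y : V d) : ℂ :=
  f ((1 / 2 : ℝ) • y - X.1) * g ((1 / 2 : ℝ) • y + X.1) *
    Complex.exp (Complex.I * ((inner ℝ y X.2 : ℝ) : ℂ))

/-- The transform `(f, g) ↦ ∫ f(y/2 - x) g(y/2 + x) e^{i⟨y,ξ⟩} dy`. -/
def wigner (f g : V d → ℂ) (X : Phase d) : ℂ := ∫ y, wignerInt f g X y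

/-- The dilation `y ↦ y / 2`. -/
def halfEquiv (d : ℕ) : V d ≃L[ℝ] V d :=
  ContinuousLinearEquiv.smulLeft (Units.mk0 (1 / 2 : ℝ) (by norm_num))

/-- The operator `f ↦ f(·/2 - x)`. -/
def dilateTranslate (x : V d) : 𝓢(V d, ℂ) →L[ℂ] 𝓢(V d, ℂ) :=
  compCLMOfContinuousLinearEquiv ℂ (halfEquiv d) ∘L compSubConstCLM ℂ x

theorem dilateTranslate_apply (x : V d) (f : 𝓢(V d, ℂ)) (y : V d) :
    dilateTranslate x f y = f ((1 / 2 : ℝ) • y - x) := rfl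

theorem dilateTranslate_neg_apply (x : V d) (f : 𝓢(V d, ℂ)) (y : V d) :
    dilateTranslate (-x) f y = f ((1 / 2 : ℝ) • y + x) := by
  rw [dilateTranslate_apply, sub_neg_eq_add]

theorem norm_exp_I_mul_ofReal (t : ℝ) : ‖Complex.exp (Complex.I * (t : ℂ))‖ = 1 := by
  rw [mul_comm, Complex.norm_exp_ofReal_mul_I]

theorem integrable_wignerInt (f g : 𝓢(V d, ℂ)) (X : Phase d) : Integrable (wignerInt f g X) := by
  have h := integrable_mul_schwartz (μ := (volume : Measure (V d)))
    (dilateTranslate X.1 f) (dilateTranslate (-X.1) g)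
  have hc : Continuous fun y : V d => Complex.exp (Complex.I * ((inner ℝ y X.2 : ℝ) : ℂ)) := by
    fun_prop
  refine (h.bdd_mul (c := 1) hc.aestronglyMeasurable
    (.of_forall fun y => (norm_exp_I_mul_ofReal _).le)).congr (.of_forall fun y => ?_)
  dsimp only
  rw [dilateTranslate_neg_apply, dilateTranslate_apply, wignerInt, mul_comm]

/-- This supplies a majorant for differentiation under the integral sign: Schwartz decay in z
controls decay in y, uniformly while z stays within distance R of y/2. -/
theorem exists_integrable_bound (h : 𝓢(V d, ℂ)) (R : ℝ) (hR : 0 ≤ R) :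
    ∃ b : V d → ℝ, Integrable b ∧ ∀ y z : V d, ‖z - (1 / 2 : ℝ) • y‖ ≤ R → ‖h z‖ ≤ b y := by
  set N : ℕ := Module.finrank ℝ (V d) + 1
  obtain ⟨C, hC⟩ : ∃ C : ℝ, ∀ z, (1 + ‖z‖) ^ N * ‖h z‖ ≤ C := by
    have := SchwartzMap.one_add_le_sup_seminorm_apply (𝕜 := ℂ) (m := (N, 0)) (k := N) (n := 0)
      le_rfl le_rfl h
    simp only [norm_iteratedFDeriv_zero] at this
    exact ⟨_, this⟩
  refine ⟨fun y => C * (2 + 2 * R) ^ N * (1 + ‖y‖) ^ (-(N : ℝ)),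
    (integrable_one_add_norm (by simp [N])).const_mul _, fun y z hz => ?_⟩
  have hy : ‖y‖ ≤ 2 * ‖z‖ + 2 * R := by
    have e : (1 / 2 : ℝ) • y = z - (z - (1 / 2 : ℝ) • y) := by abel
    have h1 : ‖(1 / 2 : ℝ) • y‖ ≤ ‖z‖ + R := by
      rw [e]
      exact (norm_sub_le _ _).trans (by gcongr)
    rw [norm_smul] at h1
    norm_num at h1
    linarith
  have h2 : 1 + ‖y‖ ≤ (2 + 2 * R) * (1 + ‖z‖) := by nlinarith [norm_nonneg z]
  have hpos : 0 < 1 + ‖y‖ := by positivity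
  dsimp only
  rw [Real.rpow_neg hpos.le, Real.rpow_natCast, ← div_eq_mul_inv, le_div_iff₀ (by positivity)]
  calc ‖h z‖ * (1 + ‖y‖) ^ N ≤ ‖h z‖ * ((2 + 2 * R) * (1 + ‖z‖)) ^ N := by gcongr
    _ = (1 + ‖z‖) ^ N * ‖h z‖ * (2 + 2 * R) ^ N := by rw [mul_pow]; ring
    _ ≤ _ := by gcongr; exact hC z

variable (f g : 𝓢(V d, ℂ)) (j : Fin d) (X : Phase d)

/-- The speed `s` is -1 or 1 when x moves in y/2 ∓ x, and 1/2 when the integration variable y moves.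
-/
theorem hasDerivAt_schwartz_line (z : V d) (s t : ℝ) :
    HasDerivAt (fun t : ℝ => f (z + (s * t) • EuclideanSpace.single j 1))
      (s * coordDeriv j f (z + (s * t) • EuclideanSpace.single j 1)) t := by
  have h1 : HasDerivAt (fun t : ℝ => z + (s * t) • EuclideanSpace.single j (1 : ℝ))
      (s • EuclideanSpace.single j (1 : ℝ)) t := by
    have := ((((hasDerivAt_id t).const_mul s).smul_const
      (EuclideanSpace.single j (1 : ℝ)))).const_add z
    simpa using this
  have h2 := (f.hasFDerivAt _).comp_hasDerivAt t h1
  refine h2.congr_deriv ?_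
  rw [map_smul]
  rfl

theorem hasLineDerivAt_wigner_fst :
    HasLineDerivAt ℝ (wigner f g)
      (wigner f (coordDeriv j g) X - wigner (coordDeriv j f) g X) X
      (EuclideanSpace.single j 1, 0) := by
  set e : V d := EuclideanSpace.single j 1
  have he : ‖e‖ = 1 := by simp [e]
  set X' : ℝ → Phase d := fun t => X + t • ((e, 0) : Phase d)
  have hX1 : ∀ t, (X' t).1 = X.1 + t • e := fun t => rfl
  have hX2 : ∀ t, (X' t).2 = X.2 := fun t => by simp [X']
  obtain ⟨b, hb, hbd⟩ := exists_integrable_bound g (‖X.1‖ + 1) (by positivity)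
  obtain ⟨b', hb', hbd'⟩ := exists_integrable_bound (coordDeriv j g) (‖X.1‖ + 1) (by positivity)
  obtain ⟨C, hC⟩ : ∃ C : ℝ, ∀ z, ‖f z‖ ≤ C := ⟨_, f.norm_le_seminorm ℂ⟩
  obtain ⟨C', hC'⟩ : ∃ C : ℝ, ∀ z, ‖coordDeriv j f z‖ ≤ C :=
    ⟨_, (coordDeriv j f).norm_le_seminorm ℂ⟩
  have hz : ∀ t ∈ Metric.ball (0 : ℝ) 1, ∀ y : V d,
      ‖(1 / 2 : ℝ) • y + (X' t).1 - (1 / 2 : ℝ) • y‖ ≤ ‖X.1‖ + 1 := by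
    intro t ht y
    rw [add_sub_cancel_left, hX1]
    refine (norm_add_le _ _).trans ?_
    rw [norm_smul, he, mul_one]
    gcongr
    exact (mem_ball_zero_iff.1 ht).le
  -- The factors from `f` are bounded by their sup norms, and those from `g` are dominated by `b`
  -- and `b'` simultaneously for all |t| < 1.
  have key := hasDerivAt_integral_of_dominated_loc_of_deriv_le (μ := (volume : Measure (V d)))
    (F := fun t y => wignerInt f g (X' t) y) (x₀ := (0 : ℝ))
    (F' := fun t y => wignerInt f (coordDeriv j g) (X' t) y - wignerInt (coordDeriv j f) g (X' t) y)
    (bound := fun y => C * b' y + C' * b y) (Metric.ball_mem_nhds 0 one_pos)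
    (.of_forall fun t => (integrable_wignerInt f g _).aestronglyMeasurable)
    (integrable_wignerInt f g _)
    ((integrable_wignerInt f _ _).sub (integrable_wignerInt _ g _)).aestronglyMeasurable
    (.of_forall fun y t ht => ?_) ((hb'.const_mul C).add (hb.const_mul C'))
    (.of_forall fun y t ht => ?_)
  · have h := key.2
    rw [integral_sub (integrable_wignerInt f _ _) (integrable_wignerInt _ g _)] at h
    have h0 : X' 0 = X := by simp [X']
    rw [h0] at h
    exact h
  · refine (norm_sub_le _ _).trans ?_
    simp only [wignerInt, norm_mul, norm_exp_I_mul_ofReal, mul_one]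
    have h1 := hbd y _ (hz t ht y)
    have h2 := hbd' y _ (hz t ht y)
    have hC0 : 0 ≤ C := (norm_nonneg _).trans (hC 0)
    have hC0' : 0 ≤ C' := (norm_nonneg _).trans (hC' 0)
    gcongr
    · exact hC _
    · exact hC' _
  · have h1 := hasDerivAt_schwartz_line f j ((1 / 2 : ℝ) • y - X.1) (-1) t
    have h2 := hasDerivAt_schwartz_line g j ((1 / 2 : ℝ) • y + X.1) 1 t
    have h3 := (h1.mul h2).mul_const (Complex.exp (Complex.I * ((inner ℝ y X.2 : ℝ) : ℂ)))
    have e1 : ∀ t : ℝ, (1 / 2 : ℝ) • y - (X' t).1 = (1 / 2 : ℝ) • y - X.1 + (-1 * t) • e := by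
      intro t
      rw [hX1, neg_one_mul, neg_smul]
      abel
    have e2 : ∀ t : ℝ, (1 / 2 : ℝ) • y + (X' t).1 = (1 / 2 : ℝ) • y + X.1 + (1 * t) • e := by
      intro t
      rw [hX1, one_mul]
      abel
    have e3 : (fun t => wignerInt f g (X' t) y) = fun t =>
        f ((1 / 2 : ℝ) • y - X.1 + (-1 * t) • e) * g ((1 / 2 : ℝ) • y + X.1 + (1 * t) • e) *
          Complex.exp (Complex.I * ((inner ℝ y X.2 : ℝ) : ℂ)) := by
      ext t
      rw [wignerInt, e1, e2, hX2]
    rw [e3]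
    refine h3.congr_deriv ?_
    simp only [wignerInt, e1, e2, hX2, e]
    push_cast
    ring

theorem wignerInt_mul_coord (y : V d) :
    (y j : ℂ) * wignerInt f g X y =
      wignerInt (coordMul j f) g X y + wignerInt f (coordMul j g) X y := by
  simp only [wignerInt, coordMul_apply, PiLp.add_apply, PiLp.sub_apply, PiLp.smul_apply,
    smul_eq_mul]
  push_cast
  ring

/-- Differentiation in ξ_j brings down i y_j, and y_j is the sum of the j-th coordinates of y/2 - x
and y/2 + x. The modulus of the differentiated integrand does not depend on ξ, so it is its own
majorant. -/
theorem hasLineDerivAt_wigner_snd :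
    HasLineDerivAt ℝ (wigner f g)
      (Complex.I * (wigner (coordMul j f) g X + wigner f (coordMul j g) X)) X
      (0, EuclideanSpace.single j 1) := by
  set e : V d := EuclideanSpace.single j 1
  set X' : ℝ → Phase d := fun t => X + t • ((0, e) : Phase d)
  have hX1 : ∀ t, (X' t).1 = X.1 := fun t => by simp [X']
  have hX2 : ∀ t, (X' t).2 = X.2 + t • e := fun t => rfl
  have hint : ∀ t, Integrable fun y => wignerInt (coordMul j f) g (X' t) y +
      wignerInt f (coordMul j g) (X' t) y := fun t =>
    (integrable_wignerInt _ g _).add (integrable_wignerInt f _ _)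
  have key := hasDerivAt_integral_of_dominated_loc_of_deriv_le (μ := (volume : Measure (V d)))
    (F := fun t y => wignerInt f g (X' t) y) (x₀ := (0 : ℝ))
    (F' := fun t y => Complex.I * ((y j : ℂ) * wignerInt f g (X' t) y))
    (bound := fun y => ‖wignerInt (coordMul j f) g X y +
      wignerInt f (coordMul j g) X y‖) (Metric.ball_mem_nhds 0 one_pos)
    (.of_forall fun t => (integrable_wignerInt f g _).aestronglyMeasurable)
    (integrable_wignerInt f g _) ?_
    (.of_forall fun y t ht => ?_) ?_
    (.of_forall fun y t ht => ?_)
  · have h := key.2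
    have h0 : X' 0 = X := by simp [X']
    rw [integral_const_mul, h0] at h
    simp only [wignerInt_mul_coord] at h
    rw [integral_add (integrable_wignerInt _ g _) (integrable_wignerInt f _ _)] at h
    exact h
  · simp only [wignerInt_mul_coord]
    exact (hint 0).aestronglyMeasurable.const_mul _
  · rw [← wignerInt_mul_coord]
    simp only [wignerInt, norm_mul, norm_exp_I_mul_ofReal, mul_one, Complex.norm_I, one_mul, hX1]
    exact le_rfl
  · have h0 : X' 0 = X := by simp [X']
    have := (hint 0).norm
    rwa [h0] at this
  · have hin : ∀ t, (inner ℝ y (X' t).2 : ℝ) = inner ℝ y X.2 + t * y j := by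
      intro t
      rw [hX2, inner_add_right, inner_smul_right, EuclideanSpace.inner_single_right]
      simp
    have h1 : HasDerivAt (fun t : ℝ => Complex.I * ((inner ℝ y X.2 + t * y j : ℝ) : ℂ))
        (Complex.I * ((y j : ℝ) : ℂ)) t := by
      have := (((hasDerivAt_id t).mul_const (y j)).const_add (inner ℝ y X.2)).ofReal_comp.const_mul
        Complex.I
      simpa using this
    have h2 := h1.cexp.const_mul (f ((1 / 2 : ℝ) • y - X.1) * g ((1 / 2 : ℝ) • y + X.1))
    simp only [wignerInt, hin, hX1]
    refine h2.congr_deriv ?_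
    ring

/-- The number 2x_j is the difference of the j-th coordinates of y/2 + x and y/2 - x. -/
theorem two_mul_fst_mul_wigner :
    2 * (X.1 j : ℂ) * wigner f g X = wigner f (coordMul j g) X - wigner (coordMul j f) g X := by
  unfold wigner
  rw [← integral_sub (integrable_wignerInt f _ _) (integrable_wignerInt _ g _),
    ← integral_const_mul]
  congr 1 with y
  simp only [wignerInt, coordMul_apply, PiLp.add_apply, PiLp.sub_apply, PiLp.smul_apply,
    smul_eq_mul]
  push_cast
  ring

/-- Integration by parts in y_j: the exponential contributes iξ_j, and each of the dilated factors
f(y/2 - x), g(y/2 + x) contributes half of its derivative. -/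
theorem snd_mul_wigner :
    -(2 * Complex.I * (X.2 j : ℂ)) * wigner f g X =
      wigner (coordDeriv j f) g X + wigner f (coordDeriv j g) X := by
  set e : V d := EuclideanSpace.single j 1
  set F : V d → ℂ := fun y => f ((1 / 2 : ℝ) • y - X.1) * g ((1 / 2 : ℝ) • y + X.1)
  set F' : V d → ℂ := fun y => (1 / 2 : ℂ) *
    (coordDeriv j f ((1 / 2 : ℝ) • y - X.1) * g ((1 / 2 : ℝ) • y + X.1) +
      f ((1 / 2 : ℝ) • y - X.1) * coordDeriv j g ((1 / 2 : ℝ) • y + X.1))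
  set E : V d → ℂ := fun y => Complex.exp (Complex.I * ((inner ℝ y X.2 : ℝ) : ℂ))
  set E' : V d → ℂ := fun y => E y * (Complex.I * (X.2 j : ℂ))
  have hF : ∀ y, HasLineDerivAt ℝ F (F' y) y e := by
    intro y
    have h1 := hasDerivAt_schwartz_line f j ((1 / 2 : ℝ) • y - X.1) (1 / 2) 0
    have h2 := hasDerivAt_schwartz_line g j ((1 / 2 : ℝ) • y + X.1) (1 / 2) 0
    have h3 := h1.mul h2
    have e3 : (fun t : ℝ => F (y + t • e)) = fun t =>
        f ((1 / 2 : ℝ) • y - X.1 + (1 / 2 * t) • e) *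
          g ((1 / 2 : ℝ) • y + X.1 + (1 / 2 * t) • e) := by
      ext t
      simp only [F, smul_add, mul_smul]
      congr 2 <;> abel
    unfold HasLineDerivAt
    rw [e3]
    refine h3.congr_deriv ?_
    simp only [mul_zero, zero_smul, add_zero, F']
    push_cast
    ring
  have hE : ∀ y, HasLineDerivAt ℝ E (E' y) y e := by
    intro y
    have h1 : HasDerivAt (fun t : ℝ => Complex.I * ((inner ℝ y X.2 + t * X.2 j : ℝ) : ℂ))
        (Complex.I * ((X.2 j : ℝ) : ℂ)) 0 := by
      have := (((hasDerivAt_id (0 : ℝ)).mul_const (X.2 j)).const_add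
        (inner ℝ y X.2)).ofReal_comp.const_mul Complex.I
      simpa using this
    have h2 := h1.cexp
    have e3 : (fun t : ℝ => E (y + t • e)) = fun t =>
        Complex.exp (Complex.I * ((inner ℝ y X.2 + t * X.2 j : ℝ) : ℂ)) := by
      ext t
      simp only [E, e, inner_add_left, inner_smul_left, EuclideanSpace.inner_single_left]
      simp
    unfold HasLineDerivAt
    rw [e3]
    refine h2.congr_deriv ?_
    simp [E', E]
  have hi1 : ∀ y, F' y * E y =
      (1 / 2 : ℂ) * (wignerInt (coordDeriv j f) g X y + wignerInt f (coordDeriv j g) X y) := by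
    intro y
    simp only [F', E, wignerInt]
    ring
  have hi2 : ∀ y, F y * E' y = Complex.I * (X.2 j : ℂ) * wignerInt f g X y := by
    intro y
    simp only [F, E', E, wignerInt]
    ring
  have hs := (integrable_wignerInt (coordDeriv j f) g X).add
    (integrable_wignerInt f (coordDeriv j g) X)
  have key := integral_bilinear_hasLineDerivAt_right_eq_neg_left_of_integrable
    (μ := (volume : Measure (V d))) (f := F) (f' := F') (g := E) (g' := E') (v := e)
    (B := ContinuousLinearMap.mul ℝ ℂ)
    (by
      simp only [ContinuousLinearMap.mul_apply', hi1]
      exact hs.const_mul _)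
    (by
      simp only [ContinuousLinearMap.mul_apply', hi2]
      exact (integrable_wignerInt f g X).const_mul _)
    (integrable_wignerInt f g X) (fun y _ => hF y) (fun y _ => hE y)
  simp only [ContinuousLinearMap.mul_apply', hi1, hi2] at key
  rw [integral_const_mul, integral_const_mul,
    integral_add (integrable_wignerInt _ g _) (integrable_wignerInt f _ _)] at key
  unfold wigner
  linear_combination -2 * key

/-- Pointwise |ab| ≤ |a|² + |b|², and the dilation y ↦ y/2 costs 2^d. Only L² norms enter, which for
Hermite functions are independent of the index; this makes the sup norms of ϱ_α uniformly bounded.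
-/
theorem norm_wigner_le :
    ‖wigner f g X‖ ≤ (2 : ℝ) ^ d * ((∫ x, ‖f x‖ ^ 2) + ∫ x, ‖g x‖ ^ 2) := by
  have hsq : ∀ h : 𝓢(V d, ℂ), Integrable fun x => ‖h x‖ ^ 2 := fun h => by
    simpa [norm_mul, sq] using (integrable_mul_schwartz (μ := (volume : Measure (V d))) h h).norm
  have hscale : ∀ (h : 𝓢(V d, ℂ)) (x : V d),
      ∫ y, ‖dilateTranslate x h y‖ ^ 2 = (2 : ℝ) ^ d * ∫ y, ‖h y‖ ^ 2 := by
    intro h x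
    simp only [dilateTranslate_apply]
    rw [Measure.integral_comp_smul volume (fun y => ‖h (y - x)‖ ^ 2) (1 / 2 : ℝ),
      integral_sub_right_eq_self (fun y => ‖h y‖ ^ 2) x]
    simp
  rw [mul_add, ← hscale f X.1, ← hscale g (-X.1), ← integral_add (hsq _) (hsq _)]
  refine norm_integral_le_of_norm_le ((hsq _).add (hsq _)) (.of_forall fun y => ?_)
  rw [wignerInt, norm_mul, norm_exp_I_mul_ofReal, mul_one, norm_mul,
    dilateTranslate_neg_apply, dilateTranslate_apply]
  nlinarith [sq_nonneg (‖f ((1 / 2 : ℝ) • y - X.1)‖ - ‖g ((1 / 2 : ℝ) • y + X.1)‖),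
    sq_nonneg ‖f ((1 / 2 : ℝ) • y - X.1)‖, sq_nonneg ‖g ((1 / 2 : ℝ) • y + X.1)‖]

end Wigner

/-! ### Commutation relations -/

section Commutation
variable {d : ℕ} (f : 𝓢(Phase d, ℂ))

theorem lineDerivOp_comm {E : Type*} [NormedAddCommGroup E] [NormedSpace ℝ E] (f : 𝓢(E, ℂ))
    (v w : E) : ∂_{v} (∂_{w} f) = ∂_{w} (∂_{v} f) := by
  ext x
  have h2 : HasFDerivAt (fderiv ℝ f) (fderiv ℝ (fderivCLM ℝ E ℂ f) x) x :=
    (fderivCLM ℝ E ℂ f).hasFDerivAt x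
  have key : ∀ v w : E, ∂_{v} (∂_{w} f) x = fderiv ℝ (fderivCLM ℝ E ℂ f) x v w := by
    intro v w
    rw [lineDerivOp_apply_eq_fderiv]
    have h3 : HasFDerivAt (∂_{w} f : 𝓢(E, ℂ)) _ x :=
      ((ContinuousLinearMap.apply ℝ ℂ w).hasFDerivAt).comp x h2
    rw [h3.fderiv]
    rfl
  rw [key, key]
  exact second_derivative_symmetric (f := f) (f' := fderiv ℝ f) (fun y => f.hasFDerivAt y) h2 v w

theorem lineDerivOp_smulLeft_clm {E : Type*} [NormedAddCommGroup E] [NormedSpace ℝ E]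
    (L : E →L[ℝ] ℝ) (f : 𝓢(E, ℂ)) (v : E) :
    ∂_{v} (smulLeftCLM ℂ (fun x => ((L x : ℝ) : ℂ)) f) =
      (L v : ℂ) • f + smulLeftCLM ℂ (fun x => ((L x : ℝ) : ℂ)) (∂_{v} f) := by
  have hL : (fun x => ((L x : ℝ) : ℂ)).HasTemperateGrowth :=
    (Complex.ofRealCLM.comp L).hasTemperateGrowth
  ext x
  have h1 : HasFDerivAt (smulLeftCLM ℂ (fun x => ((L x : ℝ) : ℂ)) f) _ x :=
    ((Complex.ofRealCLM.comp L).hasFDerivAt (x := x)).mul (f.hasFDerivAt x) |>.congr_of_eventuallyEq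
      (.of_forall fun y => by simp [smulLeftCLM_apply_apply hL])
  rw [lineDerivOp_apply_eq_fderiv, h1.fderiv]
  simp [smulLeftCLM_apply_apply hL, lineDerivOp_apply_eq_fderiv]
  ring

theorem dx_dξ (i j : Fin d) : dx i (dξ j f) = dξ j (dx i f) := lineDerivOp_comm f _ _

theorem dx_mulx (j : Fin d) : dx j (mulx j f) = f + mulx j (dx j f) := by
  refine (lineDerivOp_smulLeft_clm ((EuclideanSpace.proj (𝕜 := ℝ) j).comp
    (ContinuousLinearMap.fst ℝ (V d) (V d))) f _).trans ?_
  congr 1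
  simp

theorem dx_mulξ (i j : Fin d) : dx i (mulξ j f) = mulξ j (dx i f) := by
  refine (lineDerivOp_smulLeft_clm ((EuclideanSpace.proj (𝕜 := ℝ) j).comp
    (ContinuousLinearMap.snd ℝ (V d) (V d))) f _).trans ?_
  refine (congrArg (· + _) ?_).trans (zero_add _)
  simp

theorem dξ_mulξ (j : Fin d) : dξ j (mulξ j f) = f + mulξ j (dξ j f) := by
  refine (lineDerivOp_smulLeft_clm ((EuclideanSpace.proj (𝕜 := ℝ) j).comp
    (ContinuousLinearMap.snd ℝ (V d) (V d))) f _).trans ?_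
  congr 1
  simp

theorem dξ_mulx (i j : Fin d) : dξ i (mulx j f) = mulx j (dξ i f) := by
  refine (lineDerivOp_smulLeft_clm ((EuclideanSpace.proj (𝕜 := ℝ) j).comp
    (ContinuousLinearMap.fst ℝ (V d) (V d))) f _).trans ?_
  refine (congrArg (· + _) ?_).trans (zero_add _)
  simp

theorem mulx_mulξ (i j : Fin d) : mulx i (mulξ j f) = mulξ j (mulx i f) := by
  ext X
  simp only [mulx_apply, mulξ_apply]
  ring

end Commutation

/-! ### Ladder operators on phase space -/

/-- The annihilation operator for the first index. -/
def lowerFst {d : ℕ} (j : Fin d) : 𝓢(Phase d, ℂ) →L[ℂ] 𝓢(Phase d, ℂ) :=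
  (-(Complex.I / 2)) • dξ j - mulx j - Complex.I • mulξ j - (1 / 2 : ℂ) • dx j

/-- The creation operator for the first index. -/
def raiseFst {d : ℕ} (j : Fin d) : 𝓢(Phase d, ℂ) →L[ℂ] 𝓢(Phase d, ℂ) :=
  (-(Complex.I / 2)) • dξ j - mulx j + Complex.I • mulξ j + (1 / 2 : ℂ) • dx j

/-- The annihilation operator for the second index. -/
def lowerSnd {d : ℕ} (j : Fin d) : 𝓢(Phase d, ℂ) →L[ℂ] 𝓢(Phase d, ℂ) :=
  (-(Complex.I / 2)) • dξ j + mulx j - Complex.I • mulξ j + (1 / 2 : ℂ) • dx j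

/-- The creation operator for the second index. -/
def raiseSnd {d : ℕ} (j : Fin d) : 𝓢(Phase d, ℂ) →L[ℂ] 𝓢(Phase d, ℂ) :=
  (-(Complex.I / 2)) • dξ j + mulx j + Complex.I • mulξ j - (1 / 2 : ℂ) • dx j

section LadderOperators
variable {d : ℕ} (j : Fin d)

theorem lowerFst_apply (f : 𝓢(Phase d, ℂ)) : lowerFst j f =
    (-(Complex.I / 2)) • dξ j f - mulx j f - Complex.I • mulξ j f - (1 / 2 : ℂ) • dx j f := rfl

theorem raiseFst_apply (f : 𝓢(Phase d, ℂ)) : raiseFst j f =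
    (-(Complex.I / 2)) • dξ j f - mulx j f + Complex.I • mulξ j f + (1 / 2 : ℂ) • dx j f := rfl

theorem lowerSnd_apply (f : 𝓢(Phase d, ℂ)) : lowerSnd j f =
    (-(Complex.I / 2)) • dξ j f + mulx j f - Complex.I • mulξ j f + (1 / 2 : ℂ) • dx j f := rfl

theorem raiseSnd_apply (f : 𝓢(Phase d, ℂ)) : raiseSnd j f =
    (-(Complex.I / 2)) • dξ j f + mulx j f + Complex.I • mulξ j f - (1 / 2 : ℂ) • dx j f := rfl

/-- The passage from x_j, ξ_j, ∂_{x_j}, ∂_{ξ_j} to the four ladder operators is linear and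
invertible. This and the three following identities are its inverse, through which facts about the
ladders reach seminorms and polynomial multiplication. -/
theorem mulx_eq_ladder (f : 𝓢(Phase d, ℂ)) : mulx j f =
    (1 / 4 : ℂ) • (lowerSnd j f + raiseSnd j f - lowerFst j f - raiseFst j f) := by
  rw [lowerFst_apply, raiseFst_apply, lowerSnd_apply, raiseSnd_apply]
  module

theorem mulξ_eq_ladder (f : 𝓢(Phase d, ℂ)) : mulξ j f =
    (Complex.I / 4) • (lowerFst j f - raiseFst j f + lowerSnd j f - raiseSnd j f) := by
  rw [lowerFst_apply, raiseFst_apply, lowerSnd_apply, raiseSnd_apply]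
  match_scalars <;> ring_nf <;> simp only [Complex.I_sq] <;> ring

theorem dx_eq_ladder (f : 𝓢(Phase d, ℂ)) : dx j f =
    (1 / 2 : ℂ) • (lowerSnd j f - raiseSnd j f - lowerFst j f + raiseFst j f) := by
  rw [lowerFst_apply, raiseFst_apply, lowerSnd_apply, raiseSnd_apply]
  module

theorem dξ_eq_ladder (f : 𝓢(Phase d, ℂ)) : dξ j f =
    (Complex.I / 2) • (lowerSnd j f + raiseSnd j f + lowerFst j f + raiseFst j f) := by
  rw [lowerFst_apply, raiseFst_apply, lowerSnd_apply, raiseSnd_apply]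
  match_scalars <;> ring_nf <;> simp only [Complex.I_sq] <;> ring

/-- With A = -(i/2)∂_{ξ_j} - x_j and B = iξ_j + ½∂_{x_j} the product is (A + B)(A - B) = A² - B² -
[A, B], and [A, B] = 1, which the summand `f` compensates. The cross terms of A² and B² form the
rotation part. -/
theorem raiseFst_lowerFst (f : 𝓢(Phase d, ℂ)) : raiseFst j (lowerFst j f) + f =
    mulx j (mulx j f) + mulξ j (mulξ j f) - (1 / 4 : ℂ) • (dx j (dx j f) + dξ j (dξ j f)) +
      (mulξ j (-Complex.I • dx j f) - mulx j (-Complex.I • dξ j f)) := by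
  simp only [raiseFst_apply, lowerFst_apply, map_sub, map_smul, dx_mulx, dx_mulξ, dξ_mulξ,
    dξ_mulx, mulx_mulξ, dx_dξ]
  match_scalars <;> ring_nf <;> simp only [Complex.I_sq] <;> ring

/-- The same computation with A = -(i/2)∂_{ξ_j} + x_j and B = iξ_j - ½∂_{x_j}; the cross terms
change sign. -/
theorem raiseSnd_lowerSnd (f : 𝓢(Phase d, ℂ)) : raiseSnd j (lowerSnd j f) + f =
    mulx j (mulx j f) + mulξ j (mulξ j f) - (1 / 4 : ℂ) • (dx j (dx j f) + dξ j (dξ j f)) -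
      (mulξ j (-Complex.I • dx j f) - mulx j (-Complex.I • dξ j f)) := by
  simp only [raiseSnd_apply, lowerSnd_apply, map_sub, map_add, map_smul, dx_mulx, dx_mulξ, dξ_mulξ,
    dξ_mulx, mulx_mulξ, dx_dξ]
  match_scalars <;> ring_nf <;> simp only [Complex.I_sq] <;> ring

theorem Hσ_eq_sum (f : 𝓢(Phase d, ℂ)) : Hσ d f = ∑ j, (raiseFst j (lowerFst j f) + f) := by
  simp only [raiseFst_lowerFst, Finset.sum_add_distrib, Finset.sum_sub_distrib, ← Finset.smul_sum]
  simp [Hσ, oscillator, rotation, Finset.sum_add_distrib]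

theorem Hσbar_eq_sum (f : 𝓢(Phase d, ℂ)) : Hσbar d f = ∑ j, (raiseSnd j (lowerSnd j f) + f) := by
  simp only [raiseSnd_lowerSnd, Finset.sum_add_distrib, Finset.sum_sub_distrib, ← Finset.smul_sum]
  simp [Hσbar, oscillator, rotation, Finset.sum_add_distrib]

/-! ### Action on the Hermite–Wong functions -/

theorem hermiteWong_apply (α : Idx d) (X : Phase d) :
    hermiteWong α X = (((2 * π) ^ (-(d : ℝ) / 2) : ℝ) : ℂ) *
      wigner (hermiteSchwartz α.1) (hermiteSchwartz α.2) X := by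
  simp only [wigner, wignerInt, hermiteSchwartz_apply]
  rfl

variable (f g : 𝓢(V d, ℂ)) (X : Phase d)

theorem wigner_add_left (f' : 𝓢(V d, ℂ)) :
    wigner (f + f' : 𝓢(V d, ℂ)) g X = wigner f g X + wigner f' g X := by
  unfold wigner
  rw [← integral_add (integrable_wignerInt f g X) (integrable_wignerInt f' g X)]
  congr 1 with y
  simp only [wignerInt, add_apply]
  ring

theorem wigner_smul_left (c : ℂ) : wigner (c • f : 𝓢(V d, ℂ)) g X = c * wigner f g X := by
  unfold wigner
  rw [← integral_const_mul]
  congr 1 with y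
  simp only [wignerInt, smul_apply, smul_eq_mul]
  ring

theorem wigner_add_right (g' : 𝓢(V d, ℂ)) :
    wigner f (g + g' : 𝓢(V d, ℂ)) X = wigner f g X + wigner f g' X := by
  unfold wigner
  rw [← integral_add (integrable_wignerInt f g X) (integrable_wignerInt f g' X)]
  congr 1 with y
  simp only [wignerInt, add_apply]
  ring

theorem wigner_smul_right (c : ℂ) : wigner f (c • g : 𝓢(V d, ℂ)) X = c * wigner f g X := by
  unfold wigner
  rw [← integral_const_mul]
  congr 1 with y
  simp only [wignerInt, smul_apply, smul_eq_mul]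
  ring

variable (c : ℂ) (S : 𝓢(Phase d, ℂ))

/-- The transform is known to be a Schwartz function only for Hermite arguments, so the rules are
stated for any Schwartz `S` that agrees with a multiple of it. -/
theorem dx_wigner (hS : ∀ X, S X = c * wigner f g X) :
    dx j S X = c * (wigner f (coordDeriv j g) X - wigner (coordDeriv j f) g X) := by
  have h : HasLineDerivAt ℝ S _ X _ :=
    ((HasDerivAt.const_mul c (hasLineDerivAt_wigner_fst f g j X)).congr_of_eventuallyEq
      (.of_forall fun t => hS _))
  rw [dx_apply, h.lineDeriv]

theorem dξ_wigner (hS : ∀ X, S X = c * wigner f g X) :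
    dξ j S X = c * (Complex.I * (wigner (coordMul j f) g X + wigner f (coordMul j g) X)) := by
  have h : HasLineDerivAt ℝ S _ X _ :=
    ((HasDerivAt.const_mul c (hasLineDerivAt_wigner_snd f g j X)).congr_of_eventuallyEq
      (.of_forall fun t => hS _))
  rw [dξ_apply, h.lineDeriv]

/-- The coefficients of `lowerFst` are those for which all terms acting on `g` cancel in the four
rules for x_j, ξ_j and the derivatives. The other three ladder operators are treated alike. -/
theorem lowerFst_wigner (hS : ∀ X, S X = c * wigner f g X) :
    lowerFst j S X = c * wigner (coordMul j f + coordDeriv j f : 𝓢(V d, ℂ)) g X := by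
  have h1 := two_mul_fst_mul_wigner f g j X
  have h2 := snd_mul_wigner f g j X
  rw [lowerFst_apply, wigner_add_left]
  simp only [sub_apply, smul_apply, smul_eq_mul, mulx_apply, mulξ_apply, dx_wigner j f g X c S hS,
    dξ_wigner j f g X c S hS, hS]
  linear_combination (-c / 2) * h1 + c / 2 * h2 - c / 2 * (wigner (coordMul j f) g X +
    wigner f (coordMul j g) X) * Complex.I_sq

theorem raiseFst_wigner (hS : ∀ X, S X = c * wigner f g X) :
    raiseFst j S X = c * wigner (coordMul j f - coordDeriv j f : 𝓢(V d, ℂ)) g X := by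
  have h1 := two_mul_fst_mul_wigner f g j X
  have h2 := snd_mul_wigner f g j X
  rw [raiseFst_apply, sub_eq_add_neg (coordMul j f), ← neg_one_smul ℂ (coordDeriv j f),
    wigner_add_left, wigner_smul_left]
  simp only [sub_apply, add_apply, smul_apply, smul_eq_mul, mulx_apply, mulξ_apply,
    dx_wigner j f g X c S hS, dξ_wigner j f g X c S hS, hS]
  linear_combination (-c / 2) * h1 - c / 2 * h2 - c / 2 * (wigner (coordMul j f) g X +
    wigner f (coordMul j g) X) * Complex.I_sq

theorem lowerSnd_wigner (hS : ∀ X, S X = c * wigner f g X) :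
    lowerSnd j S X = c * wigner f (coordMul j g + coordDeriv j g : 𝓢(V d, ℂ)) X := by
  have h1 := two_mul_fst_mul_wigner f g j X
  have h2 := snd_mul_wigner f g j X
  rw [lowerSnd_apply, wigner_add_right]
  simp only [sub_apply, add_apply, smul_apply, smul_eq_mul, mulx_apply, mulξ_apply,
    dx_wigner j f g X c S hS, dξ_wigner j f g X c S hS, hS]
  linear_combination (c / 2) * h1 + c / 2 * h2 - c / 2 * (wigner (coordMul j f) g X +
    wigner f (coordMul j g) X) * Complex.I_sq

theorem raiseSnd_wigner (hS : ∀ X, S X = c * wigner f g X) :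
    raiseSnd j S X = c * wigner f (coordMul j g - coordDeriv j g : 𝓢(V d, ℂ)) X := by
  have h1 := two_mul_fst_mul_wigner f g j X
  have h2 := snd_mul_wigner f g j X
  rw [raiseSnd_apply, sub_eq_add_neg (coordMul j g), ← neg_one_smul ℂ (coordDeriv j g),
    wigner_add_right, wigner_smul_right]
  simp only [sub_apply, add_apply, smul_apply, smul_eq_mul, mulx_apply, mulξ_apply,
    dx_wigner j f g X c S hS, dξ_wigner j f g X c S hS, hS]
  linear_combination (c / 2) * h1 - c / 2 * h2 - c / 2 * (wigner (coordMul j f) g X +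
    wigner f (coordMul j g) X) * Complex.I_sq

variable (α : Idx d)

theorem lowerFst_hermiteWong : lowerFst j (hermiteWong α) =
    (√(2 * α.1 j) : ℂ) • hermiteWong (dn j α.1, α.2) := by
  ext X
  rw [lowerFst_wigner j _ _ X _ _ (hermiteWong_apply α), hermiteSchwartz_lower, wigner_smul_left,
    smul_apply, hermiteWong_apply, smul_eq_mul]
  ring

theorem raiseFst_hermiteWong : raiseFst j (hermiteWong α) =
    (√(2 * α.1 j + 2) : ℂ) • hermiteWong (up j α.1, α.2) := by
  ext X
  rw [raiseFst_wigner j _ _ X _ _ (hermiteWong_apply α), hermiteSchwartz_raise, wigner_smul_left,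
    smul_apply, hermiteWong_apply, smul_eq_mul]
  ring

theorem lowerSnd_hermiteWong : lowerSnd j (hermiteWong α) =
    (√(2 * α.2 j) : ℂ) • hermiteWong (α.1, dn j α.2) := by
  ext X
  rw [lowerSnd_wigner j _ _ X _ _ (hermiteWong_apply α), hermiteSchwartz_lower, wigner_smul_right,
    smul_apply, hermiteWong_apply, smul_eq_mul]
  ring

theorem raiseSnd_hermiteWong : raiseSnd j (hermiteWong α) =
    (√(2 * α.2 j + 2) : ℂ) • hermiteWong (α.1, up j α.2) := by
  ext X
  rw [raiseSnd_wigner j _ _ X _ _ (hermiteWong_apply α), hermiteSchwartz_raise, wigner_smul_right,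
    smul_apply, hermiteWong_apply, smul_eq_mul]
  ring

theorem ofReal_sqrt_mul_self {x : ℝ} (hx : 0 ≤ x) : (√x : ℂ) * (√x : ℂ) = (x : ℂ) := by
  rw [← Complex.ofReal_mul, Real.mul_self_sqrt hx]

/-- Going down and up again gives √(2n)·√(2(n-1)+2) = 2n. For n = 0 both sides vanish, so the
truncated index is harmless and `x = y` is only required for n ≠ 0. -/
theorem sqrt_mul_sqrt_pred_smul {E : Type*} [AddCommGroup E] [Module ℂ E]
    (n : ℕ) (x y : E) (h : n ≠ 0 → x = y) :
    ((√(2 * n) : ℂ) * (√(2 * (n - 1 : ℕ) + 2) : ℂ)) • x = (2 * n : ℂ) • y := by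
  cases n with
  | zero => simp
  | succ n =>
    rw [h n.succ_ne_zero, Nat.add_sub_cancel]
    have : (2 : ℝ) * (n : ℝ) + 2 = 2 * ((n + 1 : ℕ) : ℝ) := by push_cast; ring
    rw [this, ofReal_sqrt_mul_self (by positivity)]
    push_cast
    rfl

theorem raiseFst_lowerFst_hermiteWong : raiseFst j (lowerFst j (hermiteWong α)) =
    (2 * α.1 j : ℂ) • hermiteWong α := by
  rw [lowerFst_hermiteWong, map_smul, raiseFst_hermiteWong, smul_smul]
  dsimp only
  rw [dn_self]
  exact sqrt_mul_sqrt_pred_smul _ _ _ fun h => by rw [up_dn _ _ h]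

theorem raiseSnd_lowerSnd_hermiteWong : raiseSnd j (lowerSnd j (hermiteWong α)) =
    (2 * α.2 j : ℂ) • hermiteWong α := by
  rw [lowerSnd_hermiteWong, map_smul, raiseSnd_hermiteWong, smul_smul]
  dsimp only
  rw [dn_self]
  exact sqrt_mul_sqrt_pred_smul _ _ _ fun h => by rw [up_dn _ _ h]

theorem Hσ_hermiteWong :
    Hσ d (hermiteWong α) = (2 * (len α.1 : ℂ) + (d : ℂ)) • hermiteWong α := by
  simp only [Hσ_eq_sum, raiseFst_lowerFst_hermiteWong, Finset.sum_add_distrib, ← Finset.sum_smul,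
    ← Finset.mul_sum, Finset.sum_const, Finset.card_univ, Fintype.card_fin, add_smul, len,
    Nat.cast_sum, Nat.cast_smul_eq_nsmul]

theorem Hσbar_hermiteWong :
    Hσbar d (hermiteWong α) = (2 * (len α.2 : ℂ) + (d : ℂ)) • hermiteWong α := by
  simp only [Hσbar_eq_sum, raiseSnd_lowerSnd_hermiteWong, Finset.sum_add_distrib,
    ← Finset.sum_smul, ← Finset.mul_sum, Finset.sum_const, Finset.card_univ, Fintype.card_fin,
    add_smul, len, Nat.cast_sum, Nat.cast_smul_eq_nsmul]

end LadderOperators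

/-! ### Generalities on Schwartz functions -/

section SchwartzGeneral
variable {E : Type*} [NormedAddCommGroup E] [NormedSpace ℝ E]

/-! ### Reducing Schwartz seminorms to coordinate multiplications and line derivatives -/

section Coordinates
variable {ι : Type*} [Fintype ι] (b : ι → E) (L : ι → E →L[ℝ] ℝ)

/-- The differential of `f` is the sum of the ∂_{b_i} f tensored with the coordinate forms, so one
order of differentiation can be traded for a first-order operator. -/
theorem seminorm_succ_derivative_le (hL : ∀ x, x = ∑ i, L i x • b i) (f : 𝓢(E, ℂ)) (k n : ℕ) :
    SchwartzMap.seminorm ℂ k (n + 1) f ≤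
      ∑ i, ‖ContinuousLinearMap.smulRightL ℝ E ℂ (L i)‖ *
        SchwartzMap.seminorm ℂ k n (∂_{b i} f) := by
  refine SchwartzMap.seminorm_le_bound ℂ k (n + 1) f
    (Finset.sum_nonneg fun i _ => by positivity) fun x => ?_
  have h1 : fderiv ℝ f =
      fun y => ∑ i, (ContinuousLinearMap.smulRightL ℝ E ℂ (L i) ∘ (∂_{b i} f : 𝓢(E, ℂ))) y := by
    ext y v
    conv_lhs => rw [hL v]
    simp [lineDerivOp_apply_eq_fderiv]
  have hc : ∀ i, ContDiff ℝ n (ContinuousLinearMap.smulRightL ℝ E ℂ (L i) ∘ (∂_{b i} f : 𝓢(E, ℂ))) :=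
    fun i => (ContinuousLinearMap.contDiff _).comp ((∂_{b i} f : 𝓢(E, ℂ)).smooth n)
  rw [← norm_iteratedFDeriv_fderiv, h1, iteratedFDeriv_fun_sum_apply fun i _ => (hc i).contDiffAt]
  refine (mul_le_mul_of_nonneg_left (norm_sum_le _ _) (by positivity)).trans ?_
  rw [Finset.mul_sum]
  refine Finset.sum_le_sum fun i _ => ?_
  have h2 := (ContinuousLinearMap.smulRightL ℝ E ℂ (L i)).norm_iteratedFDeriv_comp_left
    (((∂_{b i} f : 𝓢(E, ℂ)).smooth n).contDiffAt (x := x)) le_rfl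
  calc _ ≤ ‖x‖ ^ k * (‖ContinuousLinearMap.smulRightL ℝ E ℂ (L i)‖ *
        ‖iteratedFDeriv ℝ n (∂_{b i} f : 𝓢(E, ℂ)) x‖) := by gcongr
    _ = ‖ContinuousLinearMap.smulRightL ℝ E ℂ (L i)‖ *
        (‖x‖ ^ k * ‖iteratedFDeriv ℝ n (∂_{b i} f : 𝓢(E, ℂ)) x‖) := by ring
    _ ≤ _ := by gcongr; exact SchwartzMap.le_seminorm ℂ k n _ x

/-- One factor ‖x‖ is at most a combination of the |L_i x|. The case without derivatives suffices,
since derivatives are added afterwards. -/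
theorem seminorm_succ_pow_le (hL : ∀ x, x = ∑ i, L i x • b i) (f : 𝓢(E, ℂ)) (k : ℕ) :
    SchwartzMap.seminorm ℂ (k + 1) 0 f ≤
      ∑ i, ‖b i‖ * SchwartzMap.seminorm ℂ k 0 (smulLeftCLM ℂ (fun x => ((L i x : ℝ) : ℂ)) f) := by
  refine SchwartzMap.seminorm_le_bound ℂ (k + 1) 0 f
    (Finset.sum_nonneg fun i _ => mul_nonneg (norm_nonneg _) (apply_nonneg _ _)) fun x => ?_
  have hx : ‖x‖ ≤ ∑ i, ‖L i x‖ * ‖b i‖ := by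
    conv_lhs => rw [hL x]
    refine (norm_sum_le _ _).trans (Finset.sum_le_sum fun i _ => ?_)
    rw [norm_smul]
  rw [norm_iteratedFDeriv_zero, pow_succ]
  calc ‖x‖ ^ k * ‖x‖ * ‖f x‖ ≤ ‖x‖ ^ k * (∑ i, ‖L i x‖ * ‖b i‖) * ‖f x‖ := by gcongr
    _ = ∑ i, ‖b i‖ * (‖x‖ ^ k * (‖L i x‖ * ‖f x‖)) := by
        rw [Finset.mul_sum, Finset.sum_mul]
        exact Finset.sum_congr rfl fun i _ => by ring
    _ ≤ _ := by
        refine Finset.sum_le_sum fun i _ => mul_le_mul_of_nonneg_left ?_ (norm_nonneg _)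
        have h := SchwartzMap.norm_pow_mul_le_seminorm ℂ
          (smulLeftCLM ℂ (fun x => ((L i x : ℝ) : ℂ)) f) k x
        have hL' : (fun x => ((L i x : ℝ) : ℂ)).HasTemperateGrowth :=
          (Complex.ofRealCLM.comp (L i)).hasTemperateGrowth
        rwa [smulLeftCLM_apply_apply hL', norm_smul, Complex.norm_real] at h

end Coordinates

/-! ### Absolutely convergent series of Schwartz functions -/

section Series
variable {ι : Type*} {f : ι → 𝓢(E, ℂ)}

theorem norm_iteratedFDeriv_le_seminorm_zero (f : 𝓢(E, ℂ)) (n : ℕ) (x : E) :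
    ‖iteratedFDeriv ℝ n f x‖ ≤ SchwartzMap.seminorm ℂ 0 n f := by
  simpa using SchwartzMap.le_seminorm ℂ 0 n f x

/-- The subset `s` lets one estimate serve both the full sum and the tails over complements of
finite sets. -/
theorem schwartzSeries_decay (hf : ∀ k n, Summable fun i => SchwartzMap.seminorm ℂ k n (f i))
    (s : Set ι) (k n : ℕ) (x : E) :
    ‖x‖ ^ k * ‖iteratedFDeriv ℝ n (fun y => ∑' i : s, f i y) x‖ ≤
      ∑' i : s, SchwartzMap.seminorm ℂ k n (f i) := by
  have htsum : iteratedFDeriv ℝ n (fun y => ∑' i : s, f i y) x =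
      ∑' i : s, iteratedFDeriv ℝ n (f i) x :=
    iteratedFDeriv_tsum_apply (N := (⊤ : ℕ∞)) (f := fun (i : s) => (f i : E → ℂ))
      (v := fun n (i : s) => SchwartzMap.seminorm ℂ 0 n (f i)) (fun i => (f i).smooth _)
      (fun n _ => (hf 0 n).subtype s)
      (fun n i x _ => norm_iteratedFDeriv_le_seminorm_zero (f i) n x)
      (by exact_mod_cast le_top) x
  have hs : Summable fun i : s => ‖iteratedFDeriv ℝ n (f i) x‖ :=
    Summable.of_nonneg_of_le (fun _ => norm_nonneg _)
      (fun i => norm_iteratedFDeriv_le_seminorm_zero (f i) n x) ((hf 0 n).subtype s)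
  rw [htsum]
  refine (mul_le_mul_of_nonneg_left (norm_tsum_le_tsum_norm hs) (by positivity)).trans ?_
  rw [← tsum_mul_left]
  exact (hs.mul_left _).tsum_le_tsum (fun i => SchwartzMap.le_seminorm ℂ k n (f i) x)
    ((hf k n).subtype s)

theorem contDiff_schwartzSeries (hf : ∀ k n, Summable fun i => SchwartzMap.seminorm ℂ k n (f i))
    (s : Set ι) :
    ContDiff ℝ (⊤ : ℕ∞) fun y => ∑' i : s, f i y :=
  contDiff_tsum (N := (⊤ : ℕ∞)) (f := fun (i : s) => (f i : E → ℂ))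
    (v := fun n (i : s) => SchwartzMap.seminorm ℂ 0 n (f i)) (fun i => (f i).smooth _)
    (fun n _ => (hf 0 n).subtype s)
    (fun n i x _ => norm_iteratedFDeriv_le_seminorm_zero (f i) n x)

/-- The sum over `s` of a series which converges absolutely in every Schwartz seminorm. -/
def schwartzSeries (hf : ∀ k n, Summable fun i => SchwartzMap.seminorm ℂ k n (f i))
    (s : Set ι) : 𝓢(E, ℂ) where
  toFun y := ∑' i : s, f i y
  smooth' := contDiff_schwartzSeries hf s
  decay' k n := ⟨_, schwartzSeries_decay hf s k n⟩

/-- A series of Schwartz functions converges if it converges absolutely in every seminorm. -/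
theorem summable_of_summable_seminorm (hf : ∀ k n, Summable fun i => SchwartzMap.seminorm ℂ k n (f i)) :
    Summable f := by
  have hpt : ∀ x, Summable fun i => f i x := fun x =>
    Summable.of_norm_bounded (hf 0 0) fun i => (f i).norm_le_seminorm ℂ x
  refine ⟨schwartzSeries hf Set.univ, ?_⟩
  rw [HasSum, SummationFilter.unconditional_filter,
    (schwartz_withSeminorms ℂ E ℂ).tendsto_nhds]
  intro m ε hε
  have htail := (tendsto_order.1 (tendsto_tsum_compl_atTop_zero
    fun i => SchwartzMap.seminorm ℂ m.1 m.2 (f i))).2 ε hε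
  filter_upwards [htail] with s hs
  -- The error of a partial sum is the series over the complement, whose seminorm is at most the
  -- tail of a convergent numerical series.
  have hdiff : (∑ i ∈ s, f i) - schwartzSeries hf Set.univ = -schwartzSeries hf {i | i ∉ s} := by
    ext x
    have h1 := (hpt x).sum_add_tsum_subtype_compl s
    have h2 : schwartzSeries hf Set.univ x = ∑' i, f i x := tsum_univ fun i => f i x
    have h3 : schwartzSeries hf {i | i ∉ s} x = ∑' i : {i // i ∉ s}, f i x := rfl
    rw [sub_apply, neg_apply, sum_apply, h2, h3, ← h1]
    ring
  rw [hdiff, map_neg_eq_map]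
  refine lt_of_le_of_lt ?_ hs
  exact SchwartzMap.seminorm_le_bound ℂ m.1 m.2 _
    (tsum_nonneg fun i => apply_nonneg _ _) (schwartzSeries_decay hf _ m.1 m.2)

end Series

/-- A Schwartz function with vanishing Fourier transform is zero. -/
theorem eq_zero_of_integral_exp_eq_zero [FiniteDimensional ℝ E] [MeasurableSpace E] [BorelSpace E]
    (μ : Measure E) [μ.IsAddHaarMeasure] (h : 𝓢(E, ℂ))
    (H : ∀ L : E →L[ℝ] ℝ, ∫ x, Complex.exp (Complex.I * (L x : ℂ)) * h x ∂μ = 0) : h = 0 := by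
  -- The phase space carries the maximum norm, so the function is moved to a Euclidean space, where
  -- Fourier inversion applies.
  let e : E ≃L[ℝ] EuclideanSpace ℝ (Fin (Module.finrank ℝ E)) := toEuclidean
  let k : 𝓢(EuclideanSpace ℝ (Fin (Module.finrank ℝ E)), ℂ) :=
    compCLMOfContinuousLinearEquiv ℂ e.symm h
  have hk : ∀ v, k v = h (e.symm v) := fun v => rfl
  have hF : FourierTransform.fourier k = 0 := by
    ext w
    rw [fourier_coe, Real.fourier_eq']
    let L : E →L[ℝ] ℝ := (-(2 * π)) • (innerSL ℝ w).comp (e : E →L[ℝ] _)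
    have h1 : ∀ v, Complex.exp (((-2 * π * inner ℝ v w : ℝ) : ℂ) * Complex.I) • k v =
        (fun x => Complex.exp (Complex.I * (L x : ℂ)) * h x) (e.symm v) := by
      intro v
      simp only [smul_eq_mul, hk, L, smul_apply, ContinuousLinearMap.comp_apply,
        ContinuousLinearEquiv.coe_coe, ContinuousLinearEquiv.apply_symm_apply, innerSL_apply_apply]
      rw [real_inner_comm, mul_comm Complex.I, neg_mul]
    simp only [h1]
    have h2 := (e.symm.toHomeomorph.measurableEmbedding).integral_map (μ := volume)
      (fun x => Complex.exp (Complex.I * (L x : ℂ)) * h x)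
    refine h2.symm.trans ?_
    -- The transported Lebesgue measure is a Haar measure, hence a multiple of `μ`, and the
    -- vanishing is unaffected.
    have h3 : (volume.map e.symm.toHomeomorph).IsAddHaarMeasure :=
      e.symm.isAddHaarMeasure_map volume
    rw [Measure.isAddLeftInvariant_eq_smul (volume.map e.symm.toHomeomorph) μ,
      integral_smul_nnreal_measure, H L, smul_zero]
    rfl
  have hk0 : k = 0 := by
    have h := FourierTransform.fourierInv_fourier_eq
      (F := 𝓢(EuclideanSpace ℝ (Fin (Module.finrank ℝ E)), ℂ)) k
    rw [← h, hF]
    exact map_zero (FourierTransform.fourierInvCLM ℂ _)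
  ext x
  have := hk (e x)
  rw [hk0, e.symm_apply_apply] at this
  exact this.symm

end SchwartzGeneral

/-! ### The bilinear pairing on phase space -/

instance isAddHaarMeasure_phase (d : ℕ) : (volume : Measure (Phase d)).IsAddHaarMeasure :=
  inferInstanceAs (((volume : Measure (V d)).prod (volume : Measure (V d))).IsAddHaarMeasure)

/-- The bilinear pairing `(f, g) ↦ ∫ f g`. -/
def pair {d : ℕ} : 𝓢(Phase d, ℂ) →ₗ[ℂ] 𝓢(Phase d, ℂ) →L[ℂ] ℂ where
  toFun f := integralCLM ℂ volume ∘L pairing (ContinuousLinearMap.mul ℂ ℂ) f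
  map_add' f g := by rw [map_add, ContinuousLinearMap.comp_add]
  map_smul' c f := by rw [map_smul, ContinuousLinearMap.comp_smul]; rfl

section Pair
variable {d : ℕ} (f g : 𝓢(Phase d, ℂ)) (j : Fin d)

theorem pair_apply : pair f g = ∫ X, f X * g X := rfl

theorem pair_comm : pair f g = pair g f := by
  simp only [pair_apply, mul_comm]

theorem pair_dx : pair (dx j f) g = -pair f (dx j g) := by
  rw [pair_apply, pair_apply, eq_neg_iff_add_eq_zero, add_comm, ← eq_neg_iff_add_eq_zero]
  exact SchwartzMap.integral_mul_lineDerivOp_right_eq_neg_left f g _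

theorem pair_dξ : pair (dξ j f) g = -pair f (dξ j g) := by
  rw [pair_apply, pair_apply, eq_neg_iff_add_eq_zero, add_comm, ← eq_neg_iff_add_eq_zero]
  exact SchwartzMap.integral_mul_lineDerivOp_right_eq_neg_left f g _

theorem pair_mulx : pair (mulx j f) g = pair f (mulx j g) := by
  simp only [pair_apply, mulx_apply]
  congr 1 with X
  ring

theorem pair_mulξ : pair (mulξ j f) g = pair f (mulξ j g) := by
  simp only [pair_apply, mulξ_apply]
  congr 1 with X
  ring

/-- Transposition changes the sign of the derivatives only, which turns `lowerFst` into `-raiseSnd`.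
Thus it exchanges the two indices; in `pair_Hσ` two such signs cancel and H_σ becomes H̄_σ. -/
theorem pair_lowerFst : pair (lowerFst j f) g = -pair f (raiseSnd j g) := by
  simp only [lowerFst_apply, raiseSnd_apply, map_sub, map_add, map_smul, sub_apply,
    smul_apply, pair_dx, pair_dξ, pair_mulx, pair_mulξ, smul_eq_mul]
  ring

theorem pair_raiseFst : pair (raiseFst j f) g = -pair f (lowerSnd j g) := by
  simp only [raiseFst_apply, lowerSnd_apply, map_sub, map_add, map_smul, sub_apply, add_apply,
    smul_apply, pair_dx, pair_dξ, pair_mulx, pair_mulξ, smul_eq_mul]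
  ring

theorem pair_lowerSnd : pair (lowerSnd j f) g = -pair f (raiseFst j g) := by
  rw [pair_comm, pair_comm f, pair_raiseFst, neg_neg]

theorem pair_raiseSnd : pair (raiseSnd j f) g = -pair f (lowerFst j g) := by
  rw [pair_comm, pair_comm f, pair_lowerFst, neg_neg]

theorem pair_Hσ : pair (Hσ d f) g = pair f (Hσbar d g) := by
  simp only [Hσ_eq_sum, Hσbar_eq_sum, map_sum, map_add, add_apply, sum_apply, pair_raiseFst,
    pair_lowerFst, neg_neg]

theorem norm_pair_le {C : ℝ} (hC : ∀ X, ‖f X‖ ≤ C) : ‖pair f g‖ ≤ C * ∫ X, ‖g X‖ := by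
  rw [pair_apply, ← integral_const_mul]
  refine norm_integral_le_of_norm_le (g.integrable.norm.const_mul _) (.of_forall fun X => ?_)
  rw [norm_mul]
  gcongr
  exact hC X

end Pair

/-! ### Biorthogonality -/

/-- The complex conjugate of `ϱ_α`, up to normalization the biorthogonal family of `ϱ_α` for the
bilinear pairing. -/
def hermiteWongDual {d : ℕ} (α : Idx d) : 𝓢(Phase d, ℂ) :=
  ((-1 : ℂ) ^ (len α.1 + len α.2)) • hermiteWong (α.2, α.1)

section Biorthogonal
variable {d : ℕ} (α β : Idx d) (j : Fin d)

/-- The number operator of the first index in direction j is transposed to that of the second. If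
the pairing is nonzero, the eigenvalues 2α₁(j) and 2β₂(j) agree for every j, and likewise with the
roles exchanged. -/
theorem pair_hermiteWong_eq_zero (h : α ≠ (β.2, β.1)) :
    pair (hermiteWong α) (hermiteWong β) = 0 := by
  have h1 : ∀ j, ((2 * α.1 j : ℂ) - 2 * β.2 j) * pair (hermiteWong α) (hermiteWong β) = 0 := by
    intro j
    have e : pair (raiseFst j (lowerFst j (hermiteWong α))) (hermiteWong β) =
        pair (hermiteWong α) (raiseSnd j (lowerSnd j (hermiteWong β))) := by
      rw [pair_raiseFst, pair_lowerFst, neg_neg]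
    rw [raiseFst_lowerFst_hermiteWong, raiseSnd_lowerSnd_hermiteWong, map_smul, map_smul,
      smul_apply, smul_eq_mul, smul_eq_mul] at e
    linear_combination e
  have h2 : ∀ j, ((2 * α.2 j : ℂ) - 2 * β.1 j) * pair (hermiteWong α) (hermiteWong β) = 0 := by
    intro j
    have e : pair (raiseSnd j (lowerSnd j (hermiteWong α))) (hermiteWong β) =
        pair (hermiteWong α) (raiseFst j (lowerFst j (hermiteWong β))) := by
      rw [pair_raiseSnd, pair_lowerSnd, neg_neg]
    rw [raiseFst_lowerFst_hermiteWong, raiseSnd_lowerSnd_hermiteWong, map_smul, map_smul,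
      smul_apply, smul_eq_mul, smul_eq_mul] at e
    linear_combination e
  by_contra hne
  refine h (Prod.ext (funext fun j => ?_) (funext fun j => ?_))
  · have := (mul_eq_zero.1 (h1 j)).resolve_right hne
    have : (α.1 j : ℂ) = β.2 j := by linear_combination this / 2
    exact_mod_cast this
  · have := (mul_eq_zero.1 (h2 j)).resolve_right hne
    have : (α.2 j : ℂ) = β.1 j := by linear_combination this / 2
    exact_mod_cast this

theorem sqrt_ne_zero' (n : ℕ) : (√(2 * n + 2) : ℂ) ≠ 0 := by
  have : (0 : ℝ) < √(2 * n + 2) := by positivity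
  exact Complex.ofReal_ne_zero.2 this.ne'

theorem pair_hermiteWong_up_fst (α₁ α₂ : Fin d → ℕ) :
    pair (hermiteWong (up j α₁, α₂)) (hermiteWong (α₂, up j α₁)) =
      -pair (hermiteWong (α₁, α₂)) (hermiteWong (α₂, α₁)) := by
  have e := pair_raiseFst (hermiteWong (α₁, α₂)) (hermiteWong (α₂, up j α₁)) j
  rw [raiseFst_hermiteWong, lowerSnd_hermiteWong, map_smul, map_smul, smul_apply, smul_eq_mul,
    smul_eq_mul] at e
  dsimp only at e
  rw [dn_up, up_self] at e
  have h : (√(2 * ((α₁ j + 1 : ℕ) : ℝ)) : ℂ) = (√(2 * α₁ j + 2) : ℂ) := by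
    push_cast
    rw [mul_add, mul_one]
  rw [h, ← mul_neg] at e
  exact mul_left_cancel₀ (sqrt_ne_zero' _) e

/-- Moving one creation operator across the pairing costs a sign, so every unit of length
contributes -1. The second index is lowered in the same way after using symmetry of the pairing. -/
theorem pair_hermiteWong_swap (α₁ α₂ : Fin d → ℕ) :
    pair (hermiteWong (α₁, α₂)) (hermiteWong (α₂, α₁)) = (-1) ^ (len α₁ + len α₂) *
      pair (hermiteWong (0 : Idx d)) (hermiteWong (0 : Idx d)) := by
  induction α₁ using up_induction with
  | h0 =>
    induction α₂ using up_induction with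
    | h0 => simp [len]; rfl
    | h1 j α₂ ih =>
      rw [pair_comm, pair_hermiteWong_up_fst, pair_comm, ih, len_up, ← add_assoc, pow_succ]
      ring
  | h1 j α₁ ih =>
    rw [pair_hermiteWong_up_fst, ih, len_up, add_right_comm, pow_succ]
    ring

theorem pair_dual_hermiteWong_of_ne (h : α ≠ β) :
    pair (hermiteWongDual α) (hermiteWong β) = 0 := by
  rw [hermiteWongDual, map_smul, smul_apply, pair_hermiteWong_eq_zero, smul_zero]
  intro h'
  apply h
  rw [Prod.ext_iff] at h' ⊢
  exact ⟨h'.2, h'.1⟩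

theorem pair_dual_hermiteWong_self : pair (hermiteWongDual α) (hermiteWong α) =
    pair (hermiteWong (0 : Idx d)) (hermiteWong (0 : Idx d)) := by
  rw [hermiteWongDual, map_smul, smul_apply, pair_comm, pair_hermiteWong_swap, smul_eq_mul,
    ← mul_assoc, ← pow_add, ← two_mul, pow_mul]
  simp

/-! ### The ground state -/

theorem hermite₁_zero (t : ℝ) :
    hermite₁ 0 t = π ^ (-(1 / 4) : ℝ) * Real.exp (-(t ^ 2 / 2)) := by
  have : Real.exp (-(t ^ 2 / 2)) = Real.exp (t ^ 2 / 2) * Real.exp (-t ^ 2) := by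
    rw [← Real.exp_add]
    ring_nf
  simp [hermite₁, this, mul_assoc]

theorem hermiteFun_zero (x : V d) :
    hermiteFun (0 : Fin d → ℕ) x = (π ^ (-(1 / 4) : ℝ)) ^ d * Real.exp (-(‖x‖ ^ 2 / 2)) := by
  rw [hermiteFun]
  simp only [Pi.zero_apply, hermite₁_zero, Finset.prod_mul_distrib, Finset.prod_const,
    Finset.card_univ, Fintype.card_fin, ← Real.exp_sum]
  rw [EuclideanSpace.norm_sq_eq, Finset.sum_neg_distrib, Finset.sum_div]
  simp

/-- By the parallelogram law the product of the two Gaussians is e^{-|x|²} e^{-|y|²/4}, and the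
Fourier transform of the second factor is a nonzero multiple of e^{-|ξ|²}. -/
theorem exists_hermiteWong_zero (d : ℕ) : ∃ c : ℂ, c ≠ 0 ∧ ∀ X : Phase d,
    hermiteWong (0 : Idx d) X = c * (Real.exp (-(‖X.1‖ ^ 2 + ‖X.2‖ ^ 2)) : ℝ) := by
  set K : ℝ := (π ^ (-(1 / 4) : ℝ)) ^ d
  refine ⟨(((2 * π) ^ (-(d : ℝ) / 2) : ℝ) : ℂ) * ((K * K : ℝ) : ℂ) *
    (π / (1 / 4 : ℂ)) ^ (Module.finrank ℝ (V d) / 2 : ℂ), ?_, fun X => ?_⟩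
  · have h1 : ((2 * π) ^ (-(d : ℝ) / 2) : ℝ) ≠ 0 := by positivity
    have h2 : K * K ≠ 0 := by positivity
    have h3 : (π / (1 / 4 : ℂ)) ≠ 0 := by simp [Real.pi_ne_zero]
    exact mul_ne_zero (mul_ne_zero (Complex.ofReal_ne_zero.2 h1) (Complex.ofReal_ne_zero.2 h2))
      (by simp [Complex.cpow_eq_zero_iff, Real.pi_ne_zero])
  · change hermiteWongFun 0 X = _
    have e : ∀ y : V d, ((hermiteFun (0 : Fin d → ℕ) ((1 / 2 : ℝ) • y - X.1) : ℝ) : ℂ) *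
        ((hermiteFun (0 : Fin d → ℕ) ((1 / 2 : ℝ) • y + X.1) : ℝ) : ℂ) *
        Complex.exp (Complex.I * ((inner ℝ y X.2 : ℝ) : ℂ)) =
        ((K * K : ℝ) : ℂ) * ((Real.exp (-‖X.1‖ ^ 2) : ℝ) : ℂ) *
          Complex.exp (-(1 / 4 : ℂ) * ‖y‖ ^ 2 + Complex.I * ((inner ℝ X.2 y : ℝ) : ℂ)) := by
      intro y
      have hpar := parallelogram_law_with_norm ℝ ((1 / 2 : ℝ) • y) X.1
      have hy : ‖(1 / 2 : ℝ) • y‖ ^ 2 = 1 / 4 * ‖y‖ ^ 2 := by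
        rw [norm_smul, mul_pow]
        norm_num
      have hexp : -(‖(1 / 2 : ℝ) • y - X.1‖ ^ 2 / 2) + -(‖(1 / 2 : ℝ) • y + X.1‖ ^ 2 / 2) =
          -‖X.1‖ ^ 2 + -(1 / 4 * ‖y‖ ^ 2) := by
        rw [← hy]
        linear_combination (-1 / 2 : ℝ) * hpar
      have h1 : hermiteFun (0 : Fin d → ℕ) ((1 / 2 : ℝ) • y - X.1) *
          hermiteFun (0 : Fin d → ℕ) ((1 / 2 : ℝ) • y + X.1) =
          K * K * Real.exp (-‖X.1‖ ^ 2) * Real.exp (-(1 / 4 * ‖y‖ ^ 2)) := by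
        rw [hermiteFun_zero, hermiteFun_zero, mul_assoc (K * K), ← Real.exp_add, ← hexp,
          Real.exp_add]
        ring
      rw [← Complex.ofReal_mul, h1, real_inner_comm, Complex.exp_add]
      push_cast
      ring_nf
    unfold hermiteWongFun
    simp only [Prod.fst_zero, Prod.snd_zero, e]
    rw [integral_const_mul, GaussianFourier.integral_cexp_neg_mul_sq_norm_add (by norm_num)]
    have h4 : Complex.I ^ 2 * (‖X.2‖ : ℂ) ^ 2 / (4 * (1 / 4)) = ((-‖X.2‖ ^ 2 : ℝ) : ℂ) := by
      rw [Complex.I_sq]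
      push_cast
      ring
    rw [h4, ← Complex.ofReal_exp, neg_add, Real.exp_add]
    push_cast
    ring

theorem pair_hermiteWong_zero_ne_zero (d : ℕ) :
    pair (hermiteWong (0 : Idx d)) (hermiteWong (0 : Idx d)) ≠ 0 := by
  obtain ⟨c, hc, h⟩ := exists_hermiteWong_zero d
  set G : Phase d → ℝ := fun X => Real.exp (-(‖X.1‖ ^ 2 + ‖X.2‖ ^ 2)) ^ 2
  have h1 : ∀ X, hermiteWong (0 : Idx d) X * hermiteWong (0 : Idx d) X = c ^ 2 * (G X : ℂ) := by
    intro X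
    rw [h]
    simp only [G]
    push_cast
    ring
  have hint : Integrable G := by
    have h2 := (integrable_mul_schwartz (μ := (volume : Measure (Phase d)))
      (hermiteWong (0 : Idx d)) (hermiteWong (0 : Idx d)))
    simp only [h1] at h2
    have h3 := h2.const_mul (c ^ 2)⁻¹
    simp only [inv_mul_cancel_left₀ (pow_ne_zero 2 hc)] at h3
    exact h3.re
  have hpos : 0 < ∫ X, G X := by
    rw [integral_pos_iff_support_of_nonneg (fun X => by positivity) hint]
    have : Function.support G = Set.univ := by
      ext X
      simp [G]
    rw [this]
    exact Measure.measure_univ_pos.2 (NeZero.ne _)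
  rw [pair_apply]
  simp only [h1]
  rw [integral_const_mul, integral_complex_ofReal]
  exact mul_ne_zero (pow_ne_zero 2 hc) (Complex.ofReal_ne_zero.2 hpos.ne')

theorem hermiteWong_ne_zero : hermiteWong α ≠ 0 := by
  intro h
  have := pair_dual_hermiteWong_self α
  rw [h, map_zero] at this
  exact pair_hermiteWong_zero_ne_zero d this.symm

/-- The Hermite–Wong functions are uniformly bounded. -/
theorem exists_norm_hermiteWong_le (d : ℕ) :
    ∃ C : ℝ, ∀ (α : Idx d) (X : Phase d), ‖hermiteWong α X‖ ≤ C := by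
  set I : (Fin d → ℕ) → ℝ := fun α => ∫ x, ‖hermiteSchwartz α x‖ ^ 2
  -- Hermite functions are real valued, so |h_α|² = h_α² and the invariance of the bilinear integral
  -- applies.
  have hI : ∀ α, I α = I 0 := by
    intro α
    have h : ∀ α : Fin d → ℕ, (I α : ℂ) = ∫ x, hermiteSchwartz α x * hermiteSchwartz α x := by
      intro α
      simp only [I]
      rw [← integral_complex_ofReal]
      congr 1 with x
      rw [hermiteSchwartz_apply, Complex.norm_real, Real.norm_eq_abs, sq_abs]
      push_cast
      ring
    have := h α
    rw [integral_hermiteSchwartz_sq, ← h 0] at this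
    exact_mod_cast this
  refine ⟨‖(((2 * π) ^ (-(d : ℝ) / 2) : ℝ) : ℂ)‖ * ((2 : ℝ) ^ d * (I 0 + I 0)), fun α X => ?_⟩
  rw [hermiteWong_apply, norm_mul]
  gcongr
  refine (norm_wigner_le _ _ X).trans ?_
  have h1 := hI α.1
  have h2 := hI α.2
  simp only [I] at h1 h2
  rw [h1, h2]

end Biorthogonal

/-! ### The size of an index -/

/-- The quantity `1 + |α|`. -/
def size {d : ℕ} (α : Idx d) : ℝ := ((len α.1 + len α.2 : ℕ) : ℝ) + 1

section Size
variable {d : ℕ} (α : Idx d)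

theorem one_le_size : 1 ≤ size α := by
  unfold size
  linarith [(Nat.cast_nonneg (len α.1 + len α.2) : (0 : ℝ) ≤ _)]

theorem size_pos : 0 < size α := one_pos.trans_le (one_le_size α)

/-- A finite set of multi-indices lies in a box, over which the sum of products factorizes into
one-dimensional partial sums. -/
theorem summable_pi_prod {ι : Type*} [Fintype ι] [DecidableEq ι] {f : ℕ → ℝ} (hf : Summable f)
    (h0 : ∀ n, 0 ≤ f n) :
    Summable fun α : ι → ℕ => ∏ j, f (α j) := by
  have hall : ∀ u : Finset (ι → ℕ), ∑ α ∈ u, ∏ j, f (α j) ≤ ∏ _j : ι, ∑' n, f n := by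
    intro u
    have hsub : u ⊆ Fintype.piFinset fun j => u.image fun α => α j := fun α hα =>
      Fintype.mem_piFinset.2 fun j => Finset.mem_image_of_mem (fun α => α j) hα
    refine (Finset.sum_le_sum_of_subset_of_nonneg hsub fun α _ _ =>
          Finset.prod_nonneg fun j _ => h0 _).trans ?_
    rw [← Finset.prod_univ_sum (fun j => u.image fun α => α j) fun _ n => f n]
    exact Finset.prod_le_prod (fun j _ => Finset.sum_nonneg fun n _ => h0 n)
        fun j _ => hf.sum_le_tsum _ fun n _ => h0 n
  exact summable_of_sum_le (fun α => Finset.prod_nonneg fun j _ => h0 _) hall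

/-- The exponent 4d gives each of the 2d entries n of α a factor `size α ^ 2`, which is at least (n
+ 1)². -/
theorem summable_size_pow (d : ℕ) : Summable fun α : Idx d => (size α ^ (2 * d + 2 * d))⁻¹ := by
  set f : ℕ → ℝ := fun n => (((n : ℝ) + 1) ^ 2)⁻¹
  have h0 : ∀ n, 0 ≤ f n := fun n => by positivity
  have hf : Summable f := by
    have := (summable_nat_add_iff 1).2 (Real.summable_nat_pow_inv.2 one_lt_two)
    simpa [f] using this
  have hprod := (summable_pi_prod (ι := Fin d) hf h0).mul_of_nonneg
    (summable_pi_prod (ι := Fin d) hf h0)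
    (fun α => Finset.prod_nonneg fun j _ => h0 _) (fun α => Finset.prod_nonneg fun j _ => h0 _)
  refine Summable.of_nonneg_of_le (fun α => inv_nonneg.2 (pow_nonneg (size_pos α).le _))
    (fun α => ?_) hprod
  have key : ∀ β : Fin d → ℕ, (∀ j, ((β j : ℝ) + 1) ≤ size α) →
      (size α ^ (2 * d))⁻¹ ≤ ∏ j, f (β j) := by
    intro β hβ
    have : (size α ^ (2 * d))⁻¹ = ∏ _j : Fin d, (size α ^ 2)⁻¹ := by
      rw [Finset.prod_const, Finset.card_univ, Fintype.card_fin, inv_pow, pow_mul]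
    rw [this]
    refine Finset.prod_le_prod (fun j _ => by positivity) fun j _ => ?_
    exact inv_anti₀ (by positivity) (by gcongr; exact hβ j)
  have h1 : ∀ j, ((α.1 j : ℝ) + 1) ≤ size α := fun j => by
    have : α.1 j ≤ len α.1 + len α.2 := (le_len j α.1).trans (Nat.le_add_right _ _)
    exact add_le_add_left (by exact_mod_cast this) _
  have h2 : ∀ j, ((α.2 j : ℝ) + 1) ≤ size α := fun j => by
    have : α.2 j ≤ len α.1 + len α.2 := (le_len j α.2).trans (Nat.le_add_left _ _)
    exact add_le_add_left (by exact_mod_cast this) _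
  rw [pow_add, mul_inv]
  exact mul_le_mul (key _ h1) (key _ h2) (inv_nonneg.2 (pow_nonneg (size_pos α).le _))
    (Finset.prod_nonneg fun j _ => h0 _)

end Size

/-! ### Polynomial growth of the seminorms of the Hermite–Wong functions -/

/-- The seminorm `p` grows at most polynomially on the family `F`. -/
def PolyGrowth {d : ℕ} (p : Seminorm ℂ 𝓢(Phase d, ℂ)) (F : Idx d → 𝓢(Phase d, ℂ)) : Prop :=
  ∃ (C : ℝ) (N : ℕ), 0 ≤ C ∧ ∀ α, p (F α) ≤ C * size α ^ N

section Growth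
variable {d : ℕ} {p : Seminorm ℂ 𝓢(Phase d, ℂ)} {F G : Idx d → 𝓢(Phase d, ℂ)}

theorem PolyGrowth.add (hF : PolyGrowth p F) (hG : PolyGrowth p G) :
    PolyGrowth p (fun α => F α + G α) := by
  obtain ⟨C, N, hC, h⟩ := hF
  obtain ⟨C', N', hC', h'⟩ := hG
  refine ⟨C + C', max N N', by positivity, fun α => (map_add_le_add p _ _).trans ?_⟩
  rw [add_mul]
  refine add_le_add ((h α).trans ?_) ((h' α).trans ?_) <;> gcongr <;>
    simp [one_le_size]

theorem PolyGrowth.smul (hF : PolyGrowth p F) (c : ℂ) : PolyGrowth p (fun α => c • F α) := by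
  obtain ⟨C, N, hC, h⟩ := hF
  refine ⟨‖c‖ * C, N, by positivity, fun α => ?_⟩
  rw [map_smul_eq_mul, mul_assoc]
  exact mul_le_mul_of_nonneg_left (h α) (norm_nonneg c)

theorem PolyGrowth.sub (hF : PolyGrowth p F) (hG : PolyGrowth p G) :
    PolyGrowth p (fun α => F α - G α) := by
  have := hF.add (hG.smul (-1))
  simpa only [neg_one_smul, ← sub_eq_add_neg] using this

/-- This is the situation of the ladder operators: a neighbouring index and a factor of at most
linear size raise the polynomial degree by one. -/
theorem PolyGrowth.of_shift (h : PolyGrowth p hermiteWong)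
    (hF : ∀ α, ∃ (z : ℂ) (β : Idx d), F α = z • hermiteWong β ∧ ‖z‖ ≤ 2 * size α ∧
      size β ≤ 2 * size α) : PolyGrowth p F := by
  obtain ⟨C, N, hC, h⟩ := h
  refine ⟨C * 2 ^ (N + 1), N + 1, by positivity, fun α => ?_⟩
  obtain ⟨z, β, hz, hz1, hz2⟩ := hF α
  have hβ := (size_pos β).le
  have hα := (size_pos α).le
  rw [hz, map_smul_eq_mul]
  calc ‖z‖ * p (hermiteWong β) ≤ (2 * size α) * (C * (2 * size α) ^ N) := by
        refine mul_le_mul hz1 ((h β).trans ?_) (apply_nonneg _ _) (by positivity)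
        gcongr
    _ = _ := by ring

theorem norm_sqrt_le {x y : ℝ} (h : x ≤ y) (hy : 1 ≤ y) : ‖(√x : ℂ)‖ ≤ y := by
  rw [Complex.norm_real, Real.norm_of_nonneg (Real.sqrt_nonneg _), Real.sqrt_le_left (by linarith)]
  nlinarith

theorem PolyGrowth.ladder (h : PolyGrowth p hermiteWong) (j : Fin d) :
    PolyGrowth p (fun α => lowerFst j (hermiteWong α)) ∧
    PolyGrowth p (fun α => raiseFst j (hermiteWong α)) ∧
    PolyGrowth p (fun α => lowerSnd j (hermiteWong α)) ∧
    PolyGrowth p (fun α => raiseSnd j (hermiteWong α)) := by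
  have h1 : ∀ α : Idx d, (α.1 j : ℝ) + 1 ≤ size α := fun α => by
    have : α.1 j ≤ len α.1 + len α.2 := (le_len j α.1).trans (Nat.le_add_right _ _)
    exact add_le_add_left (by exact_mod_cast this) _
  have h2 : ∀ α : Idx d, (α.2 j : ℝ) + 1 ≤ size α := fun α => by
    have : α.2 j ≤ len α.1 + len α.2 := (le_len j α.2).trans (Nat.le_add_left _ _)
    exact add_le_add_left (by exact_mod_cast this) _
  have hs : ∀ (α β : Idx d), len β.1 + len β.2 ≤ len α.1 + len α.2 + 1 →
      size β ≤ 2 * size α := by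
    intro α β hle
    have : ((len β.1 + len β.2 : ℕ) : ℝ) ≤ ((len α.1 + len α.2 + 1 : ℕ) : ℝ) := by
      exact_mod_cast hle
    have h1 := one_le_size α
    unfold size at *
    push_cast at *
    linarith
  refine ⟨h.of_shift fun α => ⟨_, _, lowerFst_hermiteWong j α, ?_, hs _ _ ?_⟩,
    h.of_shift fun α => ⟨_, _, raiseFst_hermiteWong j α, ?_, hs _ _ ?_⟩,
    h.of_shift fun α => ⟨_, _, lowerSnd_hermiteWong j α, ?_, hs _ _ ?_⟩,
    h.of_shift fun α => ⟨_, _, raiseSnd_hermiteWong j α, ?_, hs _ _ ?_⟩⟩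
  · exact norm_sqrt_le (by linarith [h1 α]) (by linarith [one_le_size α])
  · have := len_dn_le j α.1
    dsimp only
    omega
  · exact norm_sqrt_le (by linarith [h1 α]) (by linarith [one_le_size α])
  · dsimp only
    rw [len_up]
    omega
  · exact norm_sqrt_le (by linarith [h2 α]) (by linarith [one_le_size α])
  · have := len_dn_le j α.2
    dsimp only
    omega
  · exact norm_sqrt_le (by linarith [h2 α]) (by linarith [one_le_size α])
  · dsimp only
    rw [len_up]
    omega

/-- The standard basis of the phase space. -/
def phaseBasis (d : ℕ) : Fin d ⊕ Fin d → Phase d :=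
  Sum.elim (fun j => (EuclideanSpace.single j 1, 0)) fun j => (0, EuclideanSpace.single j 1)

/-- The coordinates on the phase space. -/
def phaseCoord (d : ℕ) : Fin d ⊕ Fin d → Phase d →L[ℝ] ℝ :=
  Sum.elim (fun j => (EuclideanSpace.proj (𝕜 := ℝ) j).comp (ContinuousLinearMap.fst ℝ (V d) (V d)))
    fun j => (EuclideanSpace.proj (𝕜 := ℝ) j).comp (ContinuousLinearMap.snd ℝ (V d) (V d))

theorem sum_phaseCoord (X : Phase d) : X = ∑ i, phaseCoord d i X • phaseBasis d i := by
  have h : ∀ x : V d, x = ∑ j, x j • EuclideanSpace.single j (1 : ℝ) := fun x => by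
    ext i
    simp [Finset.sum_apply, Pi.single_apply]
  rw [Fintype.sum_sum_type]
  simp only [phaseCoord, phaseBasis, Sum.elim_inl, Sum.elim_inr, ContinuousLinearMap.comp_apply,
    ContinuousLinearMap.coe_fst', ContinuousLinearMap.coe_snd', PiLp.proj_apply,
    Prod.smul_mk, smul_zero]
  refine Prod.ext ?_ ?_
  · simpa [Prod.fst_sum] using h X.1
  · simpa [Prod.snd_sum] using h X.2

/-- The seminorm without weight or derivative is bounded uniformly in α. A power of ‖X‖ or a
derivative is a combination of ladder operators, each of which preserves polynomial growth; powers
are added first, then derivatives. -/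
theorem polyGrowth_seminorm (k n : ℕ) :
    PolyGrowth (SchwartzMap.seminorm ℂ k n) (hermiteWong (d := d)) := by
  -- The induction step common to both cases: if `q` is controlled by `p` after finitely many
  -- operators `D i`, growth passes from `p` to `q`.
  have hsum : ∀ (q p : Seminorm ℂ 𝓢(Phase d, ℂ)) (D : Fin d ⊕ Fin d → 𝓢(Phase d, ℂ) → 𝓢(Phase d, ℂ))
      (c : Fin d ⊕ Fin d → ℝ), (∀ i, 0 ≤ c i) → (∀ f, q f ≤ ∑ i, c i * p (D i f)) →
      (∀ i, PolyGrowth p fun α => D i (hermiteWong α)) → PolyGrowth q (hermiteWong (d := d)) := by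
    intro q p D c hc hq hD
    choose C N hC h using hD
    refine ⟨∑ i, c i * C i, ∑ i, N i, Finset.sum_nonneg fun i _ => mul_nonneg (hc i) (hC i),
      fun α => (hq _).trans ?_⟩
    rw [Finset.sum_mul]
    refine Finset.sum_le_sum fun i _ => ?_
    rw [mul_assoc]
    refine mul_le_mul_of_nonneg_left ((h i α).trans ?_) (hc i)
    refine mul_le_mul_of_nonneg_left (pow_le_pow_right₀ (one_le_size α) ?_) (hC i)
    exact Finset.single_le_sum (fun _ _ => Nat.zero_le _) (Finset.mem_univ i)
  induction n with
  | zero =>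
    induction k with
    | zero =>
      obtain ⟨C, hC⟩ := exists_norm_hermiteWong_le d
      have hC0 : 0 ≤ C := (norm_nonneg _).trans (hC 0 0)
      refine ⟨C, 0, hC0, fun α => ?_⟩
      rw [pow_zero, mul_one]
      exact SchwartzMap.seminorm_le_bound ℂ 0 0 _ hC0 fun X => by
        simpa using hC α X
    | succ k ih =>
      refine hsum _ _ _ _ (fun i => norm_nonneg _)
        (fun f => seminorm_succ_pow_le (phaseBasis d) (phaseCoord d) sum_phaseCoord f k) ?_
      rintro (j | j) <;> obtain ⟨h1, h2, h3, h4⟩ := ih.ladder j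
      · change PolyGrowth _ fun α => mulx j (hermiteWong α)
        simp only [mulx_eq_ladder]
        exact (((h3.add h4).sub h1).sub h2).smul _
      · change PolyGrowth _ fun α => mulξ j (hermiteWong α)
        simp only [mulξ_eq_ladder]
        exact (((h1.sub h2).add h3).sub h4).smul _
  | succ n ih =>
    refine hsum _ _ _ _ (fun i => by positivity)
      (fun f => seminorm_succ_derivative_le (phaseBasis d) (phaseCoord d) sum_phaseCoord f k n) ?_
    rintro (j | j) <;> obtain ⟨h1, h2, h3, h4⟩ := ih.ladder j
    · change PolyGrowth _ fun α => dx j (hermiteWong α)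
      simp only [dx_eq_ladder]
      exact (((h3.sub h4).sub h1).add h2).smul _
    · change PolyGrowth _ fun α => dξ j (hermiteWong α)
      simp only [dξ_eq_ladder]
      exact (((h3.add h4).add h1).add h2).smul _

end Growth

/-! ### Completeness -/

section Completeness
variable {d : ℕ}

theorem mul_mem_span_hermiteWong (j : Fin d) (f : 𝓢(Phase d, ℂ))
    (hf : f ∈ Submodule.span ℂ (Set.range (hermiteWong (d := d)))) :
    mulx j f ∈ Submodule.span ℂ (Set.range (hermiteWong (d := d))) ∧
      mulξ j f ∈ Submodule.span ℂ (Set.range (hermiteWong (d := d))) := by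
  induction hf using Submodule.span_induction with
  | mem f hf =>
    obtain ⟨α, rfl⟩ := hf
    rw [mulx_eq_ladder, mulξ_eq_ladder, lowerFst_hermiteWong, raiseFst_hermiteWong,
      lowerSnd_hermiteWong, raiseSnd_hermiteWong]
    have h : ∀ (z : ℂ) (β : Idx d),
        z • hermiteWong β ∈ Submodule.span ℂ (Set.range (hermiteWong (d := d))) := fun z β =>
      Submodule.smul_mem _ _ (Submodule.subset_span ⟨β, rfl⟩)
    exact ⟨Submodule.smul_mem _ _ (Submodule.sub_mem _ (Submodule.sub_mem _
        (Submodule.add_mem _ (h _ _) (h _ _)) (h _ _)) (h _ _)),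
      Submodule.smul_mem _ _ (Submodule.sub_mem _ (Submodule.add_mem _
        (Submodule.sub_mem _ (h _ _) (h _ _)) (h _ _)) (h _ _))⟩
  | zero => simp
  | add f g _ _ hf hg =>
    rw [map_add, map_add]
    exact ⟨Submodule.add_mem _ hf.1 hg.1, Submodule.add_mem _ hf.2 hg.2⟩
  | smul z f _ hf =>
    rw [map_smul, map_smul]
    exact ⟨Submodule.smul_mem _ _ hf.1, Submodule.smul_mem _ _ hf.2⟩

/-- Powers of a single linear form suffice, because these are the Taylor terms of e^{iL}. -/
theorem exists_pow_mul_mem_span (L : Phase d →L[ℝ] ℝ) (n : ℕ) :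
    ∃ f ∈ Submodule.span ℂ (Set.range (hermiteWong (d := d))),
      ∀ X, f X = (L X : ℂ) ^ n * hermiteWong (0 : Idx d) X := by
  induction n with
  | zero => exact ⟨hermiteWong 0, Submodule.subset_span ⟨0, rfl⟩, fun X => by simp⟩
  | succ n ih =>
    obtain ⟨f, hf, hfX⟩ := ih
    refine ⟨∑ j, ((L (phaseBasis d (Sum.inl j)) : ℂ) • mulx j f +
      (L (phaseBasis d (Sum.inr j)) : ℂ) • mulξ j f), ?_, fun X => ?_⟩
    · exact Submodule.sum_mem _ fun j _ => Submodule.add_mem _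
        (Submodule.smul_mem _ _ (mul_mem_span_hermiteWong j f hf).1)
        (Submodule.smul_mem _ _ (mul_mem_span_hermiteWong j f hf).2)
    · have hL : L X = ∑ j, (X.1 j * L (phaseBasis d (Sum.inl j)) +
          X.2 j * L (phaseBasis d (Sum.inr j))) := by
        conv_lhs => rw [sum_phaseCoord X, map_sum, Fintype.sum_sum_type, ← Finset.sum_add_distrib]
        simp only [map_smul, smul_eq_mul]
        rfl
      simp only [sum_apply, add_apply, smul_apply, mulx_apply, mulξ_apply, smul_eq_mul, hfX]
      have hL' : (L X : ℂ) = ∑ j, ((X.1 j : ℂ) * (L (phaseBasis d (Sum.inl j)) : ℂ) +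
          (X.2 j : ℂ) * (L (phaseBasis d (Sum.inr j)) : ℂ)) := by
        rw [hL]
        push_cast
        rfl
      rw [pow_succ, mul_right_comm]
      nth_rewrite 4 [hL']
      rw [Finset.mul_sum]
      refine Finset.sum_congr rfl fun j _ => ?_
      ring

/-- All moments ∫ L^n ϱ_0 g vanish. Expanding e^{iL} and integrating termwise, which Gaussian decay
permits, the Fourier transform of ϱ_0 g vanishes, so ϱ_0 g = 0; and ϱ_0 has no zeros. -/
theorem eq_zero_of_pair_hermiteWong (g : 𝓢(Phase d, ℂ))
    (hg : ∀ α : Idx d, pair (hermiteWong α) g = 0) : g = 0 := by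
  obtain ⟨c, hc, hρ⟩ := exists_hermiteWong_zero d
  set ρ := hermiteWong (0 : Idx d)
  have hspan : ∀ f ∈ Submodule.span ℂ (Set.range (hermiteWong (d := d))), pair f g = 0 := by
    intro f hf
    induction hf using Submodule.span_induction with
    | mem f hf =>
      obtain ⟨α, rfl⟩ := hf
      exact hg α
    | zero => simp
    | add f f' _ _ h h' => rw [map_add, add_apply, h, h', add_zero]
    | smul z f _ h => rw [map_smul, smul_apply, h, smul_zero]
  have hzero : pairing (ContinuousLinearMap.mul ℂ ℂ) ρ g = 0 := by
    refine eq_zero_of_integral_exp_eq_zero volume _ fun L => ?_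
    have hmom : ∀ n : ℕ, ∫ X, (Complex.I * (L X : ℂ)) ^ n / (n ! : ℂ) * (ρ X * g X) = 0 := by
      intro n
      obtain ⟨f, hf, hfX⟩ := exists_pow_mul_mem_span L n
      have h1 := hspan f hf
      rw [pair_apply] at h1
      have h2 : ∀ X, (Complex.I * (L X : ℂ)) ^ n / (n ! : ℂ) * (ρ X * g X) =
          Complex.I ^ n / (n ! : ℂ) * (f X * g X) := by
        intro X
        rw [hfX]
        ring
      simp only [h2]
      rw [integral_const_mul, h1, mul_zero]
    -- Completing the square gives ‖L‖‖X‖ - ‖X‖² ≤ ‖L‖²/4, and the maximum norm satisfies ‖X‖² ≤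
    -- ‖X.1‖² + ‖X.2‖².
    have hbound : ∀ X, Real.exp ‖L X‖ * ‖ρ X‖ ≤ ‖c‖ * Real.exp (‖L‖ ^ 2 / 4) := by
      intro X
      have h1 : ‖L X‖ ≤ ‖L‖ * ‖X‖ := L.le_opNorm X
      have h2 : ‖X‖ ^ 2 ≤ ‖X.1‖ ^ 2 + ‖X.2‖ ^ 2 := by
        rw [Prod.norm_def]
        rcases max_choice ‖X.1‖ ‖X.2‖ with h | h <;> rw [h] <;> nlinarith [norm_nonneg X.1]
      rw [hρ, norm_mul, Complex.norm_real, Real.norm_of_nonneg (Real.exp_nonneg _), mul_left_comm,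
        ← Real.exp_add]
      gcongr
      nlinarith [sq_nonneg (‖L‖ / 2 - ‖X‖)]
    have hsumm : ∀ X, HasSum (fun n : ℕ => ‖L X‖ ^ n / (n ! : ℝ) * ‖ρ X * g X‖)
        (Real.exp ‖L X‖ * ‖ρ X * g X‖) := fun X => by
      rw [Real.exp_eq_exp_ℝ]
      exact (NormedSpace.expSeries_div_hasSum_exp (‖L X‖)).mul_right _
    have hcont : ∀ n : ℕ, Continuous fun X : Phase d =>
        (Complex.I * (L X : ℂ)) ^ n / (n ! : ℂ) * (ρ X * g X) := fun n => by
      have h1 := ρ.continuous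
      have h2 := g.continuous
      fun_prop
    have key := hasSum_integral_of_dominated_convergence (μ := (volume : Measure (Phase d)))
      (F := fun (n : ℕ) X => (Complex.I * (L X : ℂ)) ^ n / (n ! : ℂ) * (ρ X * g X))
      (f := fun X => Complex.exp (Complex.I * (L X : ℂ)) * (ρ X * g X))
      (fun n X => ‖L X‖ ^ n / (n ! : ℝ) * ‖ρ X * g X‖)
      (fun n => (hcont n).aestronglyMeasurable)
      (fun n => .of_forall fun X => by
        simp)
      (.of_forall fun X => (hsumm X).summable) ?_
      (.of_forall fun X => by
        rw [Complex.exp_eq_exp_ℂ]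
        exact (NormedSpace.expSeries_div_hasSum_exp (Complex.I * (L X : ℂ))).mul_right _)
    · simp only [hmom] at key
      exact (hasSum_zero.unique key).symm
    · simp only [(hsumm _).tsum_eq]
      have hcont' : Continuous fun X : Phase d => Real.exp ‖L X‖ * ‖ρ X‖ := by
        have h1 := ρ.continuous
        fun_prop
      have := (g.integrable (μ := (volume : Measure (Phase d)))).norm.bdd_mul
        (c := ‖c‖ * Real.exp (‖L‖ ^ 2 / 4)) hcont'.aestronglyMeasurable
        (.of_forall fun X => by
          rw [norm_mul, Real.norm_of_nonneg (Real.exp_nonneg _), norm_norm]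
          exact hbound X)
      refine this.congr (.of_forall fun X => ?_)
      dsimp only
      rw [norm_mul, mul_assoc]
  ext X
  have h1 : ρ X * g X = 0 := by
    have := congrArg (fun f : 𝓢(Phase d, ℂ) => f X) hzero
    exact this
  refine (mul_eq_zero.1 h1).resolve_left ?_
  rw [hρ]
  exact mul_ne_zero hc (Complex.ofReal_ne_zero.2 (Real.exp_pos _).ne')

end Completeness

/-! ### Hermite–Wong coefficients -/

/-- The Hermite–Wong coefficient of index `α` of a Schwartz function. -/
def hwCoeff {d : ℕ} (α : Idx d) : 𝓢(Phase d, ℂ) →L[ℂ] ℂ :=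
  (pair (hermiteWong (0 : Idx d)) (hermiteWong (0 : Idx d)))⁻¹ • pair (hermiteWongDual α)

section Coeff
variable {d : ℕ}

theorem hwCoeff_apply (α : Idx d) (a : 𝓢(Phase d, ℂ)) : hwCoeff α a =
    (pair (hermiteWong (0 : Idx d)) (hermiteWong (0 : Idx d)))⁻¹ * pair (hermiteWongDual α) a :=
  rfl

theorem hwCoeff_hermiteWong_self (α : Idx d) : hwCoeff α (hermiteWong α) = 1 := by
  rw [hwCoeff_apply, pair_dual_hermiteWong_self, inv_mul_cancel₀ (pair_hermiteWong_zero_ne_zero d)]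

theorem hwCoeff_hermiteWong_of_ne {α β : Idx d} (h : α ≠ β) : hwCoeff α (hermiteWong β) = 0 := by
  rw [hwCoeff_apply, pair_dual_hermiteWong_of_ne α β h, mul_zero]

theorem hwCoeff_of_isExpansion {c : Idx d → ℂ} {a : 𝓢(Phase d, ℂ)} (h : IsExpansion c a)
    (α : Idx d) : hwCoeff α a = c α := by
  have h1 := h.mapL (hwCoeff α)
  have h2 := hasSum_single (f := fun β => hwCoeff α (c β • hermiteWong β)) α fun β hβ => by
    rw [map_smul, hwCoeff_hermiteWong_of_ne hβ.symm, smul_zero]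
  rw [h1.unique h2, map_smul, hwCoeff_hermiteWong_self, smul_eq_mul, mul_one]

theorem eq_of_hwCoeff_eq {a b : 𝓢(Phase d, ℂ)} (h : ∀ α, hwCoeff α a = hwCoeff α b) : a = b := by
  rw [← sub_eq_zero]
  refine eq_zero_of_pair_hermiteWong _ fun α => ?_
  have h1 : pair (hermiteWongDual (α.2, α.1)) (a - b) = 0 := by
    have := sub_eq_zero.2 (h (α.2, α.1))
    rw [← map_sub, hwCoeff_apply] at this
    exact (mul_eq_zero.1 this).resolve_left (inv_ne_zero (pair_hermiteWong_zero_ne_zero d))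
  rw [hermiteWongDual, map_smul, smul_apply] at h1
  exact (smul_eq_zero.1 h1).resolve_left (pow_ne_zero _ (by norm_num))

/-- The transpose H̄_σ acts on the dual function, whose indices are swapped, so its eigenvalue is
again governed by α₁. -/
theorem hwCoeff_Hσ (α : Idx d) (a : 𝓢(Phase d, ℂ)) :
    hwCoeff α (Hσ d a) = (2 * (len α.1 : ℂ) + (d : ℂ)) * hwCoeff α a := by
  rw [hwCoeff_apply, pair_comm (hermiteWongDual α), pair_Hσ, hermiteWongDual, map_smul,
    Hσbar_hermiteWong, smul_comm, map_smul, pair_comm a, hwCoeff_apply, hermiteWongDual,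
    smul_eq_mul]
  ring

theorem hwCoeff_Hσbar (α : Idx d) (a : 𝓢(Phase d, ℂ)) :
    hwCoeff α (Hσbar d a) = (2 * (len α.2 : ℂ) + (d : ℂ)) * hwCoeff α a := by
  rw [hwCoeff_apply, ← pair_Hσ, hermiteWongDual, map_smul, Hσ_hermiteWong,
    smul_comm, map_smul, smul_apply, hwCoeff_apply, hermiteWongDual, smul_eq_mul]
  ring

/-- Since d ≥ 1, the eigenvalue (2|α₁|+d)(2|α₂|+d) of T_σ is at least 1 + |α|, so each power of
`size` is paid for by one application of T_σ. Neither H_σ nor H̄_σ alone controls both indices. -/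
theorem exists_seminorm_hwCoeff_le (hd : 0 < d) (N : ℕ) :
    ∃ q : Seminorm ℂ 𝓢(Phase d, ℂ), Continuous q ∧
      ∀ a (α : Idx d), ‖hwCoeff α a‖ * size α ^ N ≤ q a := by
  induction N with
  | zero =>
    obtain ⟨C, hC⟩ := exists_norm_hermiteWong_le d
    set κ := pair (hermiteWong (0 : Idx d)) (hermiteWong (0 : Idx d))
    -- The starting seminorm is a multiple of the L¹ norm, from the uniform bound `C` for the dual
    -- functions and the normalization κ⁻¹.
    let A := (κ⁻¹ * (C : ℂ)) • toLpCLM ℂ (E := Phase d) ℂ 1 volume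
    refine ⟨(normSeminorm ℂ (Lp ℂ 1 (volume : Measure (Phase d)))).comp A.toLinearMap,
      continuous_norm.comp A.continuous, fun a α => ?_⟩
    have hdual : ∀ X, ‖hermiteWongDual α X‖ ≤ C := fun X => by
      rw [hermiteWongDual, smul_apply, norm_smul, norm_pow, norm_neg, norm_one, one_pow, one_mul]
      exact hC _ X
    have h1 := norm_pair_le (hermiteWongDual α) a hdual
    have hC0 : 0 ≤ C := (norm_nonneg _).trans (hC 0 0)
    have h2 : ((normSeminorm ℂ (Lp ℂ 1 (volume : Measure (Phase d)))).comp A.toLinearMap) a =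
        ‖κ⁻¹‖ * (C * ∫ X, ‖a X‖) := by
      change ‖(κ⁻¹ * (C : ℂ)) • a.toLp 1 volume‖ = _
      rw [norm_smul, norm_mul, Complex.norm_real, Real.norm_of_nonneg hC0,
        SchwartzMap.norm_toLp_one, mul_assoc]
    rw [h2, pow_zero, mul_one, hwCoeff_apply, norm_mul]
    gcongr
  | succ N ih =>
    obtain ⟨q, hq, h⟩ := ih
    refine ⟨q.comp (Tσ d).toLinearMap, hq.comp (Tσ d).continuous, fun a α => ?_⟩
    refine le_trans ?_ (h (Tσ d a) α)
    have h1 : hwCoeff α (Tσ d a) = (((2 * (len α.1 : ℝ) + d) * (2 * (len α.2 : ℝ) + d) : ℝ) : ℂ) *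
        hwCoeff α a := by
      rw [Tσ, ContinuousLinearMap.comp_apply, hwCoeff_Hσ, hwCoeff_Hσbar]
      push_cast
      ring
    have hd1 : (1 : ℝ) ≤ d := by exact_mod_cast hd
    have h2 : size α ≤ (2 * (len α.1 : ℝ) + d) * (2 * (len α.2 : ℝ) + d) := by
      have e1 : (0 : ℝ) ≤ len α.1 := Nat.cast_nonneg _
      have e2 : (0 : ℝ) ≤ len α.2 := Nat.cast_nonneg _
      unfold size
      push_cast
      nlinarith [mul_nonneg e1 e2]
    have h0 := (size_pos α).le
    rw [h1, norm_mul, Complex.norm_real, Real.norm_of_nonneg (h0.trans h2), pow_succ]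
    calc ‖hwCoeff α a‖ * (size α ^ N * size α) = size α * ‖hwCoeff α a‖ * size α ^ N := by ring
      _ ≤ _ := by gcongr

/-- Expansions with rapidly decreasing coefficients converge in the Schwartz space. -/
theorem exists_isExpansion {c : Idx d → ℂ}
    (hc : ∀ N : ℕ, ∃ C : ℝ, ∀ α, ‖c α‖ * size α ^ N ≤ C) :
    ∃ a, IsExpansion c a := by
  refine summable_of_summable_seminorm fun k n => ?_
  obtain ⟨K, N, hK, h⟩ := polyGrowth_seminorm (d := d) k n
  obtain ⟨C, hC⟩ := hc (N + (2 * d + 2 * d))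
  refine Summable.of_nonneg_of_le (fun α => apply_nonneg _ _) (fun α => ?_)
    ((summable_size_pow d).mul_left (K * C))
  have hs := pow_pos (size_pos α) (2 * d + 2 * d)
  rw [map_smul_eq_mul, ← div_eq_mul_inv, le_div_iff₀ hs]
  calc ‖c α‖ * SchwartzMap.seminorm ℂ k n (hermiteWong α) * size α ^ (2 * d + 2 * d)
      ≤ ‖c α‖ * (K * size α ^ N) * size α ^ (2 * d + 2 * d) := by
        gcongr
        exact h α
    _ = K * (‖c α‖ * size α ^ (N + (2 * d + 2 * d))) := by rw [pow_add]; ring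
    _ ≤ _ := by gcongr; exact hC α

theorem hwCoeff_rapidDecay (hd : 0 < d) (a : 𝓢(Phase d, ℂ)) (N : ℕ) :
    ∃ C : ℝ, ∀ α : Idx d, ‖hwCoeff α a‖ * size α ^ N ≤ C := by
  obtain ⟨q, -, hq⟩ := exists_seminorm_hwCoeff_le hd N
  exact ⟨q a, hq a⟩

/-- Every Schwartz function is the sum of its Hermite–Wong expansion. -/
theorem isExpansion_hwCoeff (hd : 0 < d) (a : 𝓢(Phase d, ℂ)) :
    IsExpansion (fun α => hwCoeff α a) a := by
  -- The series converges to some `b` with the same coefficients as `a`; completeness identifies the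
  -- two.
  obtain ⟨b, hb⟩ := exists_isExpansion (hwCoeff_rapidDecay hd a)
  have h : b = a := eq_of_hwCoeff_eq (hwCoeff_of_isExpansion hb)
  exact h ▸ hb

/-- Bounded multipliers act continuously on the Schwartz space. -/
theorem exists_multiplier (hd : 0 < d) {m : Idx d → ℂ} (hm : ∀ α, ‖m α‖ ≤ 1) :
    ∃ M : 𝓢(Phase d, ℂ) →L[ℂ] 𝓢(Phase d, ℂ), ∀ a α, hwCoeff α (M a) = m α * hwCoeff α a := by
  have hex : ∀ a : 𝓢(Phase d, ℂ), ∃ b, IsExpansion (fun α => m α * hwCoeff α a) b := by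
    intro a
    refine exists_isExpansion fun N => ?_
    obtain ⟨C, hC⟩ := hwCoeff_rapidDecay hd a N
    refine ⟨C, fun α => le_trans ?_ (hC α)⟩
    rw [norm_mul]
    have := (size_pos α).le
    gcongr
    exact mul_le_of_le_one_left (norm_nonneg _) (hm α)
  choose M hM using hex
  have hMc : ∀ a α, hwCoeff α (M a) = m α * hwCoeff α a := fun a α =>
    hwCoeff_of_isExpansion (hM a) α
  let M' : 𝓢(Phase d, ℂ) →ₗ[ℂ] 𝓢(Phase d, ℂ) :=
    { toFun := M
      map_add' := fun a b => eq_of_hwCoeff_eq fun α => by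
        rw [map_add, hMc, hMc, hMc, map_add, mul_add]
      map_smul' := fun z a => eq_of_hwCoeff_eq fun α => by
        rw [RingHom.id_apply, map_smul, hMc, hMc, map_smul, smul_eq_mul, smul_eq_mul,
          mul_left_comm] }
  refine ⟨⟨M', ?_⟩, hMc⟩
  refine ((schwartz_withSeminorms ℂ (Phase d) ℂ).continuous_iff_continuous_comp M').2 ?_
  rintro ⟨k, n⟩
  obtain ⟨K, N, hK, h⟩ := polyGrowth_seminorm (d := d) k n
  obtain ⟨q, hq, hqc⟩ := exists_seminorm_hwCoeff_le hd (N + (2 * d + 2 * d))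
  set S := ∑' α : Idx d, (size α ^ (2 * d + 2 * d))⁻¹
  have hS : 0 ≤ S := tsum_nonneg fun α => inv_nonneg.2 (pow_nonneg (size_pos α).le _)
  -- Here `K` bounds the growth of the seminorm on ϱ_α and `S` sums the remaining powers of `size`.
  -- The bound is proved for finite partial sums and passes to the limit.
  let z : NNReal := ⟨K * S, mul_nonneg hK hS⟩
  refine Seminorm.continuous_of_le (q := z • q) (hq.const_smul z) fun a => ?_
  change SchwartzMap.seminorm ℂ k n (M a) ≤ K * S * q a
  have hp : Continuous (SchwartzMap.seminorm ℂ k n : 𝓢(Phase d, ℂ) → ℝ) :=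
    (schwartz_withSeminorms ℂ (Phase d) ℂ).continuous_seminorm (k, n)
  have hMa := hM a
  rw [IsExpansion, HasSum, SummationFilter.unconditional_filter] at hMa
  refine le_of_tendsto ((hp.tendsto _).comp hMa) (.of_forall fun s => ?_)
  refine (Finset.le_sum_of_subadditive _ (map_zero _).le (fun x y => map_add_le_add _ x y) _ _).trans ?_
  have hterm : ∀ α : Idx d, SchwartzMap.seminorm ℂ k n ((m α * hwCoeff α a) • hermiteWong α) ≤
      K * q a * (size α ^ (2 * d + 2 * d))⁻¹ := by
    intro α
    have hs := pow_pos (size_pos α) (2 * d + 2 * d)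
    have hs' := (size_pos α).le
    rw [map_smul_eq_mul, ← div_eq_mul_inv, le_div_iff₀ hs, norm_mul]
    calc ‖m α‖ * ‖hwCoeff α a‖ * SchwartzMap.seminorm ℂ k n (hermiteWong α) *
          size α ^ (2 * d + 2 * d)
        ≤ 1 * ‖hwCoeff α a‖ * (K * size α ^ N) * size α ^ (2 * d + 2 * d) := by
          gcongr
          · exact hm α
          · exact h α
      _ = K * (‖hwCoeff α a‖ * size α ^ (N + (2 * d + 2 * d))) := by rw [pow_add]; ring
      _ ≤ _ := by gcongr; exact hqc a α
  calc _ ≤ ∑ α ∈ s, K * q a * (size α ^ (2 * d + 2 * d))⁻¹ :=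
        Finset.sum_le_sum fun α _ => hterm α
    _ = K * q a * ∑ α ∈ s, (size α ^ (2 * d + 2 * d))⁻¹ := by rw [Finset.mul_sum]
    _ ≤ K * q a * S := by
        have hq0 : 0 ≤ q a := apply_nonneg _ _
        gcongr
        exact (summable_size_pow d).sum_le_tsum _ fun α _ =>
          inv_nonneg.2 (pow_nonneg (size_pos α).le _)
    _ = _ := by ring

/-- A diagonal operator with eigenvalues bounded away from zero is a homeomorphism of the
Schwartz space. -/
theorem exists_equiv_of_diagonal (hd : 0 < d) {T : 𝓢(Phase d, ℂ) →L[ℂ] 𝓢(Phase d, ℂ)}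
    {μ : Idx d → ℂ} (hμ : ∀ α, 1 ≤ ‖μ α‖) (hT : ∀ a α, hwCoeff α (T a) = μ α * hwCoeff α a) :
    ∃ e : 𝓢(Phase d, ℂ) ≃L[ℂ] 𝓢(Phase d, ℂ), ∀ a, e a = T a := by
  have h0 : ∀ α, μ α ≠ 0 := fun α => norm_pos_iff.1 (one_pos.trans_le (hμ α))
  obtain ⟨M, hM⟩ := exists_multiplier hd (m := fun α => (μ α)⁻¹) fun α => by
    rw [norm_inv]
    exact inv_le_one_of_one_le₀ (hμ α)
  exact ⟨ContinuousLinearEquiv.equivOfInverse T M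
    (fun a => eq_of_hwCoeff_eq fun α => by rw [hM, hT, inv_mul_cancel_left₀ (h0 α)])
    (fun a => eq_of_hwCoeff_eq fun α => by rw [hT, hM, mul_inv_cancel_left₀ (h0 α)]), fun a => rfl⟩

/-! ### Tempered distributions -/

theorem toTemperedDistribution_apply (a g : 𝓢(Phase d, ℂ)) :
    toTemperedDistributionCLM (Phase d) ℂ volume a g = pair g a :=
  toTemperedDistributionCLM_apply_apply volume a g

/-- Applying u to the expansion of a test function b gives u(b) as the sum of the coefficients of b
times u(ϱ_α). The partial sums are pairings of b with finite combinations of the dual functions. -/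
theorem denseRange_toTemperedDistribution (hd : 0 < d) :
    DenseRange (toTemperedDistributionCLM (Phase d) ℂ volume) := by
  intro u
  refine mem_closure_of_tendsto (b := Filter.atTop) (f := fun s : Finset (Idx d) =>
    toTemperedDistributionCLM (Phase d) ℂ volume (∑ α ∈ s,
      ((pair (hermiteWong (0 : Idx d)) (hermiteWong (0 : Idx d)))⁻¹ * u (hermiteWong α)) •
        hermiteWongDual α)) ?_ (.of_forall fun s => ⟨_, rfl⟩)
  rw [PointwiseConvergenceCLM.tendsto_iff_forall_tendsto]
  intro b
  let u' : 𝓢(Phase d, ℂ) →L[ℂ] ℂ := u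
  have h1 := (isExpansion_hwCoeff hd b).mapL u'
  rw [HasSum, SummationFilter.unconditional_filter] at h1
  refine Filter.Tendsto.congr (fun s => ?_) h1
  rw [toTemperedDistribution_apply, map_sum]
  refine Finset.sum_congr rfl fun α _ => ?_
  rw [map_smul, map_smul, pair_comm b, smul_eq_mul, smul_eq_mul]
  change hwCoeff α b * u' (hermiteWong α) = _ * u' (hermiteWong α) * _
  rw [hwCoeff_apply]
  ring

/-- The extension is precomposition with the transpose `e` of `T`, with inverse precomposition with
`e.symm`. Density of the Schwartz functions gives uniqueness. -/
theorem extendsUniquelyTempered (hd : 0 < d) {T : 𝓢(Phase d, ℂ) →L[ℂ] 𝓢(Phase d, ℂ)}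
    (e : 𝓢(Phase d, ℂ) ≃L[ℂ] 𝓢(Phase d, ℂ)) (h : ∀ f g, pair (T f) g = pair f (e g)) :
    ExtendsUniquelyTempered T := by
  let Φ : 𝓢'(Phase d, ℂ) ≃L[ℂ] 𝓢'(Phase d, ℂ) := ContinuousLinearEquiv.equivOfInverse
    (PointwiseConvergenceCLM.precomp ℂ (e : 𝓢(Phase d, ℂ) →L[ℂ] 𝓢(Phase d, ℂ)))
    (PointwiseConvergenceCLM.precomp ℂ (e.symm : 𝓢(Phase d, ℂ) →L[ℂ] 𝓢(Phase d, ℂ)))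
    (fun u => by ext a; exact congrArg u (e.apply_symm_apply a))
    (fun u => by ext a; exact congrArg u (e.symm_apply_apply a))
  have hΦ : ∀ a : 𝓢(Phase d, ℂ), Φ (toTemperedDistributionCLM (Phase d) ℂ volume a) =
      toTemperedDistributionCLM (Phase d) ℂ volume (T a) := by
    intro a
    ext g
    change toTemperedDistributionCLM (Phase d) ℂ volume a (e g) = _
    rw [toTemperedDistribution_apply, toTemperedDistribution_apply, pair_comm, ← h, pair_comm]
  refine ⟨Φ, hΦ, fun Ψ hΨ h' => ?_⟩
  refine (denseRange_toTemperedDistribution hd).equalizer hΨ Φ.continuous (funext fun a => ?_)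
  exact (h' a).trans (hΦ a).symm

end Coeff

/-! ### Weights -/

section Weight
variable {d : ℕ} {s : ℝ}

theorem weight_le_one {r : ℝ} (hr : 0 ≤ r) (α : Idx d) : weight s r α ≤ 1 := by
  unfold weight
  split_ifs
  · exact le_rfl
  · exact zero_le_one
  · exact Real.exp_le_one_iff.2 (neg_nonpos.2 (by positivity))

theorem weight_pos (hs : 0 < s) (r : ℝ) (α : Idx d) : 0 < weight s r α := by
  rw [weight, if_neg hs.ne']
  exact Real.exp_pos _

/-- For s = 0 the value r = 1/(1 + |α|) is the threshold at which the cut-off still includes α. It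
provides a defining map that sees the coefficient of index α, for every s. -/
theorem weight_inv_size_pos (s : ℝ) (α : Idx d) : 0 < weight s (size α)⁻¹ α := by
  unfold weight
  split_ifs with h0 h1
  · exact one_pos
  · exact absurd (inv_mul_cancel₀ (size_pos α).ne').le h1
  · exact Real.exp_pos _

theorem exists_pow_mul_exp_rpow_le {p c : ℝ} (hp : 0 < p) (hc : 0 < c) (M : ℕ) :
    ∃ C : ℝ, 0 ≤ C ∧ ∀ t : ℝ, 0 ≤ t → (t + 1) ^ M * Real.exp (-(c * t ^ p)) ≤ C := by
  -- With pK ≥ M one has t^M ≤ (t^p)^K for t ≥ 1, and the K-th term of the exponential series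
  -- absorbs this power.
  obtain ⟨K, hK⟩ := exists_nat_ge (M / p)
  refine ⟨2 ^ M * max 1 ((K ! : ℝ) / c ^ K), by positivity, fun t ht => ?_⟩
  rcases le_total t 1 with h | h
  · refine mul_le_mul (by gcongr; linarith) ?_ (Real.exp_nonneg _) (by positivity)
    exact (Real.exp_le_one_iff.2 (neg_nonpos.2 (by positivity))).trans (le_max_left _ _)
  · have h1 : t ^ M ≤ (t ^ p) ^ K := by
      rw [← Real.rpow_natCast t M, ← Real.rpow_natCast (t ^ p) K, ← Real.rpow_mul ht]
      exact Real.rpow_le_rpow_of_exponent_le h (by rw [div_le_iff₀ hp] at hK; linarith)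
    have h2 := Real.pow_div_factorial_le_exp (c * t ^ p) (by positivity) K
    have h3 : t ^ M * Real.exp (-(c * t ^ p)) ≤ (K ! : ℝ) / c ^ K := by
      rw [Real.exp_neg, ← div_eq_mul_inv, div_le_div_iff₀ (Real.exp_pos _) (by positivity)]
      rw [div_le_iff₀ (by positivity), mul_pow] at h2
      calc t ^ M * c ^ K ≤ (t ^ p) ^ K * c ^ K := by gcongr
        _ ≤ _ := by linarith
    calc (t + 1) ^ M * Real.exp (-(c * t ^ p)) ≤ (2 * t) ^ M * Real.exp (-(c * t ^ p)) := by
          gcongr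
          linarith
      _ = 2 ^ M * (t ^ M * Real.exp (-(c * t ^ p))) := by rw [mul_pow, mul_assoc]
      _ ≤ _ := by
        gcongr
        exact h3.trans (le_max_right _ _)

/-- For s > 0 half of the exponent absorbs the polynomial; for s = 0 the weight lives where `size α
≤ r⁻¹`, so the polynomial is bounded there. The form `r = r' + r'` allows both halving and doubling
of r. -/
theorem exists_size_pow_mul_weight_le (hs : 0 ≤ s) {r r' : ℝ} (hr' : 0 < r') (h : r = r' + r')
    (M : ℕ) :
    ∃ C : ℝ, 0 ≤ C ∧ ∀ α : Idx d, size α ^ M * weight s r α ≤ C * weight s r' α := by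
  rcases hs.eq_or_lt with rfl | hs
  · refine ⟨(r⁻¹) ^ M, pow_nonneg (inv_nonneg.2 (by linarith)) _, fun α => ?_⟩
    have h0 := (size_pos α).le
    have hr : 0 < r := by linarith
    by_cases h1 : r * size α ≤ 1
    · have h2 : weight 0 r α = 1 := by rw [weight, if_pos rfl]; exact if_pos h1
      have h3 : weight 0 r' α = 1 :=
        le_antisymm (weight_le_one hr'.le α) (h2 ▸ weight_anti 0 (by linarith) α)
      rw [h2, h3, mul_one, mul_one]
      gcongr
      rw [← one_div, le_div_iff₀ hr, mul_comm]
      exact h1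
    · have h2 : weight 0 r α = 0 := by rw [weight, if_pos rfl]; exact if_neg h1
      rw [h2, mul_zero]
      exact mul_nonneg (by positivity) (weight_nonneg ..)
  · obtain ⟨C, hC, hb⟩ := exists_pow_mul_exp_rpow_le (p := 1 / (2 * s)) (by positivity) hr' M
    refine ⟨C, hC, fun α => ?_⟩
    have h1 : weight s r α = weight s r' α * weight s r' α := by
      simp only [weight, if_neg hs.ne']
      rw [← Real.exp_add, h]
      ring_nf
    rw [h1, ← mul_assoc]
    refine mul_le_mul_of_nonneg_right ?_ (weight_nonneg ..)
    have := hb ((len α.1 + len α.2 : ℕ) : ℝ) (Nat.cast_nonneg _)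
    rw [weight, if_neg hs.ne']
    exact this

/-- A family of complex numbers growing at most linearly. -/
def LinearGrowth (m : Idx d → ℂ) : Prop := ∃ K : ℝ, 0 ≤ K ∧ ∀ α, ‖m α‖ ≤ K * size α

theorem LinearGrowth.exists_mul_weight_le {m : Idx d → ℂ} (hm : LinearGrowth m) (hs : 0 ≤ s)
    {r r' : ℝ} (hr' : 0 < r') (h : r = r' + r') :
    ∃ C : ℝ, 0 ≤ C ∧ ∀ α, ‖m α‖ * weight s r α ≤ C * weight s r' α := by
  obtain ⟨K, hK, hm⟩ := hm
  obtain ⟨C, hC, hw⟩ := exists_size_pow_mul_weight_le (d := d) hs hr' h 1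
  refine ⟨K * C, by positivity, fun α => ?_⟩
  calc ‖m α‖ * weight s r α ≤ K * size α * weight s r α :=
        mul_le_mul_of_nonneg_right (hm α) (weight_nonneg ..)
    _ = K * (size α ^ 1 * weight s r α) := by ring
    _ ≤ K * (C * weight s r' α) := mul_le_mul_of_nonneg_left (hw α) hK
    _ = _ := by ring

theorem weight_eq_zero {r r' : ℝ} (h : r' ≤ r) {α : Idx d} (h0 : weight s r' α = 0) :
    weight s r α = 0 :=
  le_antisymm (h0 ▸ weight_anti s h α) (weight_nonneg ..)

/-- The bounded multiplier through which a linearly growing multiplier acts between two weighted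
spaces. -/
theorem LinearGrowth.exists_bdd {m : Idx d → ℂ} (hm : LinearGrowth m) (hs : 0 ≤ s)
    {r r' : ℝ} (hr' : 0 < r') (h : r = r' + r') :
    ∃ g : Bdd d, ∀ α, g α * (weight s r' α : ℂ) = m α * (weight s r α : ℂ) := by
  obtain ⟨C, hC, hw⟩ := hm.exists_mul_weight_le hs hr' h
  refine ⟨toBdd (fun α => m α * (weight s r α : ℂ) / (weight s r' α : ℂ)) ⟨C, fun α => ?_⟩,
    fun α => ?_⟩
  · rw [norm_div, norm_mul, Complex.norm_real, Complex.norm_real,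
      Real.norm_of_nonneg (weight_nonneg ..), Real.norm_of_nonneg (weight_nonneg ..)]
    exact div_le_of_le_mul₀ (weight_nonneg ..) hC (hw α)
  · change m α * (weight s r α : ℂ) / (weight s r' α : ℂ) * (weight s r' α : ℂ) = _
    -- For s = 0 the denominator may vanish; then the weight for the larger `r` vanishes too and
    -- both sides are 0.
    rcases eq_or_ne (weight s r' α) 0 with h0 | h0
    · rw [weight_eq_zero (by linarith) h0, h0]
      simp
    · exact div_mul_cancel₀ _ (Complex.ofReal_ne_zero.2 h0)

end Weight

/-! ### Limit topologies -/

section Limits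
variable {ι F E : Type*} [TopologicalSpace F]

/-- The universal property: the topology induced by `Φ` is itself a locally convex vector space
topology making all `T i` continuous, hence a member of the family whose infimum is taken. -/
theorem continuous_lcInductive_dom [AddCommGroup E] [Module ℂ E] {E' : Type*} [AddCommGroup E']
    [Module ℂ E'] [t : TopologicalSpace E'] [IsTopologicalAddGroup E'] [ContinuousSMul ℂ E']
    [LocallyConvexSpace ℝ E'] {T : ι → F → E} (Φ : E →ₗ[ℂ] E')
    (h : ∀ i, Continuous fun x => Φ (T i x)) :
    @Continuous E E' (lcInductive T) t Φ := by
  rw [continuous_iff_le_induced]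
  refine sInf_le ⟨fun i => continuous_induced_rng.2 (h i), topologicalAddGroup_induced Φ,
    continuousSMul_induced Φ, ?_⟩
  exact LocallyConvexSpace.induced (Φ.restrictScalars ℝ)

theorem continuous_lcInductive [AddCommGroup E] [Module ℂ E] (T : ι → F → E) (i : ι) :
    @Continuous F E _ (lcInductive T) (T i) :=
  continuous_sInf_rng.2 fun _ ht => ht.1 i

theorem continuous_lcInductive_map [AddCommGroup E] [Module ℂ E] {T : ι → F → E} (Φ : E →ₗ[ℂ] E)
    (h : ∀ i, ∃ (j : ι) (g : F → F), Continuous g ∧ ∀ x, Φ (T i x) = T j (g x)) :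
    @Continuous E E (lcInductive T) (lcInductive T) Φ := by
  refine continuous_sInf_rng.2 fun t ⟨h1, h2, h3, h4⟩ => ?_
  refine @continuous_lcInductive_dom ι F E _ _ _ E _ _ t h2 h3 h4 T Φ fun i => ?_
  obtain ⟨j, g, hg, hi⟩ := h i
  simp only [hi]
  exact @Continuous.comp _ _ _ _ _ t _ _ (h1 j) hg

theorem continuous_projective (T : ι → E → F) (i : ι) :
    @Continuous E F (projective T) _ (T i) :=
  continuous_iInf_dom continuous_induced_dom

theorem continuous_projective_map {T : ι → E → F} (Φ : E → E)
    (h : ∀ i, ∃ (j : ι) (g : F → F), Continuous g ∧ ∀ c, T i (Φ c) = g (T j c)) :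
    @Continuous E E (projective T) (projective T) Φ := by
  refine continuous_iInf_rng.2 fun i => continuous_induced_rng.2 ?_
  obtain ⟨j, g, hg, hi⟩ := h i
  have h1 : T i ∘ Φ = g ∘ T j := funext hi
  rw [h1]
  exact @Continuous.comp _ _ _ (projective T) _ _ _ _ hg (continuous_projective T j)

theorem tendsto_projective {T : ι → E → F} {β : Type*} {l : Filter β} {f : β → E} {c : E}
    (h : ∀ i, Filter.Tendsto (fun b => T i (f b)) l (nhds (T i c))) :
    Filter.Tendsto f l (@nhds E (projective T) c) := by
  rw [nhds_iInf, Filter.tendsto_iInf]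
  intro i
  rw [nhds_induced, Filter.tendsto_comap_iff]
  exact h i

end Limits

/-! ### Truncations -/

section Truncation
variable {d : ℕ}

/-- The restriction of a family to `|α| ≤ N`. -/
def truncate (N : ℕ) (f : Idx d → ℂ) (α : Idx d) : ℂ := if len α.1 + len α.2 ≤ N then f α else 0

theorem norm_truncate_le (N : ℕ) (f : Idx d → ℂ) (α : Idx d) : ‖truncate N f α‖ ≤ ‖f α‖ := by
  unfold truncate
  split_ifs
  · exact le_rfl
  · simp

theorem finite_support_truncate (N : ℕ) (f : Idx d → ℂ) :
    (Function.support (truncate N f)).Finite := by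
  refine ((Set.finite_Iic (fun _ : Fin d => N)).prod (Set.finite_Iic (fun _ : Fin d => N))).subset
    fun α hα => ?_
  have h : len α.1 + len α.2 ≤ N := by
    by_contra h
    exact hα (if_neg h)
  exact ⟨fun j => (le_len j α.1).trans ((Nat.le_add_right _ _).trans h),
    fun j => (le_len j α.2).trans ((Nat.le_add_left _ _).trans h)⟩

/-- Bounded families need not be limits of their truncations in ℓ^∞; decay of order 1/`size` makes
the tail beyond N at most C/(N+1). -/
theorem tendsto_of_truncate {b : Bdd d} {C : ℝ} (h : ∀ α, ‖b α‖ * size α ≤ C) {u : ℕ → Bdd d}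
    (hu : ∀ N α, u N α = truncate N b α) : Filter.Tendsto u Filter.atTop (nhds b) := by
  have hC : 0 ≤ C := (mul_nonneg (norm_nonneg _) (size_pos 0).le).trans (h 0)
  rw [tendsto_iff_norm_sub_tendsto_zero]
  refine squeeze_zero (fun _ => norm_nonneg _) (fun N => ?_)
    (tendsto_const_div_atTop_nhds_zero_nat C |>.comp (Filter.tendsto_add_atTop_nat 1))
  refine lp.norm_le_of_forall_le (by dsimp; positivity) fun α => ?_
  rw [lp.coeFn_sub, Pi.sub_apply, hu, truncate]
  dsimp only [Function.comp_apply]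
  split_ifs with h1
  · rw [sub_self, norm_zero]
    positivity
  · rw [zero_sub, norm_neg, le_div_iff₀ (by positivity)]
    refine le_trans ?_ (h α)
    gcongr
    unfold size
    push_cast
    have : (N : ℝ) ≤ ((len α.1 + len α.2 : ℕ) : ℝ) := by exact_mod_cast (not_le.1 h1).le
    push_cast at this
    linarith

end Truncation

/-! ### Diagonal operators on spaces of expansions -/

section Diagonal
variable {d : ℕ} {E : Type} [AddCommGroup E] [Module ℂ E] [TopologicalSpace E]

/-- Linearly growing multipliers act continuously on the space `E` of expansions. -/
def HasDiagonal (coeff : E →ₗ[ℂ] (Idx d → ℂ)) : Prop :=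
  ∀ m : Idx d → ℂ, LinearGrowth m → ∃ Φ : E →L[ℂ] E, ∀ c α, coeff (Φ c) α = m α * coeff c α

variable {coeff : E →ₗ[ℂ] (Idx d → ℂ)}

/-- The reciprocal multiplier is bounded by 1, so it also grows at most linearly and gives a
continuous inverse. -/
theorem HasDiagonal.exists_equiv (h : HasDiagonal coeff) (hinj : Function.Injective coeff)
    {μ : Idx d → ℂ} (hμ : ∀ α, 1 ≤ ‖μ α‖) (hμ' : LinearGrowth μ) :
    ∃ Φ : E ≃L[ℂ] E, ∀ c α, coeff (Φ c) α = μ α * coeff c α := by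
  have h0 : ∀ α, μ α ≠ 0 := fun α => norm_pos_iff.1 (one_pos.trans_le (hμ α))
  obtain ⟨A, hA⟩ := h μ hμ'
  obtain ⟨B, hB⟩ := h (fun α => (μ α)⁻¹) ⟨1, zero_le_one, fun α => by
    rw [norm_inv, one_mul]
    exact (inv_le_one_of_one_le₀ (hμ α)).trans (one_le_size α)⟩
  exact ⟨ContinuousLinearEquiv.equivOfInverse A B
    (fun c => hinj (funext fun α => by rw [hB, hA, inv_mul_cancel_left₀ (h0 α)]))
    (fun c => hinj (funext fun α => by rw [hA, hB, mul_inv_cancel_left₀ (h0 α)])), hA⟩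

theorem isExpansion_map {T : 𝓢(Phase d, ℂ) →L[ℂ] 𝓢(Phase d, ℂ)} {μ : Idx d → ℂ}
    (hT : ∀ α, T (hermiteWong α) = μ α • hermiteWong α) {c c' : Idx d → ℂ} {a : 𝓢(Phase d, ℂ)}
    (hc : ∀ α, c' α = μ α * c α) (h : IsExpansion c a) : IsExpansion c' (T a) := by
  have h1 := h.mapL T
  have h2 : (fun α => c' α • hermiteWong α) = fun α => T (c α • hermiteWong α) := by
    funext α
    rw [hc, map_smul, hT, smul_smul, mul_comm]
  rw [IsExpansion, h2]
  exact h1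

theorem HasDiagonal.restrictsToHomeo (h : HasDiagonal coeff) (hinj : Function.Injective coeff)
    (hdecay : ∀ (c : E) (N : ℕ), ∃ C : ℝ, ∀ α, ‖coeff c α‖ * size α ^ N ≤ C)
    {T : 𝓢(Phase d, ℂ) →L[ℂ] 𝓢(Phase d, ℂ)} {μ : Idx d → ℂ} (hμ : ∀ α, 1 ≤ ‖μ α‖)
    (hμ' : LinearGrowth μ) (hT : ∀ α, T (hermiteWong α) = μ α • hermiteWong α) :
    RestrictsToHomeo T coeff := by
  obtain ⟨Φ, hΦ⟩ := h.exists_equiv hinj hμ hμ'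
  refine ⟨Φ, fun c => ?_⟩
  obtain ⟨a, ha⟩ := exists_isExpansion (hdecay c)
  exact ⟨a, ha, isExpansion_map hT (hΦ c) ha⟩

theorem isExpansion_of_finite_support {c : Idx d → ℂ} (hc : (Function.support c).Finite) :
    ∃ a, IsExpansion c a :=
  ⟨_, hasSum_sum_of_ne_finset_zero (s := hc.toFinset) fun α hα => by
    have : c α = 0 := by simpa using hα
    rw [this, zero_smul]⟩

/-- Existence uses that coefficients of Schwartz functions are bounded. For uniqueness, a finite
expansion represents a Schwartz function, so both maps send it to expansions of the same function,
which have the same coefficients; density and coefficientwise continuity finish, without linearity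
of `Ψ`. -/
theorem HasDiagonal.extendsUniquely (hd : 0 < d) (h : HasDiagonal coeff)
    (hinj : Function.Injective coeff)
    (hbdd : ∀ f : Idx d → ℂ, (∃ C : ℝ, ∀ α, ‖f α‖ ≤ C) → ∃ c, coeff c = f)
    (hcoeff : ∀ α, Continuous fun c => coeff c α)
    (hdense : Dense {c : E | (Function.support (coeff c)).Finite})
    {T : 𝓢(Phase d, ℂ) →L[ℂ] 𝓢(Phase d, ℂ)} {μ : Idx d → ℂ} (hμ : ∀ α, 1 ≤ ‖μ α‖)
    (hμ' : LinearGrowth μ) (hT : ∀ α, T (hermiteWong α) = μ α • hermiteWong α) :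
    ExtendsUniquely T coeff := by
  obtain ⟨Φ, hΦ⟩ := h.exists_equiv hinj hμ hμ'
  have hext : Extends T coeff Φ := fun c a => isExpansion_map hT (hΦ c)
  refine ⟨fun a => ?_, Φ, hext, fun Ψ hΨ hΨ' => ?_⟩
  · obtain ⟨C, hC⟩ := hwCoeff_rapidDecay hd a 0
    obtain ⟨c, hc⟩ := hbdd (fun α => hwCoeff α a) ⟨C, fun α => by simpa using hC α⟩
    exact ⟨c, hc ▸ isExpansion_hwCoeff hd a⟩
  · funext c
    refine hinj (funext fun α => ?_)
    refine congrFun (Continuous.ext_on hdense ((hcoeff α).comp hΨ)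
      ((hcoeff α).comp Φ.continuous) fun c' hc' => ?_) c
    obtain ⟨a, ha⟩ := isExpansion_of_finite_support hc'
    exact (hwCoeff_of_isExpansion (hΨ' c' a ha) α).symm.trans
      (hwCoeff_of_isExpansion (hext c' a ha) α)

end Diagonal

/-! ### The four types of spaces -/

theorem continuous_bdd_mul {d : ℕ} (g : Bdd d) : Continuous fun b : Bdd d => g * b :=
  continuous_const.mul continuous_id

theorem decay_of_weight {d : ℕ} {s : ℝ} (hs : 0 ≤ s) {c : Idx d → ℂ} {r C : ℝ} (hr : 0 < r)
    (hc : ∀ α, ‖c α‖ ≤ C * weight s r α) (N : ℕ) :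
    ∃ C : ℝ, ∀ α, ‖c α‖ * size α ^ N ≤ C := by
  obtain ⟨C', hC', hw⟩ := exists_size_pow_mul_weight_le (d := d) hs (half_pos hr)
    (add_halves r).symm N
  refine ⟨|C| * C', fun α => ?_⟩
  have h0 := pow_nonneg (size_pos α).le N
  calc ‖c α‖ * size α ^ N ≤ |C| * weight s r α * size α ^ N := by
        refine mul_le_mul_of_nonneg_right ((hc α).trans ?_) h0
        exact mul_le_mul_of_nonneg_right (le_abs_self C) (weight_nonneg ..)
    _ = |C| * (size α ^ N * weight s r α) := by ring
    _ ≤ |C| * (C' * 1) := by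
        refine mul_le_mul_of_nonneg_left ((hw α).trans ?_) (abs_nonneg C)
        exact mul_le_mul_of_nonneg_left (weight_le_one (half_pos hr).le α) hC'
    _ = _ := by ring

namespace Roumieu
variable {d : ℕ} {s : ℝ}

theorem hasDiagonal (hs : 0 ≤ s) : HasDiagonal (coeff (d := d) (s := s)) := by
  intro m hm
  let Φ : Roumieu d s →ₗ[ℂ] Roumieu d s :=
    { toFun := fun c => ⟨fun α => m α * coeff c α, by
        obtain ⟨r, hr, C, hC⟩ := c.2
        obtain ⟨C', hC', hw⟩ := hm.exists_mul_weight_le hs (half_pos hr) (add_halves r).symm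
        refine ⟨r / 2, half_pos hr, |C| * C', fun α => ?_⟩
        rw [norm_mul]
        calc ‖m α‖ * ‖coeff c α‖ ≤ ‖m α‖ * (|C| * weight s r α) := by
              refine mul_le_mul_of_nonneg_left ((hC α).trans ?_) (norm_nonneg _)
              exact mul_le_mul_of_nonneg_right (le_abs_self C) (weight_nonneg ..)
          _ = |C| * (‖m α‖ * weight s r α) := by ring
          _ ≤ |C| * (C' * weight s (r / 2) α) := by
              exact mul_le_mul_of_nonneg_left (hw α) (abs_nonneg C)
          _ = _ := by ring⟩
      map_add' := fun c c' => Subtype.ext (funext fun α => mul_add _ _ _)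
      map_smul' := fun z c => Subtype.ext (funext fun α => mul_left_comm _ _ _) }
  refine ⟨⟨Φ, continuous_lcInductive_map Φ fun r => ?_⟩, fun c α => rfl⟩
  have hr : 0 < (r : ℝ) := r.2
  -- The multiplier carries the Banach step r into the step r/2 through multiplication by a bounded
  -- family.
  obtain ⟨g, hg⟩ := hm.exists_bdd hs (half_pos hr) (add_halves (r : ℝ)).symm
  refine ⟨⟨r / 2, half_pos hr⟩, fun b => g * b, continuous_bdd_mul g, fun b =>
    Subtype.ext (funext fun α => ?_)⟩
  change m α * ((weight s r α : ℂ) * b α) = (weight s (r / 2) α : ℂ) * (g α * b α)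
  linear_combination -(b α) * hg α

theorem coeff_injective : Function.Injective (coeff (d := d) (s := s)) := Subtype.val_injective

theorem decay (hs : 0 ≤ s) (c : Roumieu d s) (N : ℕ) :
    ∃ C : ℝ, ∀ α, ‖coeff c α‖ * size α ^ N ≤ C := by
  obtain ⟨r, hr, C, hC⟩ := c.2
  exact decay_of_weight hs hr hC N

end Roumieu

namespace Beurling
variable {d : ℕ} {s : ℝ}

theorem hasDiagonal (hs : 0 ≤ s) : HasDiagonal (coeff (d := d) (s := s)) := by
  intro m hm
  let Φ : Beurling d s →ₗ[ℂ] Beurling d s :=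
    { toFun := fun c => ⟨fun α => m α * coeff c α, fun r hr => by
        obtain ⟨C, hC⟩ := c.2 (r + r) (add_pos hr hr)
        obtain ⟨C', hC', hw⟩ := hm.exists_mul_weight_le hs hr rfl
        refine ⟨|C| * C', fun α => ?_⟩
        rw [norm_mul]
        calc ‖m α‖ * ‖coeff c α‖ ≤ ‖m α‖ * (|C| * weight s (r + r) α) := by
              refine mul_le_mul_of_nonneg_left ((hC α).trans ?_) (norm_nonneg _)
              exact mul_le_mul_of_nonneg_right (le_abs_self C) (weight_nonneg ..)
          _ = |C| * (‖m α‖ * weight s (r + r) α) := by ring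
          _ ≤ |C| * (C' * weight s r α) := by
              exact mul_le_mul_of_nonneg_left (hw α) (abs_nonneg C)
          _ = _ := by ring⟩
      map_add' := fun c c' => Subtype.ext (funext fun α => mul_add _ _ _)
      map_smul' := fun z c => Subtype.ext (funext fun α => mul_left_comm _ _ _) }
  refine ⟨⟨Φ, continuous_projective_map Φ fun r => ?_⟩, fun c α => rfl⟩
  have hr : 0 < (r : ℝ) := r.2
  -- In the projective limit the estimate runs the other way: the norm with parameter r is
  -- controlled by the one with 2r.
  obtain ⟨g, hg⟩ := hm.exists_bdd hs hr rfl
  refine ⟨⟨r + r, add_pos hr hr⟩, fun b => g * b, continuous_bdd_mul g, fun c =>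
    Subtype.ext (funext fun α => ?_)⟩
  change m α * coeff c α / (weight s r α : ℂ) = g α * (coeff c α / (weight s (r + r) α : ℂ))
  -- For s = 0 the weight can vanish, but then the defining bound forces the coefficient to vanish.
  rcases eq_or_ne (weight s (r + r) α) 0 with h0 | h0
  · obtain ⟨C, hC⟩ := c.2 (r + r) (add_pos hr hr)
    have h1 : coeff c α = 0 := by
      have := hC α
      rw [h0, mul_zero] at this
      exact norm_le_zero_iff.1 this
    rw [h1, mul_zero, zero_div, zero_div, mul_zero]
  · have h1 : weight s r α ≠ 0 := fun h => h0 (weight_eq_zero (by linarith) h)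
    rw [div_eq_iff (Complex.ofReal_ne_zero.2 h1), mul_right_comm, hg, mul_right_comm,
      mul_assoc, div_mul_cancel₀ _ (Complex.ofReal_ne_zero.2 h0)]

theorem coeff_injective : Function.Injective (coeff (d := d) (s := s)) := Subtype.val_injective

theorem decay (hs : 0 ≤ s) (c : Beurling d s) (N : ℕ) :
    ∃ C : ℝ, ∀ α, ‖coeff c α‖ * size α ^ N ≤ C := by
  obtain ⟨C, hC⟩ := c.2 1 one_pos
  exact decay_of_weight hs one_pos hC N

end Beurling

namespace RoumieuDual
variable {d : ℕ} {s : ℝ}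

theorem hasDiagonal (hs : 0 ≤ s) : HasDiagonal (coeff (d := d) (s := s)) := by
  intro m hm
  let Φ : RoumieuDual d s →ₗ[ℂ] RoumieuDual d s :=
    { toFun := fun c => ⟨fun α => m α * coeff c α, fun r hr => by
        obtain ⟨C, hC⟩ := c.2 (r / 2) (half_pos hr)
        obtain ⟨C', hC', hw⟩ := hm.exists_mul_weight_le hs (half_pos hr) (add_halves r).symm
        refine ⟨C' * C, fun α => ?_⟩
        rw [norm_mul]
        calc ‖m α‖ * ‖coeff c α‖ * weight s r α = ‖m α‖ * weight s r α * ‖coeff c α‖ := by ring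
          _ ≤ C' * weight s (r / 2) α * ‖coeff c α‖ := by
              exact mul_le_mul_of_nonneg_right (hw α) (norm_nonneg _)
          _ = C' * (‖coeff c α‖ * weight s (r / 2) α) := by ring
          _ ≤ _ := mul_le_mul_of_nonneg_left (hC α) hC'⟩
      map_add' := fun c c' => Subtype.ext (funext fun α => mul_add _ _ _)
      map_smul' := fun z c => Subtype.ext (funext fun α => mul_left_comm _ _ _) }
  refine ⟨⟨Φ, continuous_projective_map Φ fun r => ?_⟩, fun c α => rfl⟩
  have hr : 0 < (r : ℝ) := r.2
  obtain ⟨g, hg⟩ := hm.exists_bdd hs (half_pos hr) (add_halves (r : ℝ)).symm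
  refine ⟨⟨r / 2, half_pos hr⟩, fun b => g * b, continuous_bdd_mul g, fun c =>
    Subtype.ext (funext fun α => ?_)⟩
  change m α * coeff c α * (weight s r α : ℂ) = g α * (coeff c α * (weight s (r / 2) α : ℂ))
  linear_combination -(coeff c α) * hg α

theorem coeff_injective : Function.Injective (coeff (d := d) (s := s)) := Subtype.val_injective

theorem exists_coeff_eq (f : Idx d → ℂ) (hf : ∃ C : ℝ, ∀ α, ‖f α‖ ≤ C) :
    ∃ c, coeff (d := d) (s := s) c = f := by
  obtain ⟨C, hC⟩ := hf
  exact ⟨⟨f, fun r hr => ⟨C, fun α => (mul_le_of_le_one_right (norm_nonneg _)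
    (weight_le_one (le_of_lt hr) α)).trans (hC α)⟩⟩, rfl⟩

theorem continuous_coeff (α : Idx d) : Continuous fun c => coeff (d := d) (s := s) c α := by
  have hw := weight_inv_size_pos s α
  let r : Set.Ioi (0 : ℝ) := ⟨(size α)⁻¹, inv_pos.2 (size_pos α)⟩
  have h : (fun c => coeff (d := d) (s := s) c α) =
      fun c => lp.evalCLM ℂ (fun _ : Idx d => ℂ) ∞ α (scaled r c) / (weight s r α : ℂ) := by
    funext c
    change _ = coeff c α * (weight s r α : ℂ) / (weight s r α : ℂ)
    rw [mul_div_cancel_right₀ _ (Complex.ofReal_ne_zero.2 hw.ne')]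
  rw [h]
  exact ((ContinuousLinearMap.continuous _).comp (continuous_projective scaled r)).div_const _

theorem dense_finite (hs : 0 ≤ s) :
    Dense {c : RoumieuDual d s | (Function.support (coeff c)).Finite} := by
  intro c
  let u : ℕ → RoumieuDual d s := fun N => ⟨truncate N (coeff c), fun r hr => by
    obtain ⟨C, hC⟩ := c.2 r hr
    exact ⟨C, fun α => (mul_le_mul_of_nonneg_right (norm_truncate_le N _ α)
      (weight_nonneg ..)).trans (hC α)⟩⟩
  refine mem_closure_of_tendsto (f := u) (b := Filter.atTop) (tendsto_projective fun r => ?_)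
    (.of_forall fun N => finite_support_truncate N _)
  have hr : 0 < (r : ℝ) := r.2
  -- Boundedness against the weight r/2 gives decay of order 1/`size` against the weight r, as
  -- truncation requires.
  obtain ⟨C, hC⟩ := c.2 (r / 2) (half_pos hr)
  obtain ⟨C', hC', hw⟩ := exists_size_pow_mul_weight_le (d := d) hs (half_pos hr)
    (add_halves (r : ℝ)).symm 1
  refine tendsto_of_truncate (C := C' * C) (fun α => ?_) fun N α => ?_
  · change ‖coeff c α * (weight s r α : ℂ)‖ * size α ≤ _
    rw [norm_mul, Complex.norm_real, Real.norm_of_nonneg (weight_nonneg ..)]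
    calc ‖coeff c α‖ * weight s r α * size α = size α ^ 1 * weight s r α * ‖coeff c α‖ := by ring
      _ ≤ C' * weight s (r / 2) α * ‖coeff c α‖ :=
          mul_le_mul_of_nonneg_right (hw α) (norm_nonneg _)
      _ = C' * (‖coeff c α‖ * weight s (r / 2) α) := by ring
      _ ≤ _ := mul_le_mul_of_nonneg_left (hC α) hC'
  · change truncate N (coeff c) α * (weight s r α : ℂ) =
      truncate N (fun α => coeff c α * (weight s r α : ℂ)) α
    unfold truncate
    split_ifs
    · rfl
    · exact zero_mul _

end RoumieuDual

namespace BeurlingDual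
variable {d : ℕ} {s : ℝ}

theorem hasDiagonal (hs : 0 < s) : HasDiagonal (coeff (d := d) (s := s)) := by
  intro m hm
  let Φ : BeurlingDual d s →ₗ[ℂ] BeurlingDual d s :=
    { toFun := fun c => ⟨fun α => m α * coeff c α, by
        obtain ⟨r, hr, C, hC⟩ := c.2
        obtain ⟨C', hC', hw⟩ := hm.exists_mul_weight_le hs.le hr rfl
        refine ⟨r + r, add_pos hr hr, C' * C, fun α => ?_⟩
        rw [norm_mul]
        calc ‖m α‖ * ‖coeff c α‖ * weight s (r + r) α
            = ‖m α‖ * weight s (r + r) α * ‖coeff c α‖ := by ring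
          _ ≤ C' * weight s r α * ‖coeff c α‖ := by
              exact mul_le_mul_of_nonneg_right (hw α) (norm_nonneg _)
          _ = C' * (‖coeff c α‖ * weight s r α) := by ring
          _ ≤ _ := mul_le_mul_of_nonneg_left (hC α) hC'⟩
      map_add' := fun c c' => Subtype.ext (funext fun α => mul_add _ _ _)
      map_smul' := fun z c => Subtype.ext (funext fun α => mul_left_comm _ _ _) }
  refine ⟨⟨Φ, continuous_lcInductive_map Φ fun r => ?_⟩, fun c α => rfl⟩
  have hr : 0 < (r : ℝ) := r.2
  obtain ⟨g, hg⟩ := hm.exists_bdd hs.le hr rfl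
  refine ⟨⟨r + r, add_pos hr hr⟩, fun b => g * b, continuous_bdd_mul g, fun b =>
    Subtype.ext (funext fun α => ?_)⟩
  change m α * (b α / (weight s r α : ℂ)) = g α * b α / (weight s (r + r) α : ℂ)
  have h1 : (weight s r α : ℂ) ≠ 0 := Complex.ofReal_ne_zero.2 (weight_pos hs _ α).ne'
  have h2 : (weight s (r + r) α : ℂ) ≠ 0 := Complex.ofReal_ne_zero.2 (weight_pos hs _ α).ne'
  rw [mul_div_assoc', div_eq_div_iff h1 h2]
  linear_combination -(b α) * hg α

theorem coeff_injective : Function.Injective (coeff (d := d) (s := s)) := Subtype.val_injective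

theorem exists_coeff_eq (f : Idx d → ℂ) (hf : ∃ C : ℝ, ∀ α, ‖f α‖ ≤ C) :
    ∃ c, coeff (d := d) (s := s) c = f := by
  obtain ⟨C, hC⟩ := hf
  exact ⟨⟨f, 1, one_pos, C, fun α => (mul_le_of_le_one_right (norm_nonneg _)
    (weight_le_one zero_le_one α)).trans (hC α)⟩, rfl⟩

theorem continuous_coeff (α : Idx d) : Continuous fun c => coeff (d := d) (s := s) c α := by
  refine continuous_lcInductive_dom ((LinearMap.proj α).comp coeff) fun r => ?_
  exact (lp.evalCLM ℂ (fun _ : Idx d => ℂ) ∞ α).continuous.div_const (weight s r α : ℂ)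

/-- An element of the step r need not be a norm limit of its truncations there, but it is in the
step 2r. Continuity of the step map carries the convergence to the inductive limit. -/
theorem dense_finite (hs : 0 < s) :
    Dense {c : BeurlingDual d s | (Function.support (coeff c)).Finite} := by
  intro c
  obtain ⟨r, hr, C, hC⟩ := c.2
  obtain ⟨C', hC', hw⟩ := exists_size_pow_mul_weight_le (d := d) hs.le hr rfl 1
  let f : Idx d → ℂ := fun α => coeff c α * (weight s (r + r) α : ℂ)
  have hf : ∀ α, ‖f α‖ * size α ≤ C' * C := by
    intro α
    rw [norm_mul, Complex.norm_real, Real.norm_of_nonneg (weight_nonneg ..)]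
    calc ‖coeff c α‖ * weight s (r + r) α * size α
        = size α ^ 1 * weight s (r + r) α * ‖coeff c α‖ := by ring
      _ ≤ C' * weight s r α * ‖coeff c α‖ :=
          mul_le_mul_of_nonneg_right (hw α) (norm_nonneg _)
      _ = C' * (‖coeff c α‖ * weight s r α) := by ring
      _ ≤ _ := mul_le_mul_of_nonneg_left (hC α) hC'
  have hf' : ∀ α, ‖f α‖ ≤ C' * C := fun α =>
    (le_mul_of_one_le_right (norm_nonneg _) (one_le_size α)).trans (hf α)
  let b : Bdd d := toBdd f ⟨_, hf'⟩
  let u : ℕ → Bdd d := fun N => toBdd (truncate N f) ⟨_, fun α =>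
    (norm_truncate_le N f α).trans (hf' α)⟩
  let ρ : Set.Ioi (0 : ℝ) := ⟨r + r, add_pos hr hr⟩
  have hb : step ρ b = c := Subtype.ext (funext fun α =>
    mul_div_cancel_right₀ _ (Complex.ofReal_ne_zero.2 (weight_pos hs _ α).ne'))
  have hu : Filter.Tendsto u Filter.atTop (nhds b) := tendsto_of_truncate hf fun N α => rfl
  have hlim := ((continuous_lcInductive (step (d := d) (s := s)) ρ).tendsto b).comp hu
  rw [hb] at hlim
  refine mem_closure_of_tendsto hlim (.of_forall fun N => ?_)
  refine (finite_support_truncate N f).subset fun α hα h0 => hα ?_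
  change truncate N f α / _ = 0
  rw [h0, zero_div]

end BeurlingDual

/-! ### The twisted harmonic oscillators -/

section Operators
variable {d : ℕ}

theorem one_le_norm_eigenvalue (hd : 0 < d) (n : ℕ) : 1 ≤ ‖(2 * (n : ℂ) + (d : ℂ))‖ := by
  have h : (2 * (n : ℂ) + (d : ℂ)) = ((2 * n + d : ℕ) : ℂ) := by push_cast; rfl
  rw [h, Complex.norm_natCast]
  exact_mod_cast (by omega : 1 ≤ 2 * n + d)

theorem linearGrowth_eigenvalue {ν : Idx d → ℕ} (hν : ∀ α, ν α ≤ len α.1 + len α.2) :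
    LinearGrowth fun α : Idx d => (2 * (ν α : ℂ) + (d : ℂ)) := by
  refine ⟨2 + d, by positivity, fun α => ?_⟩
  have h : (2 * (ν α : ℂ) + (d : ℂ)) = ((2 * ν α + d : ℕ) : ℂ) := by push_cast; rfl
  have h1 : (ν α : ℝ) ≤ ((len α.1 + len α.2 : ℕ) : ℝ) := by exact_mod_cast hν α
  have h2 : (0 : ℝ) ≤ d := Nat.cast_nonneg d
  have h3 : (0 : ℝ) ≤ ν α := Nat.cast_nonneg _
  change ‖(2 * (ν α : ℂ) + (d : ℂ))‖ ≤ _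
  rw [h, Complex.norm_natCast, size]
  push_cast at *
  nlinarith [mul_nonneg h2 (h3.trans h1)]

/-- A diagonal operator with eigenvalues `2 ν_α + d` whose transpose is again such an operator
restricts and extends to homeomorphisms. -/
theorem homeo_of_diagonal (hd : 0 < d) {s : ℝ} (hs : 0 ≤ s)
    {T T' : 𝓢(Phase d, ℂ) →L[ℂ] 𝓢(Phase d, ℂ)} {ν ν' : Idx d → ℕ}
    (hν : ∀ α, ν α ≤ len α.1 + len α.2)
    (hT : ∀ α, T (hermiteWong α) = (2 * (ν α : ℂ) + (d : ℂ)) • hermiteWong α)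
    (hT' : ∀ α a, hwCoeff α (T' a) = (2 * (ν' α : ℂ) + (d : ℂ)) * hwCoeff α a)
    (hpair : ∀ f g, pair (T f) g = pair f (T' g)) :
    RestrictsToHomeo T (Roumieu.coeff (d := d) (s := s)) ∧
    RestrictsToHomeo T (Beurling.coeff (d := d) (s := s)) ∧
    ExtendsUniquelyTempered T ∧
    ExtendsUniquely T (RoumieuDual.coeff (d := d) (s := s)) ∧
    (0 < s → ExtendsUniquely T (BeurlingDual.coeff (d := d) (s := s))) := by
  have h1 := linearGrowth_eigenvalue hν
  have h2 : ∀ α, 1 ≤ ‖(2 * (ν α : ℂ) + (d : ℂ))‖ := fun α => one_le_norm_eigenvalue hd _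
  obtain ⟨e, he⟩ := exists_equiv_of_diagonal hd (T := T')
    (μ := fun α => 2 * (ν' α : ℂ) + (d : ℂ)) (fun α => one_le_norm_eigenvalue hd _)
    fun a α => hT' α a
  exact ⟨(Roumieu.hasDiagonal hs).restrictsToHomeo Roumieu.coeff_injective (Roumieu.decay hs)
      h2 h1 hT,
    (Beurling.hasDiagonal hs).restrictsToHomeo Beurling.coeff_injective (Beurling.decay hs)
      h2 h1 hT,
    extendsUniquelyTempered hd e fun f g => by rw [he, hpair],
    (RoumieuDual.hasDiagonal hs).extendsUniquely hd RoumieuDual.coeff_injective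
      RoumieuDual.exists_coeff_eq RoumieuDual.continuous_coeff (RoumieuDual.dense_finite hs)
      h2 h1 hT,
    fun hs => (BeurlingDual.hasDiagonal hs).extendsUniquely hd BeurlingDual.coeff_injective
      BeurlingDual.exists_coeff_eq BeurlingDual.continuous_coeff (BeurlingDual.dense_finite hs)
      h2 h1 hT⟩

end Operators

end TwistedPilipovic

end

/-! ### Assembly of the eigenvalue relations and the mapping properties -/

theorem lemma2p3 (d : ℕ) (hd : 0 < d) (s : ℝ) (hs : 0 ≤ s) :
    -- the Hermite–Wong functions are eigenfunctions
    (∀ α : TwistedPilipovic.Idx d,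
      TwistedPilipovic.hermiteWong α ≠ 0 ∧
      TwistedPilipovic.Hσ d (TwistedPilipovic.hermiteWong α) =
        (2 * (TwistedPilipovic.len α.1 : ℂ) + (d : ℂ)) • TwistedPilipovic.hermiteWong α ∧
      TwistedPilipovic.Hσbar d (TwistedPilipovic.hermiteWong α) =
        (2 * (TwistedPilipovic.len α.2 : ℂ) + (d : ℂ)) • TwistedPilipovic.hermiteWong α ∧
      TwistedPilipovic.Tσ d (TwistedPilipovic.hermiteWong α) =
        ((2 * (TwistedPilipovic.len α.1 : ℂ) + (d : ℂ)) *
          (2 * (TwistedPilipovic.len α.2 : ℂ) + (d : ℂ))) • TwistedPilipovic.hermiteWong α) ∧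
    -- restrictions to the test function spaces and extensions to the distribution spaces
    (∀ T ∈ ({TwistedPilipovic.Hσ d, TwistedPilipovic.Hσbar d} :
        Set (SchwartzMap (TwistedPilipovic.Phase d) ℂ →L[ℂ]
          SchwartzMap (TwistedPilipovic.Phase d) ℂ)),
      TwistedPilipovic.RestrictsToHomeo T (TwistedPilipovic.Roumieu.coeff (d := d) (s := s)) ∧
      TwistedPilipovic.RestrictsToHomeo T (TwistedPilipovic.Beurling.coeff (d := d) (s := s)) ∧
      TwistedPilipovic.ExtendsUniquelyTempered T ∧
      TwistedPilipovic.ExtendsUniquely T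
        (TwistedPilipovic.RoumieuDual.coeff (d := d) (s := s)) ∧
      (0 < s → TwistedPilipovic.ExtendsUniquely T
        (TwistedPilipovic.BeurlingDual.coeff (d := d) (s := s)))) := by
  refine ⟨fun α => ⟨TwistedPilipovic.hermiteWong_ne_zero α, TwistedPilipovic.Hσ_hermiteWong α,
    TwistedPilipovic.Hσbar_hermiteWong α, ?_⟩, ?_⟩
  · rw [TwistedPilipovic.Tσ, ContinuousLinearMap.comp_apply, TwistedPilipovic.Hσbar_hermiteWong,
      map_smul, TwistedPilipovic.Hσ_hermiteWong, smul_smul, mul_comm]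
  -- Each of H_σ and H̄_σ is the transpose of the other, so each serves as `T'` for the other.
  · rintro T (rfl | rfl)
    · exact TwistedPilipovic.homeo_of_diagonal hd hs (fun α => Nat.le_add_right _ _)
        TwistedPilipovic.Hσ_hermiteWong TwistedPilipovic.hwCoeff_Hσbar
        TwistedPilipovic.pair_Hσ
    · refine TwistedPilipovic.homeo_of_diagonal hd hs (fun α => Nat.le_add_left _ _)
        TwistedPilipovic.Hσbar_hermiteWong TwistedPilipovic.hwCoeff_Hσ fun f g => ?_
      rw [TwistedPilipovic.pair_comm, ← TwistedPilipovic.pair_Hσ, TwistedPilipovic.pair_comm]
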